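/- Fix an integer $m\ge 1$ and write $\mathsf m_j(z)=\exp(t_jz^3+y_jz^2+x_jz)$ for $1\le j\le m$, $\mathsf m_0\equiv 1$, and $\Delta(z)=\mathrm{diag}(\mathsf m_1(z),\dots,\mathsf m_m(z),1)$, where $(x,y,t)\in\mathbb R^{3m}$. **Cubic admissible determinants.** Let $\Omega\subset\mathbb C$ be a finite union of disjoint oriented simple contours, each closed or extending to infinity in both directions (put $d\mu=dz$), or a set without accumulation points (put $\mu=$ counting measure). Let $F,G:\Omega\to\mathbb C^{m+1}$ be independent of $(x,y,t)$ with $F_i(u)G_i(u)=0$ for all $u\in\Omega$ and all $i$, let $c$ be a non-vanishing scalar function on $\Omega$, which may depend on $(x,y,t)$, and put $f=c\,\Delta F$, $g=c^{-1}\Delta^{-1}G$. The bounded operator $H$ on $L^2(\Omega,|d\mu|)$, $(H\varphi)(u)=\int_\Omega H(u,v)\varphi(v)\,d\mu(v)$, with kernel $H(u,v)=f(u)^Tg(v)/(u-v)$ for $u\ne v$ and $H(u,u)=0$, is *cubic integrable* if $f,g\in L^2\cap L^\infty$; it is *strongly* cubic integrable if moreover $\Omega$ is a union of contours and $F,G$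 are constant on each of them. If it is also trace class, then $\det(1-H)$ is called a *(strongly) cubic admissible determinant*. When $1-H$ is invertible put $Y_1(x,y,t)=\int_\Omega ((1-H)^{-1}f)(s)\,g(s)^T\,d\mu(s)$. **A class of operators.** Let $\Omega_{\ell,j}$ ($\ell=1,2$, $1\le j\le m$) be pairwise disjoint, $\Omega_\ell=\bigcup_j\Omega_{\ell,j}$, $\Omega=\Omega_1\cup\Omega_2$, let $A_j,B_j$ be functions on $\Omega$, and put $M_j=\mathsf m_j/\mathsf m_{j-1}$ for odd $j$ and $M_j=\mathsf m_{j-1}/\mathsf m_j$ for even $j$. Let $\widehat K_1,\widehat K_2$ have the kernels $$\widehat K_1(u,v)=\big(\delta_i(j)+\delta_i(j+(-1)^i)\big)\frac{M_i(u)A_i(u)B_j(v)}{u-v}\quad(u\in\Omega_{1,i},\ v\in\Omega_{2,j}),$$ $$\widehat K_2(u,v)=\big(\delta_i(j)+\delta_i(j-(-1)^i)\big)\frac{M_i(u)^{-1}A_i(u)B_j(v)}{u-v}\quad(u\in\Omega_{2,i},\ v\in\Omega_{1,j}),$$ and let $\det(1-\widehat K_1\widehat K_2)$ be defined by the Fredholm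 series of the kernel of $\widehat K_1\widehat K_2$ with respect to $d\mu$. The associated operator $H$ is given as above by $$F=P\begin{pmatrix}\Lambda_1&\Lambda_2-E_{11}\\0&E_{11}\end{pmatrix}\begin{pmatrix}\mathbf A\chi_1e\\ \mathbf A\chi_2e\end{pmatrix},\qquad G=P\begin{pmatrix}\Lambda_1&\Lambda_2-E_{11}\\0&E_{11}\end{pmatrix}\begin{pmatrix}\mathbf B\chi_2e\\ \mathbf B\chi_1e\end{pmatrix},$$ and $c=(\mathsf m_{j-1}\mathsf m_j)^{-1/2}:=\exp\big(-\tfrac12\sum_{i\in\{j-1,j\},\,i\ge1}(t_iz^3+y_iz^2+x_iz)\big)$ on $\Omega_{1,j}\cup\Omega_{2,j}$. Here $\mathbf A=\mathrm{diag}(A_j)$, $\mathbf B=\mathrm{diag}(B_j)$, $\chi_\ell=\mathrm{diag}(\chi_{\Omega_{\ell,j}})$, $e=(1,\dots,1)^T$, $P=(I_{m+1}\ 0)$, $E_{11}=\mathrm{diag}(1,0,\dots,0)$, $\Lambda_1=\mathrm{diag}(U,U,\dots)$ and $\Lambda_2=\mathrm{diag}(1,U,U,\dots)$ are $m\times m$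 with $U=\begin{pmatrix}1&1\\0&0\end{pmatrix}$ and with a last diagonal entry $1$ where a full block $U$ does not fit. **(i) KPZ fixed point.** Let $\zeta=(\zeta_1,\dots,\zeta_{m-1})$ with $0<|\zeta_i|<1$, and put $\zeta_0=\infty$, $\zeta_m=0$. Let $\Gamma_{m,L}^+,\dots,\Gamma_{2,L}^+,\Gamma_{1,L},\Gamma_{2,L}^-,\dots,\Gamma_{m,L}^-$ be horizontal translates, ordered from right to left, of a Lipschitz graph over the imaginary axis, all of them in the left half plane, oriented upwards, and extending from $\infty e^{-i\theta_1}$ to $\infty e^{i\theta_2}$ with $\theta_1,\theta_2\in(\pi/2,5\pi/6)$. Similarly let $\Gamma_{m,R}^+,\dots,\Gamma_{2,R}^+,\Gamma_{1,R},\Gamma_{2,R}^-,\dots,\Gamma_{m,R}^-$ be such translates, ordered from left to right, in the right half plane, oriented upwards, with end angles $-\theta_1',\theta_2'$, $\theta'_1,\theta_2'\in(\pi/6,\pi/2)$. Put $\Gamma_{j,\bullet}=\Gamma_{j,\bullet}^+\cup\Gamma_{j,\bullet}^-$ for $j\ge2$. Let $\Omega_{1,j}=\Gamma_{j,L}$,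 $\Omega_{2,j}=\Gamma_{j,R}$ for odd $j$ and $\Omega_{1,j}=\Gamma_{j,R}$, $\Omega_{2,j}=\Gamma_{j,L}$ for even $j$. Let $A_j=1$, $B_j=Q_jP_j$, where $Q_j=-(1-\frac1{\zeta_{j-1}})\chi_{\Omega_{1,j}}+(1-\zeta_j)\chi_{\Omega_{2,j}}$ for odd $j$, $Q_j=-(1-\zeta_j)\chi_{\Omega_{1,j}}+(1-\frac1{\zeta_{j-1}})\chi_{\Omega_{2,j}}$ for even $j$, and $P_1=\frac1{2\pi i}$, while for $j\ge 2$, $P_j=\frac1{2\pi i(1-\zeta_{j-1})}$ on $\Gamma_{j,L}^+\cup\Gamma_{j,R}^+$ and $P_j=\frac{-\zeta_{j-1}}{2\pi i(1-\zeta_{j-1})}$ on $\Gamma_{j,L}^-\cup\Gamma_{j,R}^-$. Let $D(h,\gamma,\tau\mid\zeta)=\det(1-\widehat K_1\widehat K_2)$ be the resulting determinant of Liu for the parameters $t_i=-\tau_i/3$, $y_i=\gamma_i$, $x_i=h_i$. * If $0<\tau_1<\dots<\tau_m$, the series for $D$ converges absolutely, the associated $H$ is a trace class strongly cubic integrable operator,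 and $D(h,\gamma,\tau\mid\zeta)=\det(1-H)$. So $D$, as a function of $(x,y,t)$, is a strongly cubic admissible determinant. * If moreover the left end angles are in $(\pi/2,3\pi/4)$ and the right ones in $(\pi/6,\pi/4)$, the same holds for all parameters with $0<\tau_1\le\dots\le\tau_m$ and $\gamma_i<\gamma_{i+1}$ whenever $\tau_i=\tau_{i+1}$. * Suppose that the right contours are the images of the corresponding left contours under $z\mapsto-z$, with the orientation reversed. If $0<\tau_1<\dots<\tau_m$ and $1-H$ is invertible at $(x,y,t)$, then it is invertible at $(x,-y,t)$, and $$L\,Y_1(x,y,t)\,L^{-1}=Y_1(x,-y,t)^T,\quad L=\mathrm{diag}(L_1,\dots,L_m,1),\quad L_j=(-1)^j\frac{(1-\zeta_1)\cdots(1-\zeta_j)}{(1-\frac1{\zeta_1})\cdots(1-\frac1{\zeta_{j-1}})}.$$ **(ii) Periodic KPZ fixed point.** Let $\zeta=(\zeta_1,\dots,\zeta_m)$ with $0<|\zeta_1|<\dots<|\zeta_m|<1$, and put $\zeta_0=\zeta_{m+1}=0$. Let $S_{j,L}$ and $S_{j,R}$ be the sets of roots of $e^{-s^2/2}=\zeta_j$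 with $\mathrm{Re}\,s<0$ and $\mathrm{Re}\,s>0$. Let $\Omega_{1,j}=S_{j,L}$, $\Omega_{2,j}=S_{j,R}$ for odd $j$, and the other way around for even $j$. Let $H_j(z)=\exp\big(-\int_{-i\infty}^{i\infty}\frac{\log(1-\zeta_je^{w^2/2})}{w-z}dw\big)$ for $\mathrm{Re}\,z<0$ and $H_j(z)=H_j(-z)$ for $\mathrm{Re}\,z>0$ (so $H_0=H_{m+1}=1$). On $S_{j,L}\cup S_{j,R}$ let $H_j^\ast=H_{j+1}$ on $S_{j,L}$, $H_j^\ast=H_{j-1}$ on $S_{j,R}$, and $$A_j=\frac{H_j^\ast(z)}{zH_j(z)},\qquad B_j=\Big(\big(1-\tfrac{\zeta_{j-(-1)^j}}{\zeta_j}\big)\chi_{\Omega_{1,j}}+\big(1-\tfrac{\zeta_{j+(-1)^j}}{\zeta_j}\big)\chi_{\Omega_{2,j}}\Big)H_j^\ast .$$ Let $D^{\mathrm{per}}(h,\gamma,\tau\mid\zeta)=\det(1-\widehat K_1\widehat K_2)$ be the resulting determinant for the parameters $t_i=-\tau_i/3$, $y_i=\gamma_i/2$, $x_i=h_i$. If $0<\tau_1\le\dots\le\tau_m$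 and $h_i<h_{i+1}$ whenever $\tau_i=\tau_{i+1}$, then the series for $D^{\mathrm{per}}$ converges absolutely, the associated $H$ is a trace class cubic integrable operator on $\ell^2(\Omega)$, and $D^{\mathrm{per}}(h,\gamma,\tau\mid\zeta)=\det(1-H)$. So $D^{\mathrm{per}}$, as a function of $(x,y,t)$, is a cubic admissible determinant. -/

import Mathlib

open MeasureTheory Filter Topology

noncomputable section

namespace KPZ

/-! ### Contours, discrete sets and their Hilbert spaces -/

/-- A curve in the complex plane, given by a parametrization restricted to a set of parameters. -/
structure ParamCurve where
  dom : Set ℝ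
  toFun : ℝ → ℂ

/-- The set of points of the curve. -/
def ParamCurve.image (γ : ParamCurve) : Set ℂ := γ.toFun '' γ.dom

/-- A simple, locally rectifiable, oriented contour without finite endpoints: either it extends
to infinity in both directions, or it is closed (parametrized over one period). -/
def ParamCurve.IsSimpleContour (γ : ParamCurve) : Prop :=
  LocallyLipschitz γ.toFun ∧
    ((γ.dom = Set.univ ∧ Function.Injective γ.toFun ∧
        Tendsto γ.toFun (cocompact ℝ) (cocompact ℂ)) ∨
      (γ.dom = Set.Ico 0 1 ∧ Function.Periodic γ.toFun 1 ∧ Set.InjOn γ.toFun (Set.Ico 0 1)))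

/-- The arc length measure `|dz|` of a curve, as a measure on `ℂ`. -/
def ParamCurve.arcMeasure (γ : ParamCurve) : Measure ℂ :=
  ((volume.restrict γ.dom).withDensity fun s => ‖deriv γ.toFun s‖ₑ).map γ.toFun

/-- The sets `Ω` on which the operators live: unions of contours, or discrete sets. -/
inductive SpectralSet : Type 1
  | contours {ι : Type} (γ : ι → ParamCurve) : SpectralSet
  | discrete (S : Set ℂ) : SpectralSet

namespace SpectralSet

/-- The underlying set of points. -/
def carrier : SpectralSet → Set ℂ
  | contours γ => ⋃ i, (γ i).image
  | discrete S => S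

/-- `Ω` is a finite union of pairwise disjoint simple contours, or a set without accumulation
points. -/
def IsValid : SpectralSet → Prop
  | @contours ι γ => Finite ι ∧ (∀ i, (γ i).IsSimpleContour) ∧
      ∀ i j, i ≠ j → Disjoint (γ i).image (γ j).image
  | discrete S => ∀ z : ℂ, ¬ AccPt z (𝓟 S)

/-- The positive measure `|dμ|`: arc length on contours, counting measure on discrete sets. -/
def absMeasure : SpectralSet → Measure ℂ
  | contours γ => Measure.sum fun i => (γ i).arcMeasure
  | discrete S => Measure.count.restrict S

open Classical in
/-- The density of `dμ` with respect to `|dμ|`: on contours `dμ = dz`, so this is the unit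
tangent vector; on discrete sets it is `1`. -/
def phase : SpectralSet → ℂ → ℂ
  | @contours ι γ => fun z =>
      if h : ∃ q : ι × ℝ, q.2 ∈ (γ q.1).dom ∧ (γ q.1).toFun q.2 = z then
        deriv (γ h.choose.1).toFun h.choose.2 / (‖deriv (γ h.choose.1).toFun h.choose.2‖ : ℂ)
      else 0
  | discrete _ => fun _ => 1

/-- The Hilbert space `L²(Ω, |dμ|)`. -/
abbrev L2 (Ω : SpectralSet) : Type := Lp ℂ 2 Ω.absMeasure

/-- The integral `∫_Ω φ dμ`. -/
def integral (Ω : SpectralSet) (φ : ℂ → ℂ) : ℂ := ∫ z, φ z * Ω.phase z ∂Ω.absMeasure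

open Classical in
/-- The class in `L²` of a square integrable function. -/
def toL2 (Ω : SpectralSet) (φ : ℂ → ℂ) : Ω.L2 :=
  if h : MemLp φ 2 Ω.absMeasure then h.toLp φ else 0

/-- `T` is the integral operator `(Tφ)(u) = ∫_Ω K(u,v) φ(v) dμ(v)`. -/
def IsIntegralOperator (Ω : SpectralSet) (K : ℂ → ℂ → ℂ) (T : Ω.L2 →L[ℂ] Ω.L2) : Prop :=
  ∀ φ : Ω.L2, ∀ᵐ u ∂Ω.absMeasure,
    Integrable (fun v => K u v * φ v * Ω.phase v) Ω.absMeasure ∧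
      T φ u = Ω.integral fun v => K u v * φ v

/-- The `n`-th integrand of the Fredholm series of the kernel `K`. -/
def fredholmIntegrand (Ω : SpectralSet) (K : ℂ → ℂ → ℂ) (n : ℕ) (u : Fin n → ℂ) : ℂ :=
  (Matrix.of fun i j => K (u i) (u j)).det * ∏ i, Ω.phase (u i)

/-- The `n`-th term
`(-1)ⁿ/n! ∫_Ω ⋯ ∫_Ω det[K(u_i,u_j)] dμ(u_1) ⋯ dμ(u_n)` of the Fredholm series. -/
def fredholmTerm (Ω : SpectralSet) (K : ℂ → ℂ → ℂ) (n : ℕ) : ℂ :=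
  (-1) ^ n / (n.factorial : ℂ) *
    ∫ u : Fin n → ℂ, Ω.fredholmIntegrand K n u ∂(Measure.pi fun _ => Ω.absMeasure)

/-- All integrals of the Fredholm series converge, and the series converges absolutely. -/
def FredholmSeriesConverges (Ω : SpectralSet) (K : ℂ → ℂ → ℂ) : Prop :=
  (∀ n, Integrable (Ω.fredholmIntegrand K n) (Measure.pi fun _ => Ω.absMeasure)) ∧
    Summable (Ω.fredholmTerm K)

/-- The Fredholm determinant `det(1 - K)` of a kernel, as a series. -/
def fredholmSeries (Ω : SpectralSet) (K : ℂ → ℂ → ℂ) : ℂ := ∑' n, Ω.fredholmTerm K n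

end SpectralSet

/-! ### Trace class operators and their Fredholm determinants -/

section Operators

variable {E : Type} [NormedAddCommGroup E] [InnerProductSpace ℂ E] [CompleteSpace E]

/-- `T` is trace class (nuclear): `T = ∑ₙ ⟨aₙ, ·⟩ bₙ` with `∑ₙ ‖aₙ‖ ‖bₙ‖ < ∞`. -/
def IsTraceClass (T : E →L[ℂ] E) : Prop :=
  ∃ a b : ℕ → E, (Summable fun n => ‖a n‖ * ‖b n‖) ∧
    ∀ x, HasSum (fun n => (inner ℂ (a n) x) • b n) (T x)

/-- `det(1 - T) = d`, where `det(1 - T) = ∑ₙ (-1)ⁿ Tr(Λⁿ T)`; computed in any orthonormal basis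
this is the sum over finite sets `S` of basis vectors of the principal minors of `-T`. -/
def HasFredholmDet (T : E →L[ℂ] E) (d : ℂ) : Prop :=
  ∀ (ι : Type) (b : HilbertBasis ι ℂ E), HasSum
    (fun S : Finset ι => by
      classical
      exact (Matrix.of fun i j : S => -inner ℂ (b (i : ι)) (T (b (j : ι)))).det) d

end Operators

/-! ### Cubic integrable operators -/

/-- The `3m` real parameters. -/
structure CubicParams (m : ℕ) where
  x : Fin m → ℝ
  y : Fin m → ℝ
  t : Fin m → ℝ

/-- The parameters `(x, -y, t)`. -/
def CubicParams.negY {m : ℕ} (p : CubicParams m) : CubicParams m := ⟨p.x, -p.y, p.t⟩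

/-- The cubic polynomial `t_j z³ + y_j z² + x_j z` for `1 ≤ j ≤ m`, and `0` for other `j`. -/
def CubicParams.expo {m : ℕ} (p : CubicParams m) (j : ℕ) (z : ℂ) : ℂ :=
  if h : 1 ≤ j ∧ j ≤ m then
    (p.t ⟨j - 1, by omega⟩ : ℂ) * z ^ 3 + (p.y ⟨j - 1, by omega⟩ : ℂ) * z ^ 2
      + (p.x ⟨j - 1, by omega⟩ : ℂ) * z
  else 0

/-- The cubic exponential functions `m_j(z)`; in particular `m_0 = m_{m+1} = 1`. -/
def CubicParams.expFun {m : ℕ} (p : CubicParams m) (j : ℕ) (z : ℂ) : ℂ := Complex.exp (p.expo j z)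

/-- The diagonal of `Δ(z) = diag(m_1(z), …, m_m(z), 1)`. -/
def CubicParams.diagDelta {m : ℕ} (p : CubicParams m) (z : ℂ) (i : Fin (m + 1)) : ℂ :=
  p.expFun (i + 1) z

/-- The data from which a parameter dependent family of IIKS operators is built: the set `Ω`, the
parameter independent vectors `F, G`, and the scalar `c`. -/
structure CubicFamily (m : ℕ) where
  Ω : SpectralSet
  F : ℂ → Fin (m + 1) → ℂ
  G : ℂ → Fin (m + 1) → ℂ
  c : CubicParams m → ℂ → ℂ

namespace CubicFamily

variable {m : ℕ} (D : CubicFamily m)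

/-- `f = c Δ F`. -/
def f (p : CubicParams m) (u : ℂ) (i : Fin (m + 1)) : ℂ := D.c p u * p.diagDelta u i * D.F u i

/-- `g = c⁻¹ Δ⁻¹ G`. -/
def g (p : CubicParams m) (u : ℂ) (i : Fin (m + 1)) : ℂ :=
  (D.c p u)⁻¹ * (p.diagDelta u i)⁻¹ * D.G u i

open Classical in
/-- `H(u,v) = f(u)ᵀ g(v) / (u - v)` for `u ≠ v`, and `H(u,u) = 0`. -/
def kernel (p : CubicParams m) (u v : ℂ) : ℂ :=
  if u = v then 0 else (∑ i, D.f p u i * D.g p v i) / (u - v)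

open Classical in
/-- The bounded operator on `L²(Ω)` with kernel `H` (and `0` if there is none). -/
def operator (p : CubicParams m) : D.Ω.L2 →L[ℂ] D.Ω.L2 :=
  if h : ∃ T, D.Ω.IsIntegralOperator (D.kernel p) T then h.choose else 0

/-- `H` is a cubic integrable operator at the parameters `p`. -/
structure IsCubicIntegrable (p : CubicParams m) : Prop where
  valid : D.Ω.IsValid
  orthogonal : ∀ u ∈ D.Ω.carrier, ∀ i, D.F u i * D.G u i = 0
  scalar_ne_zero : ∀ u ∈ D.Ω.carrier, D.c p u ≠ 0
  f_memL2 : ∀ i, MemLp (fun u => D.f p u i) 2 D.Ω.absMeasure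
  f_memLinf : ∀ i, MemLp (fun u => D.f p u i) ⊤ D.Ω.absMeasure
  g_memL2 : ∀ i, MemLp (fun u => D.g p u i) 2 D.Ω.absMeasure
  g_memLinf : ∀ i, MemLp (fun u => D.g p u i) ⊤ D.Ω.absMeasure
  bounded : ∃ T, D.Ω.IsIntegralOperator (D.kernel p) T

/-- `Ω` is a union of contours, and `F, G` are constant on each of them. (The contours of a valid
`Ω` are its connected components.) -/
def IsPiecewiseConstant : Prop :=
  match D.Ω with
  | .contours γ => ∀ i, ∃ a b, ∀ u ∈ (γ i).image, D.F u = a ∧ D.G u = b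
  | .discrete _ => False

/-- On the parameter set `P`, the function `d` is the cubic admissible determinant of the family:
the operators are cubic integrable and trace class, with Fredholm determinant `d`. -/
def IsAdmissibleDet (P : Set (CubicParams m)) (d : CubicParams m → ℂ) : Prop :=
  ∀ p ∈ P, D.IsCubicIntegrable p ∧ IsTraceClass (D.operator p) ∧ HasFredholmDet (D.operator p) (d p)

/-- The strongly cubic version of `IsAdmissibleDet`. -/
def IsStronglyAdmissibleDet (P : Set (CubicParams m)) (d : CubicParams m → ℂ) : Prop :=
  D.IsPiecewiseConstant ∧ D.IsAdmissibleDet P d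

/-- The matrix `Y₁ = ∫_Ω ((1 - H)⁻¹ f)(s) g(s)ᵀ dμ(s)`, meaningful when `1 - H` is invertible. -/
def Y1 (p : CubicParams m) : Matrix (Fin (m + 1)) (Fin (m + 1)) ℂ :=
  Matrix.of fun i j => D.Ω.integral fun s =>
    (Ring.inverse (1 - D.operator p) (D.Ω.toL2 fun u => D.f p u i)) s * D.g p s j

end CubicFamily

/-! ### The class of operators arising in multi-point distributions

Indices `i, j` run over `1, …, m`. -/

/-- The characteristic function of a set. -/
def chi (S : Set ℂ) (z : ℂ) : ℂ := S.indicator (fun _ => 1) z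

/-- The sets `Ω_{1,j}, Ω_{2,j}`, their union `Ω`, and the functions `A_j, B_j`. -/
structure KernelData where
  Ω : SpectralSet
  set1 : ℕ → Set ℂ
  set2 : ℕ → Set ℂ
  A : ℕ → ℂ → ℂ
  B : ℕ → ℂ → ℂ

/-- `M = diag(m_1, m_1/m_2, m_3/m_2, m_3/m_4, …)`. -/
def CubicParams.ratio {m : ℕ} (p : CubicParams m) (j : ℕ) (z : ℂ) : ℂ :=
  if Odd j then p.expFun j z / p.expFun (j - 1) z else p.expFun (j - 1) z / p.expFun j z

namespace KernelData

variable (m : ℕ) (K : KernelData) (p : CubicParams m)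

/-- The kernel of `K̂₁ : L²(Ω₂) → L²(Ω₁)`, extended by zero. -/
def kernel1 (u v : ℂ) : ℂ :=
  ∑ i ∈ Finset.Icc 1 m, ∑ j ∈ Finset.Icc 1 m,
    chi (K.set1 i) u * chi (K.set2 j) v *
      (((if j = i then 1 else 0) + (if (j : ℤ) + (-1) ^ i = i then 1 else 0) : ℂ) *
        (p.ratio i u * K.A i u * K.B j v / (u - v)))

/-- The kernel of `K̂₂ : L²(Ω₁) → L²(Ω₂)`, extended by zero. -/
def kernel2 (u v : ℂ) : ℂ :=
  ∑ i ∈ Finset.Icc 1 m, ∑ j ∈ Finset.Icc 1 m,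
    chi (K.set2 i) u * chi (K.set1 j) v *
      (((if j = i then 1 else 0) + (if (j : ℤ) - (-1) ^ i = i then 1 else 0) : ℂ) *
        ((p.ratio i u)⁻¹ * K.A i u * K.B j v / (u - v)))

/-- The kernel of `K̂₁ K̂₂`. -/
def prodKernel (u u' : ℂ) : ℂ := K.Ω.integral fun v => K.kernel1 m p u v * K.kernel2 m p v u'

/-- The series for `det(1 - K̂₁ K̂₂)` is well defined. -/
def WellDefined : Prop :=
  (∀ u ∈ K.Ω.carrier, ∀ u' ∈ K.Ω.carrier, Integrable
      (fun v => K.kernel1 m p u v * K.kernel2 m p v u' * K.Ω.phase v) K.Ω.absMeasure) ∧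
    K.Ω.FredholmSeriesConverges (K.prodKernel m p)

/-- `det(1 - K̂₁ K̂₂)`. -/
def det : ℂ := K.Ω.fredholmSeries (K.prodKernel m p)

/-- `Λ₁ = diag(U, U, …)` with `U = (1 1; 0 0)`, the last block being `1` if `m` is odd. -/
def Lambda1 : Matrix (Fin m) (Fin m) ℂ :=
  Matrix.of fun i j => if Even (i : ℕ) ∧ ((j : ℕ) = i ∨ (j : ℕ) = i + 1) then 1 else 0

/-- `Λ₂ = diag(1, U, U, …)`, the last block being `1` if `m` is even. -/
def Lambda2 : Matrix (Fin m) (Fin m) ℂ :=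
  Matrix.of fun i j =>
    if ((i : ℕ) = 0 ∧ (j : ℕ) = 0) ∨ (Odd (i : ℕ) ∧ ((j : ℕ) = i ∨ (j : ℕ) = i + 1)) then 1 else 0

/-- `E₁₁ = diag(1, 0, …, 0)`. -/
def E11 : Matrix (Fin m) (Fin m) ℂ :=
  Matrix.of fun i j => if (i : ℕ) = 0 ∧ (j : ℕ) = 0 then 1 else 0

/-- The first `m + 1` entries of the product of the `2m × 2m` matrix
`(Λ₁  Λ₂ - E₁₁; 0  E₁₁)` with the column vector `(a; b)`. -/
def assemble (a b : Fin m → ℂ) (i : Fin (m + 1)) : ℂ :=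
  if h : (i : ℕ) < m then
    ((Lambda1 m).mulVec a + (Lambda2 m - E11 m).mulVec b) ⟨i, h⟩
  else if h : 0 < m then (E11 m).mulVec b ⟨0, h⟩ else 0

/-- The integrable operator obtained from the data, with
`F = (Λ₁  Λ₂ - E₁₁; 0  E₁₁) (A χ₁ e; A χ₂ e)`, `G = (Λ₁  Λ₂ - E₁₁; 0  E₁₁) (B χ₂ e; B χ₁ e)` (first
`m + 1` entries) and `c = (m_{j-1} m_j)^{-1/2}` on `Ω_{1,j} ∪ Ω_{2,j}`, where `m_0 = 1`. -/
def family : CubicFamily m where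
  Ω := K.Ω
  F := fun z => assemble m (fun j => K.A (j + 1) z * chi (K.set1 (j + 1)) z)
    (fun j => K.A (j + 1) z * chi (K.set2 (j + 1)) z)
  G := fun z => assemble m (fun j => K.B (j + 1) z * chi (K.set2 (j + 1)) z)
    (fun j => K.B (j + 1) z * chi (K.set1 (j + 1)) z)
  c := fun p z => ∑ j ∈ Finset.Icc 1 m, (chi (K.set1 j) z + chi (K.set2 j) z) *
    Complex.exp (-(p.expo (j - 1) z + p.expo j z) / 2)

end KernelData

/-! ### The KPZ fixed point -/

/-- The data of the contours. The contour with label `k` is the graph, oriented upwards, of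
`-(aL k + φL)` (on the left) or of `aR k + φR` (on the right) over the imaginary axis. The label
`k = 0` belongs to `Γ_1`, the label `j - 1 > 0` to `Γ_j⁺`, and `-(j - 1) < 0` to `Γ_j⁻`. -/
structure ContourSystem where
  φL : ℝ → ℝ
  φR : ℝ → ℝ
  aL : ℤ → ℝ
  aR : ℤ → ℝ

namespace ContourSystem

variable (C : ContourSystem)

/-- The left contour with label `k`. -/
def leftCurve (k : ℤ) (s : ℝ) : ℂ := ⟨-(C.aL k + C.φL s), s⟩

/-- The right contour with label `k`. -/
def rightCurve (k : ℤ) (s : ℝ) : ℂ := ⟨C.aR k + C.φR s, s⟩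

/-- The upper end of the curve extends to `∞ e^{iθ₂}`, and the lower end to `∞ e^{-iθ₁}`, for some
angles `θ₁, θ₂` strictly between `α` and `β`. -/
def TailsIn (γ : ℝ → ℂ) (α β : ℝ) : Prop :=
  ∃ θ₁ ∈ Set.Ioo α β, ∃ θ₂ ∈ Set.Ioo α β,
    Tendsto (fun s => Complex.arg (γ s)) atTop (𝓝 θ₂) ∧
      Tendsto (fun s => Complex.arg (γ s)) atBot (𝓝 (-θ₁))

/-- The left contours end in the sectors `π/2 < |arg z| < α` and the right contours in the sectors
`π/6 < |arg z| < β`. -/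
def EndsIn (α β : ℝ) : Prop :=
  ∀ k, TailsIn (C.leftCurve k) (Real.pi / 2) α ∧ TailsIn (C.rightCurve k) (Real.pi / 6) β

/-- The contours are Lipschitz graphs, the left ones lie in the left half plane and the right ones
in the right half plane, they are closer to the imaginary axis the larger the label is, and they
extend to infinity in the sectors where the relevant cubic exponentials decay. -/
structure IsAdmissible (m : ℕ) : Prop where
  lipL : ∃ κ, LipschitzWith κ C.φL
  lipR : ∃ κ, LipschitzWith κ C.φR
  order : ∀ k l : ℤ, k.natAbs < m → l.natAbs < m → k < l → C.aL l < C.aL k ∧ C.aR l < C.aR k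
  halfPlanes : ∀ k : ℤ, k.natAbs < m → ∀ s, 0 < C.aL k + C.φL s ∧ 0 < C.aR k + C.φR s
  ends : C.EndsIn (5 * Real.pi / 6) (Real.pi / 2)

/-- Each right contour is the image of the corresponding left contour under `z ↦ -z` (with the
orientation reversed). -/
def IsSymmetric (m : ℕ) : Prop :=
  ∀ k : ℤ, k.natAbs < m → ∀ s, C.rightCurve k s = -C.leftCurve k (-s)

/-- `Ω`, the union of the `2(2m-1)` contours. -/
def omega (m : ℕ) : SpectralSet :=
  .contours (ι := Bool × {k : ℤ // k.natAbs < m}) fun q =>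
    ⟨Set.univ, if q.1 then C.leftCurve q.2 else C.rightCurve q.2⟩

/-- `Γ_{j,L} = Γ_{j,L}⁺ ∪ Γ_{j,L}⁻`, and `Γ_{1,L}` for `j = 1`. -/
def gammaL (j : ℕ) : Set ℂ :=
  Set.range (C.leftCurve ((j : ℤ) - 1)) ∪ Set.range (C.leftCurve (-((j : ℤ) - 1)))

/-- `Γ_{j,R} = Γ_{j,R}⁺ ∪ Γ_{j,R}⁻`, and `Γ_{1,R}` for `j = 1`. -/
def gammaR (j : ℕ) : Set ℂ :=
  Set.range (C.rightCurve ((j : ℤ) - 1)) ∪ Set.range (C.rightCurve (-((j : ℤ) - 1)))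

/-- `Ω_{1,j}`. -/
def set1 (j : ℕ) : Set ℂ := if Odd j then C.gammaL j else C.gammaR j

/-- `Ω_{2,j}`. -/
def set2 (j : ℕ) : Set ℂ := if Odd j then C.gammaR j else C.gammaL j

end ContourSystem

section KPZFixedPoint

variable {m : ℕ} (ζ : Fin (m - 1) → ℂ)

/-- `1 - ζ_j` for `1 ≤ j ≤ m`, with `ζ_m = 0`. -/
def oneSub (j : ℕ) : ℂ := if h : 1 ≤ j ∧ j < m then 1 - ζ ⟨j - 1, by omega⟩ else 1

/-- `1 - 1/ζ_j` for `0 ≤ j < m`, with `ζ_0 = ∞`. -/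
def oneSubInv (j : ℕ) : ℂ := if h : 1 ≤ j ∧ j < m then 1 - 1 / ζ ⟨j - 1, by omega⟩ else 1

variable (C : ContourSystem)

/-- `Q_j = -Q_2(j) χ_{Ω_{1,j}} + Q_1(j) χ_{Ω_{2,j}}`, where `Q_1(j) = 1 - ζ_j`,
`Q_2(j) = 1 - 1/ζ_{j-1}` for odd `j`, and the other way around for even `j`. -/
def kpzQ (j : ℕ) (z : ℂ) : ℂ :=
  if Odd j then
    -oneSubInv ζ (j - 1) * chi (C.set1 j) z + oneSub ζ j * chi (C.set2 j) z
  else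
    -oneSub ζ j * chi (C.set1 j) z + oneSubInv ζ (j - 1) * chi (C.set2 j) z

open Classical in
/-- `1/(2πi)` on `Γ_1`, `1/(2πi(1-ζ_{j-1}))` on `Γ_j⁺`, `-ζ_{j-1}/(2πi(1-ζ_{j-1}))` on `Γ_j⁻`.
Here `-ζ = (1 - ζ) - 1`. -/
def kpzP (j : ℕ) (z : ℂ) : ℂ :=
  if j = 1 then 1 / (2 * Real.pi * Complex.I)
  else if z ∈ Set.range (C.leftCurve ((j : ℤ) - 1)) ∪ Set.range (C.rightCurve ((j : ℤ) - 1)) then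
    1 / (2 * Real.pi * Complex.I * oneSub ζ (j - 1))
  else (oneSub ζ (j - 1) - 1) / (2 * Real.pi * Complex.I * oneSub ζ (j - 1))

/-- The data of the operators `K̂₁, K̂₂` of the KPZ fixed point. -/
def kpzData : KernelData where
  Ω := C.omega m
  set1 := C.set1
  set2 := C.set2
  A := fun _ _ => 1
  B := fun j z => kpzQ ζ C j z * kpzP ζ C j z

/-- The parameters `x_i = h_i`, `y_i = γ_i`, `t_i = -τ_i/3`. -/
def kpzParams (h γ τ : Fin m → ℝ) : CubicParams m := ⟨h, γ, fun i => -τ i / 3⟩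

/-- Liu's Fredholm determinant `D(h, γ, τ | ζ)` of the KPZ fixed point. -/
def kpzDet (h γ τ : Fin m → ℝ) : ℂ := (kpzData ζ C).det m (kpzParams h γ τ)

/-- The diagonal matrix `L = diag(L_1, …, L_m, 1)`. -/
def kpzL : Matrix (Fin (m + 1)) (Fin (m + 1)) ℂ :=
  Matrix.diagonal fun i =>
    if (i : ℕ) < m then
      (-1) ^ ((i : ℕ) + 1) * (∏ k ∈ Finset.Icc 1 ((i : ℕ) + 1), oneSub ζ k) /
        ∏ k ∈ Finset.Icc 1 (i : ℕ), oneSubInv ζ k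
    else 1

end KPZFixedPoint

/-- Parameters of the KPZ fixed point, with `t_i = -τ_i/3` and `y_i = γ_i`:
`0 < τ_1 ≤ ⋯ ≤ τ_m`, and `γ_i < γ_{i+1}` whenever `τ_i = τ_{i+1}`. -/
def kpzRegion (m : ℕ) : Set (CubicParams m) :=
  {p | (∀ i, 0 < -3 * p.t i) ∧ ∀ i j : Fin m, (i : ℕ) + 1 = j →
    -3 * p.t i ≤ -3 * p.t j ∧ (-3 * p.t i = -3 * p.t j → p.y i < p.y j)}

/-- Parameters with `0 < τ_1 < ⋯ < τ_m`, where `t_i = -τ_i/3`. -/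
def kpzStrictRegion (m : ℕ) : Set (CubicParams m) :=
  {p | (∀ i, 0 < -3 * p.t i) ∧ ∀ i j : Fin m, (i : ℕ) + 1 = j → -3 * p.t i < -3 * p.t j}

/-! ### The periodic KPZ fixed point -/

section Periodic

variable {m : ℕ} (ζ : Fin m → ℂ)

/-- `ζ_j` for `1 ≤ j ≤ m`, with `ζ_0 = ζ_{m+1} = 0`. -/
def perZeta (j : ℕ) : ℂ := if h : 1 ≤ j ∧ j ≤ m then ζ ⟨j - 1, by omega⟩ else 0

/-- The Bethe roots in the left half plane. -/
def betheL (j : ℕ) : Set ℂ := {s | Complex.exp (-s ^ 2 / 2) = perZeta ζ j ∧ s.re < 0}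

/-- The Bethe roots in the right half plane. -/
def betheR (j : ℕ) : Set ℂ := {s | Complex.exp (-s ^ 2 / 2) = perZeta ζ j ∧ 0 < s.re}

/-- `Ω_{1,j}`. -/
def perSet1 (j : ℕ) : Set ℂ := if Odd j then betheL ζ j else betheR ζ j

/-- `Ω_{2,j}`. -/
def perSet2 (j : ℕ) : Set ℂ := if Odd j then betheR ζ j else betheL ζ j

/-- `Q_{1,j} = 1 - ζ_{j-(-1)^j} / ζ_j`. -/
def perQ1 (j : ℕ) : ℂ := 1 - perZeta ζ (if Odd j then j + 1 else j - 1) / perZeta ζ j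

/-- `Q_{2,j} = 1 - ζ_{j+(-1)^j} / ζ_j`. -/
def perQ2 (j : ℕ) : ℂ := 1 - perZeta ζ (if Odd j then j - 1 else j + 1) / perZeta ζ j

/-- The function `H_j`, where the integral over the imaginary axis is written with `w = iy`.
In particular `H_0 = H_{m+1} = 1`. -/
def perH (j : ℕ) (z : ℂ) : ℂ :=
  if z.re < 0 then
    Complex.exp (-∫ y : ℝ, Complex.log (1 - perZeta ζ j * Complex.exp ((y * Complex.I) ^ 2 / 2)) /
      (y * Complex.I - z) * Complex.I)
  else
    Complex.exp (-∫ y : ℝ, Complex.log (1 - perZeta ζ j * Complex.exp ((y * Complex.I) ^ 2 / 2)) /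
      (y * Complex.I + z) * Complex.I)

/-- `H_{j+1}` in the left half plane and `H_{j-1}` in the right half plane. -/
def perHShift (j : ℕ) (z : ℂ) : ℂ := if z.re < 0 then perH ζ (j + 1) z else perH ζ (j - 1) z

/-- The data of the operators `K̂₁, K̂₂` of the periodic KPZ fixed point. -/
def perData : KernelData where
  Ω := .discrete (⋃ j ∈ Finset.Icc 1 m, perSet1 ζ j ∪ perSet2 ζ j)
  set1 := perSet1 ζ
  set2 := perSet2 ζ
  A := fun j z => 1 / (z * perH ζ j z) * perHShift ζ j z
  B := fun j z => (perQ1 ζ j * chi (perSet1 ζ j) z + perQ2 ζ j * chi (perSet2 ζ j) z) *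
    perHShift ζ j z

/-- The parameters `x_i = h_i`, `y_i = γ_i/2`, `t_i = -τ_i/3`. -/
def perParams (h γ τ : Fin m → ℝ) : CubicParams m := ⟨h, fun i => γ i / 2, fun i => -τ i / 3⟩

/-- The Fredholm determinant of the periodic KPZ fixed point. -/
def perDet (h γ τ : Fin m → ℝ) : ℂ := (perData ζ).det m (perParams h γ τ)

end Periodic

/-- Parameters of the periodic KPZ fixed point, with `t_i = -τ_i/3` and `x_i = h_i`:
`0 < τ_1 ≤ ⋯ ≤ τ_m`, and `h_i < h_{i+1}` whenever `τ_i = τ_{i+1}`. -/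
def perRegion (m : ℕ) : Set (CubicParams m) :=
  {p | (∀ i, 0 < -3 * p.t i) ∧ ∀ i j : Fin m, (i : ℕ) + 1 = j →
    -3 * p.t i ≤ -3 * p.t j ∧ (-3 * p.t i = -3 * p.t j → p.x i < p.x j)}

end KPZ

end

set_option linter.unusedSectionVars false

/-! ### Finite-dimensional determinant inequalities and expansions. -/

namespace KPZ

/-! The algebraic core is that `H` only maps between `Ω₁` and `Ω₂`. A point of `Ω_{1,j}` carries `F`
in the component labelled by the odd member of {j-1, j} and `G` in the one labelled by the even
member; on `Ω_{2,j}` it is the other way around (label 0 means the last component). Hence F_i G_i =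
0, and F(u)ᵀG(v) vanishes when u and v lie both in `Ω₁` or both in `Ω₂`. The choice of the scalar c
gives f and g one common exponential factor `halfExp`, whose square is M_j on `Ω_{1,j}` and 1/M_j on
`Ω_{2,j}`. So the two off-diagonal blocks of H are the kernels of K̂₁ and K̂₂ conjugated by
`halfExp`, and formally det(1 - H) = det(1 - H₁₂H₂₁) = det(1 - K̂₁K̂₂).

To make this rigorous, every kernel is written as a series ∑ φ_n(u) ψ_n(v) with both families square
summable in the sense of `SqFamily`, that is, as a product of two Hilbert–Schmidt operators. Such an
operator is trace class, and the Andreief identity with Hadamard's inequality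
(`SqFamily.hasSum_det`) identifies three things: the Fredholm series of the kernel, the sum of
principal minors in any orthonormal basis (`hasFredholmDet_of_hasSum`), and the determinant of the
matrix `pairing` of the integrals ∫ ψ_n φ_n'. For these matrices the block identity is an infinite
version of the Schur complement formula (`tsum_minor_sum`). All this is assembled in
`block_fredholm` and `KernelData.HasCells.fredholm`.

It remains to find the families. For the KPZ fixed point, a component of f and the same component of
g live on different contours, which have positive distance; the Cauchy kernel is expanded in
geometric series around the corners of a fine grid (`exists_sqFamily_cauchy`), and the exponential
decay of f and g along the contours pays for the sum over the grid. The decay comes from the signs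
of cos 3θ and, for equal times, of cos 2θ at the end angles. For the periodic model, Ω is countable
and the kernel is dominated by b(u) b(v) with b summable: the roots lie on hyperbolas on which Re z²
is constant, so `halfExp` decays exponentially, while 1/|u - v| grows at most polynomially.

For the symmetry, z ↦ -z exchanges `Ω_{1,j}` and `Ω_{2,j}`, and together with y ↦ -y it preserves
`halfExp`. The entries of L are fixed by the recursion `weightL_mul`, which makes g at (x,y,t) a
scalar multiple of L f(-·) at (x,-y,t), and conversely. So the two operators are transposes of each
other for a nondegenerate bilinear form, and `isUnit_one_sub_of_reflect` carries this over to the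
resolvents and to `Y1`. -/

theorem norm_det_gram_le_of_norm_eq_one {n E : Type*} [Fintype n] [DecidableEq n]
    [NormedAddCommGroup E] [InnerProductSpace ℂ E] (v : n → E) (hv : ∀ i, ‖v i‖ = 1) :
    ‖(Matrix.gram ℂ v).det‖ ≤ 1 := by
  have hp := Matrix.posSemidef_gram ℂ v
  have hH := hp.1
  rw [hH.det_eq_prod_eigenvalues]
  have htr := hH.trace_eq_sum_eigenvalues
  have htr' : ∑ i, hH.eigenvalues i = Fintype.card n := by
    have : (Matrix.gram ℂ v).trace = Fintype.card n := by
      simp [Matrix.trace, Matrix.gram_apply, inner_self_eq_norm_sq_to_K, hv]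
    rw [this] at htr
    simpa using (congrArg Complex.re htr).symm
  rw [norm_prod]
  -- The bound x ≤ exp(x - 1) replaces the inequality of the means: the eigenvalues are nonnegative
  -- with sum n, so the exponents add up to 0.
  calc ∏ i, ‖((hH.eigenvalues i : ℝ) : ℂ)‖ ≤ ∏ i, Real.exp (hH.eigenvalues i - 1) := by
        refine Finset.prod_le_prod (fun _ _ => norm_nonneg _) fun i _ => ?_
        rw [Complex.norm_real, Real.norm_of_nonneg (hp.eigenvalues_nonneg i)]
        linarith [Real.add_one_le_exp (hH.eigenvalues i - 1)]
    _ = 1 := by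
        rw [← Real.exp_sum, Finset.sum_sub_distrib, htr']
        simp

/-- Hadamard's inequality for Gram determinants. -/
theorem norm_det_gram_le {n E : Type*} [Fintype n] [DecidableEq n]
    [NormedAddCommGroup E] [InnerProductSpace ℂ E] (v : n → E) :
    ‖(Matrix.gram ℂ v).det‖ ≤ ∏ i, ‖v i‖ ^ 2 := by
  by_cases h0 : ∃ i, v i = 0
  · obtain ⟨i, hi⟩ := h0
    rw [Matrix.det_eq_zero_of_row_eq_zero i (fun j => by simp [Matrix.gram_apply, hi])]
    simpa using Finset.prod_nonneg fun i _ => sq_nonneg ‖v i‖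
  push Not at h0
  have hn : ∀ i, (‖v i‖ : ℂ) ≠ 0 := fun i => by simpa using h0 i
  have key : Matrix.gram ℂ v = Matrix.of fun i j => (‖v i‖ : ℂ) *
      (Matrix.of fun i j => (‖v j‖ : ℂ) *
        Matrix.gram ℂ (fun i => ((‖v i‖ : ℂ)⁻¹) • v i) i j) i j := by
    ext i j
    simp only [Matrix.gram_apply, Matrix.of_apply, inner_smul_left, inner_smul_right, map_inv₀,
      Complex.conj_ofReal]
    field_simp [hn i, hn j]
  rw [key, Matrix.det_mul_column, Matrix.det_mul_row, norm_mul, norm_mul, ← mul_assoc]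
  have := norm_det_gram_le_of_norm_eq_one (fun i => ((‖v i‖ : ℂ)⁻¹) • v i) (fun i => by
    rw [norm_smul, norm_inv, Complex.norm_real, norm_norm]
    exact inv_mul_cancel₀ (by simpa using h0 i))
  calc _ ≤ ‖∏ i, (‖v i‖ : ℂ)‖ * ‖∏ i, (‖v i‖ : ℂ)‖ * 1 := by gcongr
    _ = ∏ i, ‖v i‖ ^ 2 := by
        rw [mul_one, norm_prod, ← Finset.prod_mul_distrib]
        exact Finset.prod_congr rfl fun i _ => by simp [sq]

/-- A finite product of absolutely convergent series, expanded. -/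
theorem hasSum_pi_prod {J : Type*} {k : ℕ} (a : Fin k → J → ℂ)
    (h : ∀ i, Summable fun n => ‖a i n‖) :
    (Summable fun n : Fin k → J => ‖∏ i, a i (n i)‖) ∧
      HasSum (fun n : Fin k → J => ∏ i, a i (n i)) (∏ i, ∑' n, a i n) := by
  induction k with
  | zero =>
    exact ⟨(hasSum_fintype _).summable, by
      simp only [Finset.univ_eq_empty, Finset.prod_empty]
      exact hasSum_unique (fun n : Fin 0 → J => (1 : ℂ))⟩
  | succ k ih =>
    obtain ⟨b, hb⟩ : ∃ b : (Fin k → J) → ℂ, b = fun n => ∏ i : Fin k, a i.succ (n i) := ⟨_, rfl⟩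
    obtain ⟨h1, h2⟩ : (Summable fun n => ‖b n‖) ∧ HasSum b (∏ i : Fin k, ∑' n, a i.succ n) :=
      hb ▸ ih (fun i : Fin k => a i.succ) (fun i => h i.succ)
    have he : ∀ x : J × (Fin k → J), ∏ i, a i (Fin.consEquiv (fun _ => J) x i) =
        a 0 x.1 * b x.2 := fun x => by
      rw [Fin.prod_univ_succ, hb]
      rfl
    have h0 := h 0
    constructor
    · rw [← (Fin.consEquiv fun _ => J).summable_iff]
      exact (h0.mul_norm h1).congr fun x => (congrArg norm (he x)).symm
    · rw [← (Fin.consEquiv fun _ => J).hasSum_iff, Fin.prod_univ_succ]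
      have he' : (fun n : Fin (k + 1) → J => ∏ i, a i (n i)) ∘ (Fin.consEquiv fun _ => J) =
          fun x => a 0 x.1 * b x.2 := funext he
      rw [he']
      exact h0.of_norm.hasSum.mul h2 (h0.mul_norm h1).of_norm

/-- The sum of all principal minors of `M` is `det (1 + M)`. -/
theorem det_one_add_eq_sum_minors {n : Type*} [Fintype n] [DecidableEq n] (M : Matrix n n ℂ) :
    (1 + M).det = ∑ s : Finset n, (M.submatrix (Subtype.val : s → n) Subtype.val).det := by
  -- Multilinearity in the rows: each row of M + 1 is taken either from M or from the identity.
  have h := Matrix.detRowAlternating.map_add_univ (R := ℂ) (fun i => M i) (fun i => (1 : Matrix n n ℂ) i)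
  rw [add_comm]
  refine Eq.trans h (Finset.sum_congr rfl fun s _ => ?_)
  rw [← Matrix.det_piecewise_one_eq_submatrix_det]
  rfl

end KPZ

/-! ### The Andreief identity for square summable families. -/

namespace KPZ

section AndreiefIdentity

variable {X J : Type*} [MeasurableSpace X] {μ : Measure X}

/-- A series of integrable functions with summable `L¹` norms has an integrable sum. -/
theorem integrable_tsum_of_summable_integral_norm [Countable J] {F : J → X → ℂ}
    (hF : ∀ n, Integrable (F n) μ) (hs : Summable fun n => ∫ x, ‖F n x‖ ∂μ) :
    Integrable (fun x => ∑' n, F n x) μ ∧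
      ∫ x, ‖∑' n, F n x‖ ∂μ ≤ ∑' n, ∫ x, ‖F n x‖ ∂μ := by
  have hnorm : ∀ n, ‖(hF n).toL1 (F n)‖ = ∫ x, ‖F n x‖ ∂μ := fun n => by
    rw [L1.norm_eq_integral_norm]
    exact integral_congr_ae ((hF n).coeFn_toL1.mono fun x hx => by simp only [hx])
  have hsum : Summable fun n => ‖(hF n).toL1 (F n)‖ := hs.congr fun n => (hnorm n).symm
  have hae := Lp.coeFn_tsum (f := fun n => (hF n).toL1 (F n))
    (tsum_enorm_ne_top_iff_summable_norm.2 hsum)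
  have hall : ∀ᵐ x ∂μ, ∀ n, (hF n).toL1 (F n) x = F n x :=
    ae_all_iff.2 fun n => (hF n).coeFn_toL1
  have heq : (∑' n, (hF n).toL1 (F n) : X →₁[μ] ℂ) =ᵐ[μ] fun x => ∑' n, F n x := by
    filter_upwards [hae, hall] with x hx hx'
    rw [hx]
    exact tsum_congr hx'
  refine ⟨(L1.integrable_coeFn _).congr heq, ?_⟩
  calc ∫ x, ‖∑' n, F n x‖ ∂μ = ‖∑' n, (hF n).toL1 (F n)‖ := by
        rw [L1.norm_eq_integral_norm]
        exact integral_congr_ae (heq.mono fun x hx => by simp only [hx])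
    _ ≤ ∑' n, ‖(hF n).toL1 (F n)‖ := norm_tsum_le_tsum_norm hsum
    _ = _ := tsum_congr hnorm

/-- The `L²` norm of a function. -/
noncomputable def l2norm (μ : Measure X) (f : X → ℂ) : ℝ := Real.sqrt (∫ x, ‖f x‖ ^ 2 ∂μ)

theorem l2norm_nonneg (f : X → ℂ) : 0 ≤ l2norm μ f := Real.sqrt_nonneg _

theorem l2norm_sq (f : X → ℂ) : l2norm μ f ^ 2 = ∫ x, ‖f x‖ ^ 2 ∂μ :=
  Real.sq_sqrt (integral_nonneg fun _ => sq_nonneg _)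

theorem _root_.MeasureTheory.MemLp.integrable_normSq {f : X → ℂ} (hf : MemLp f 2 μ) :
    Integrable (fun x => ‖f x‖ ^ 2) μ :=
  (memLp_two_iff_integrable_sq_norm hf.1).1 hf

theorem inner_toLp {f g : X → ℂ} (hf : MemLp f 2 μ) (hg : MemLp g 2 μ) :
    inner ℂ (hf.toLp f) (hg.toLp g) = ∫ x, (starRingEnd ℂ) (f x) * g x ∂μ := by
  rw [L2.inner_def]
  refine integral_congr_ae ?_
  filter_upwards [hf.coeFn_toLp, hg.coeFn_toLp] with x hx hx'
  rw [hx, hx', RCLike.inner_apply, mul_comm]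

theorem norm_toLp_eq {f : X → ℂ} (hf : MemLp f 2 μ) : ‖hf.toLp f‖ = l2norm μ f := by
  rw [l2norm, ← Real.sqrt_sq (norm_nonneg (hf.toLp f))]
  congr 1
  have h := inner_toLp hf hf
  rw [inner_self_eq_norm_sq_to_K] at h
  have h2 : ∀ x, (starRingEnd ℂ) (f x) * f x = ((‖f x‖ ^ 2 : ℝ) : ℂ) := fun x => by
    rw [mul_comm, Complex.mul_conj, Complex.normSq_eq_norm_sq]
  simp_rw [h2] at h
  rw [integral_complex_ofReal] at h
  exact Complex.ofReal_injective (by rw [Complex.ofReal_pow]; exact h)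

theorem integral_norm_mul_le {f g : X → ℂ} (hf : MemLp f 2 μ) (hg : MemLp g 2 μ) :
    ∫ x, ‖f x * g x‖ ∂μ ≤ l2norm μ f * l2norm μ g := by
  have h := integral_mul_norm_le_Lp_mul_Lq (μ := μ) (f := f) (g := g) (p := 2) (q := 2)
    Real.HolderConjugate.two_two (by simpa using hf) (by simpa using hg)
  simp only [norm_mul]
  refine h.trans (le_of_eq ?_)
  simp only [l2norm, Real.sqrt_eq_rpow, Real.rpow_two]

theorem norm_integral_mul_le {f g : X → ℂ} (hf : MemLp f 2 μ) (hg : MemLp g 2 μ) :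
    ‖∫ x, f x * g x ∂μ‖ ≤ l2norm μ f * l2norm μ g :=
  (norm_integral_le_integral_norm _).trans (integral_norm_mul_le hf hg)

variable [SigmaFinite μ] {k : ℕ}

theorem memLp_two_prod {f : Fin k → X → ℂ} (hf : ∀ i, MemLp (f i) 2 μ) :
    MemLp (fun x : Fin k → X => ∏ i, f i (x i)) 2 (Measure.pi fun _ => μ) := by
  have hm : AEStronglyMeasurable (fun x : Fin k → X => ∏ i, f i (x i))
      (Measure.pi fun _ => μ) := by
    refine Finset.aestronglyMeasurable_fun_prod _ fun i _ => ?_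
    exact (hf i).1.comp_quasiMeasurePreserving (Measure.quasiMeasurePreserving_eval _ i)
  rw [memLp_two_iff_integrable_sq_norm hm]
  have := Integrable.fintype_prod (𝕜 := ℝ) (μ := fun _ : Fin k => μ)
    (f := fun i x => ‖f i x‖ ^ 2) (fun i => (hf i).integrable_normSq)
  refine this.congr (ae_of_all _ fun x => ?_)
  simp [norm_prod, Finset.prod_pow]

theorem l2norm_prod (f : Fin k → X → ℂ) :
    l2norm (Measure.pi fun _ => μ) (fun x : Fin k → X => ∏ i, f i (x i)) = ∏ i, l2norm μ (f i) := by
  rw [l2norm]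
  have : ∀ x : Fin k → X, ‖∏ i, f i (x i)‖ ^ 2 = ∏ i, ‖f i (x i)‖ ^ 2 := fun x => by
    rw [norm_prod, Finset.prod_pow]
  simp_rw [this]
  rw [integral_fintype_prod_eq_prod (𝕜 := ℝ) (fun i x => ‖f i x‖ ^ 2), Real.sqrt_prod]
  · rfl
  · exact fun i _ => integral_nonneg fun _ => sq_nonneg _

theorem memLp_two_det {g : Fin k → X → ℂ} (hg : ∀ i, MemLp (g i) 2 μ) :
    MemLp (fun x : Fin k → X => (Matrix.of fun i j => g i (x j)).det) 2
      (Measure.pi fun _ => μ) := by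
  simp_rw [Matrix.det_apply', Matrix.of_apply]
  refine memLp_finsetSum _ fun σ _ => MemLp.const_mul ?_ _
  exact memLp_two_prod fun i => hg (σ i)

/-- The `L²` norm of a Slater determinant. -/
theorem l2norm_det_le {g : Fin k → X → ℂ} (hg : ∀ i, MemLp (g i) 2 μ) :
    l2norm (Measure.pi fun _ => μ) (fun x : Fin k → X => (Matrix.of fun i j => g i (x j)).det) ≤
      Real.sqrt k.factorial * ∏ i, l2norm μ (g i) := by
  have hmul : ∀ i j, Integrable (fun x => (starRingEnd ℂ) (g i x) * g j x) μ := fun i j =>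
    MemLp.integrable_mul (p := 2) (q := 2) (hg i).star (hg j)
  set G := Matrix.gram ℂ fun i => (hg i).toLp (g i) with hG
  have hGa : ∀ i j, ∫ x, (starRingEnd ℂ) (g i x) * g j x ∂μ = G i j := fun i j => by
    rw [hG, Matrix.gram_apply, inner_toLp]
  have key : ((l2norm (Measure.pi fun _ => μ)
      (fun x : Fin k → X => (Matrix.of fun i j => g i (x j)).det) ^ 2 : ℝ) : ℂ) =
        k.factorial * G.det := by
    rw [l2norm_sq, ← integral_complex_ofReal]
    have h1 : ∀ x : Fin k → X, ((‖(Matrix.of fun i j => g i (x j)).det‖ ^ 2 : ℝ) : ℂ) =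
        ∑ τ : Equiv.Perm (Fin k), ∑ σ : Equiv.Perm (Fin k),
          (((Equiv.Perm.sign σ : ℤ) : ℂ) * ((Equiv.Perm.sign τ : ℤ) : ℂ)) *
            ∏ i, (starRingEnd ℂ) (g (σ i) (x i)) * g (τ i) (x i) := fun x => by
      rw [← Complex.normSq_eq_norm_sq, ← Complex.mul_conj, Matrix.det_apply', map_sum,
        Finset.sum_mul_sum]
      refine Finset.sum_congr rfl fun τ _ => Finset.sum_congr rfl fun σ _ => ?_
      simp only [Matrix.of_apply, map_mul, map_prod, map_intCast, Finset.prod_mul_distrib]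
      ring
    simp_rw [h1]
    have hint : ∀ σ τ : Equiv.Perm (Fin k), Integrable (fun x : Fin k → X =>
        (((Equiv.Perm.sign σ : ℤ) : ℂ) * ((Equiv.Perm.sign τ : ℤ) : ℂ)) *
            ∏ i, (starRingEnd ℂ) (g (σ i) (x i)) * g (τ i) (x i)) (Measure.pi fun _ => μ) :=
      fun σ τ => (Integrable.fintype_prod (μ := fun _ : Fin k => μ)
        (f := fun i x => (starRingEnd ℂ) (g (σ i) x) * g (τ i) x)
          (fun i => hmul _ _)).const_mul _
    rw [integral_finsetSum _ fun τ _ => integrable_finsetSum _ fun σ _ => hint σ τ]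
    -- Replacing σ by στ cancels the sign of τ and, after relabelling the factors, removes τ from
    -- the product. Every τ then contributes `G.det`, and summing over τ gives the factor k!.
    have h2 : ∀ τ : Equiv.Perm (Fin k), ∫ x : Fin k → X, ∑ σ : Equiv.Perm (Fin k),
        (((Equiv.Perm.sign σ : ℤ) : ℂ) * ((Equiv.Perm.sign τ : ℤ) : ℂ)) *
            ∏ i, (starRingEnd ℂ) (g (σ i) (x i)) * g (τ i) (x i) ∂(Measure.pi fun _ => μ) =
          G.det := fun τ => by
      rw [integral_finsetSum _ fun σ _ => hint σ τ, Matrix.det_apply',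
        ← Equiv.sum_comp (Equiv.mulRight τ)]
      refine Finset.sum_congr rfl fun σ _ => ?_
      simp only [Equiv.coe_mulRight]
      rw [integral_const_mul,
        integral_fintype_prod_eq_prod (fun i x => (starRingEnd ℂ) (g ((σ * τ) i) x) * g (τ i) x)]
      simp_rw [hGa]
      have hs : ((Equiv.Perm.sign τ : ℤ) : ℂ) * ((Equiv.Perm.sign τ : ℤ) : ℂ) = 1 := by
        rcases Int.units_eq_one_or (Equiv.Perm.sign τ) with h | h <;> simp [h]
      simp only [Equiv.Perm.sign_mul, Units.val_mul, Int.cast_mul, mul_assoc,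
        hs, mul_one]
      congr 1
      exact Equiv.prod_comp τ fun i => G (σ i) i
    simp_rw [h2]
    simp [Fintype.card_perm]
  have h3 : l2norm (Measure.pi fun _ => μ)
      (fun x : Fin k → X => (Matrix.of fun i j => g i (x j)).det) ^ 2 ≤
        k.factorial * ∏ i, l2norm μ (g i) ^ 2 := by
    have h4 := congrArg norm key
    rw [Complex.norm_real, Real.norm_of_nonneg (sq_nonneg _), norm_mul,
      Complex.norm_natCast] at h4
    rw [h4]
    have := norm_det_gram_le fun i => (hg i).toLp (g i)
    simp_rw [norm_toLp_eq] at this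
    gcongr
  have h5 := Real.sqrt_le_sqrt h3
  rwa [Real.sqrt_sq (l2norm_nonneg _), Real.sqrt_mul (Nat.cast_nonneg _), Finset.prod_pow,
    Real.sqrt_sq (Finset.prod_nonneg fun i _ => l2norm_nonneg _)] at h5

/-- A square summable family of functions in `L²`. -/
structure SqFamily (μ : Measure X) (φ : J → X → ℂ) : Prop where
  memLp : ∀ n, MemLp (φ n) 2 μ
  summable_l2norm : Summable fun n => l2norm μ (φ n) ^ 2
  summable_apply : ∀ x, Summable fun n => ‖φ n x‖ ^ 2

theorem summable_mul_of_sq {a b : J → ℝ} (ha : Summable fun n => a n ^ 2)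
    (hb : Summable fun n => b n ^ 2) (ha0 : ∀ n, 0 ≤ a n) (hb0 : ∀ n, 0 ≤ b n) :
    Summable fun n => a n * b n :=
  Summable.of_nonneg_of_le (fun n => mul_nonneg (ha0 n) (hb0 n))
    (fun n => by nlinarith [sq_nonneg (a n - b n), sq_nonneg (a n), sq_nonneg (b n)])
    (ha.add hb)

namespace SqFamily

variable {φ ψ : J → X → ℂ}

theorem summable_norm_mul (hφ : SqFamily μ φ) (hψ : SqFamily μ ψ) (x y : X) :
    Summable fun n => ‖φ n x * ψ n y‖ := by
  simp_rw [norm_mul]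
  exact summable_mul_of_sq (hφ.summable_apply x) (hψ.summable_apply y) (fun _ => norm_nonneg _)
    fun _ => norm_nonneg _

theorem summable_l2norm_mul (hφ : SqFamily μ φ) (hψ : SqFamily μ ψ) :
    Summable fun n => l2norm μ (φ n) * l2norm μ (ψ n) :=
  summable_mul_of_sq hφ.summable_l2norm hψ.summable_l2norm (fun _ => l2norm_nonneg _)
    fun _ => l2norm_nonneg _

/-- The terms in the expansion of the minors of a kernel. -/
noncomputable def minorTerm (φ ψ : J → X → ℂ) (n : Fin k → J) (x : Fin k → X) : ℂ :=
  (∏ i, φ (n i) (x i)) * (Matrix.of fun i j => ψ (n i) (x j)).det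

/-- Leibniz expansion turns the determinant into products of k absolutely convergent series, hence
into series over k-tuples. For a fixed tuple the permutations recombine to one product times one
Slater determinant. -/
theorem hasSum_minorTerm (hφ : SqFamily μ φ) (hψ : SqFamily μ ψ) (x : Fin k → X) :
    HasSum (fun n => minorTerm φ ψ n x)
      (Matrix.of fun i j => ∑' n, φ n (x i) * ψ n (x j)).det := by
  have h1 : ∀ n : Fin k → J, minorTerm φ ψ n x = ∑ σ : Equiv.Perm (Fin k),
      ((Equiv.Perm.sign σ : ℤ) : ℂ) * ∏ i, φ (n i) (x i) * ψ (n i) (x (σ i)) := fun n => by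
    rw [minorTerm, ← Matrix.det_transpose, Matrix.det_apply', Finset.mul_sum]
    refine Finset.sum_congr rfl fun σ _ => ?_
    simp only [Matrix.transpose_apply, Matrix.of_apply, Finset.prod_mul_distrib]
    ring
  rw [← Matrix.det_transpose, Matrix.det_apply']
  simp_rw [h1]
  refine hasSum_sum fun σ _ => HasSum.mul_left _ ?_
  exact (hasSum_pi_prod (fun i n => φ n (x i) * ψ n (x (σ i)))
    fun i => hφ.summable_norm_mul hψ _ _).2

/-- Grouping the factors by the variable x_i leaves products of functions of one variable, so that
the integral factorises for each permutation. -/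
theorem minorTerm_eq (n : Fin k → J) (x : Fin k → X) :
    minorTerm φ ψ n x = ∑ σ : Equiv.Perm (Fin k),
      ((Equiv.Perm.sign σ : ℤ) : ℂ) * ∏ i, ψ (n (σ i)) (x i) * φ (n i) (x i) := by
  rw [minorTerm, Matrix.det_apply', Finset.mul_sum]
  refine Finset.sum_congr rfl fun σ _ => ?_
  simp only [Matrix.of_apply, Finset.prod_mul_distrib]
  ring

theorem integrable_mul (hφ : SqFamily μ φ) (hψ : SqFamily μ ψ) (n n' : J) :
    Integrable (fun x => ψ n x * φ n' x) μ :=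
  MemLp.integrable_mul (p := 2) (q := 2) (hψ.memLp n) (hφ.memLp n')

theorem integrable_minorTerm (hφ : SqFamily μ φ) (hψ : SqFamily μ ψ) (n : Fin k → J) :
    Integrable (minorTerm φ ψ n) (Measure.pi fun _ => μ) := by
  have : minorTerm φ ψ n = fun x => minorTerm φ ψ n x := rfl
  rw [this]
  simp_rw [minorTerm_eq]
  exact integrable_finsetSum _ fun σ _ => (Integrable.fintype_prod (μ := fun _ : Fin k => μ)
    (f := fun i x => ψ (n (σ i)) x * φ (n i) x)
      fun i => hφ.integrable_mul hψ _ _).const_mul _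

theorem integral_minorTerm (hφ : SqFamily μ φ) (hψ : SqFamily μ ψ) (n : Fin k → J) :
    ∫ x, minorTerm φ ψ n x ∂(Measure.pi fun _ => μ) =
      (Matrix.of fun i j => ∫ x, ψ (n i) x * φ (n j) x ∂μ).det := by
  simp_rw [minorTerm_eq]
  rw [integral_finsetSum _ fun σ _ => (Integrable.fintype_prod (μ := fun _ : Fin k => μ)
    (f := fun i x => ψ (n (σ i)) x * φ (n i) x)
      fun i => hφ.integrable_mul hψ _ _).const_mul _, Matrix.det_apply']
  refine Finset.sum_congr rfl fun σ _ => ?_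
  rw [integral_const_mul,
    integral_fintype_prod_eq_prod (fun i x => ψ (n (σ i)) x * φ (n i) x)]
  rfl

/-- Cauchy–Schwarz with the determinant kept whole: its L² norm costs only √k!, whereas the triangle
inequality over permutations would cost k!. After division by k! a factor 1/√k! survives, and the
Fredholm series converges without any smallness assumption. -/
theorem integral_norm_minorTerm_le (hφ : SqFamily μ φ) (hψ : SqFamily μ ψ) (n : Fin k → J) :
    ∫ x, ‖minorTerm φ ψ n x‖ ∂(Measure.pi fun _ => μ) ≤
      Real.sqrt k.factorial * ∏ i, (l2norm μ (φ (n i)) * l2norm μ (ψ (n i))) := by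
  refine (integral_norm_mul_le (memLp_two_prod fun i => hφ.memLp (n i))
    (memLp_two_det fun i => hψ.memLp (n i))).trans ?_
  rw [l2norm_prod (fun i => φ (n i)), Finset.prod_mul_distrib]
  have := l2norm_det_le fun i => hψ.memLp (n i)
  have h0 : 0 ≤ ∏ i, l2norm μ (φ (n i)) := Finset.prod_nonneg fun i _ => l2norm_nonneg _
  nlinarith [mul_le_mul_of_nonneg_left this h0]

theorem hasSum_prod_l2norm (hφ : SqFamily μ φ) (hψ : SqFamily μ ψ) :
    HasSum (fun n : Fin k → J => ∏ i, (l2norm μ (φ (n i)) * l2norm μ (ψ (n i))))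
      ((∑' n, l2norm μ (φ n) * l2norm μ (ψ n)) ^ k) := by
  have := (hasSum_pi_prod (k := k) (fun _ n => ((l2norm μ (φ n) * l2norm μ (ψ n) : ℝ) : ℂ))
    fun _ => by
      simp only [Complex.norm_real]
      exact (hφ.summable_l2norm_mul hψ).norm).2
  rw [Finset.prod_const, Finset.card_univ, Fintype.card_fin] at this
  have h2 := Complex.hasSum_re this
  convert h2 using 1
  · ext n
    rw [← Complex.ofReal_prod, Complex.ofReal_re]
  · rw [← Complex.ofReal_tsum, ← Complex.ofReal_pow, Complex.ofReal_re]

variable [Countable J]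

/-- Termwise form of the identity `det (1 - ΦΨ) = det (1 - ΨΦ)`. -/
theorem hasSum_det (hφ : SqFamily μ φ) (hψ : SqFamily μ ψ) (k : ℕ) :
    (Integrable (fun x : Fin k → X => (Matrix.of fun i j => ∑' n, φ n (x i) * ψ n (x j)).det)
        (Measure.pi fun _ => μ)) ∧
      (∫ x : Fin k → X, ‖(Matrix.of fun i j => ∑' n, φ n (x i) * ψ n (x j)).det‖
          ∂(Measure.pi fun _ => μ) ≤
        Real.sqrt k.factorial * (∑' n, l2norm μ (φ n) * l2norm μ (ψ n)) ^ k) ∧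
      (Summable fun n : Fin k → J =>
        ‖(Matrix.of fun i j => ∫ x, ψ (n i) x * φ (n j) x ∂μ).det‖) ∧
      (∑' n : Fin k → J, ‖(Matrix.of fun i j => ∫ x, ψ (n i) x * φ (n j) x ∂μ).det‖ ≤
        Real.sqrt k.factorial * (∑' n, l2norm μ (φ n) * l2norm μ (ψ n)) ^ k) ∧
      ∑' n : Fin k → J, (Matrix.of fun i j => ∫ x, ψ (n i) x * φ (n j) x ∂μ).det =
        ∫ x : Fin k → X, (Matrix.of fun i j => ∑' n, φ n (x i) * ψ n (x j)).det
          ∂(Measure.pi fun _ => μ) := by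
  have hb := (hφ.hasSum_prod_l2norm hψ (k := k)).mul_left (Real.sqrt k.factorial)
  have hs : Summable fun n : Fin k → J =>
      ∫ x, ‖minorTerm φ ψ n x‖ ∂(Measure.pi fun _ => μ) :=
    Summable.of_nonneg_of_le (fun n => integral_nonneg fun _ => norm_nonneg _)
      (fun n => hφ.integral_norm_minorTerm_le hψ n) hb.summable
  have hle : ∑' n : Fin k → J, ∫ x, ‖minorTerm φ ψ n x‖ ∂(Measure.pi fun _ => μ) ≤
      Real.sqrt k.factorial * (∑' n, l2norm μ (φ n) * l2norm μ (ψ n)) ^ k := by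
    rw [← hb.tsum_eq]
    exact hs.tsum_le_tsum (fun n => hφ.integral_norm_minorTerm_le hψ n) hb.summable
  have hts : ∀ x : Fin k → X, ∑' n, minorTerm φ ψ n x =
      (Matrix.of fun i j => ∑' n, φ n (x i) * ψ n (x j)).det := fun x =>
    (hφ.hasSum_minorTerm hψ x).tsum_eq
  have h1 := integrable_tsum_of_summable_integral_norm
    (fun n : Fin k → J => hφ.integrable_minorTerm hψ n) hs
  have h2 := hasSum_integral_of_summable_integral_norm
    (fun n : Fin k → J => hφ.integrable_minorTerm hψ n) hs
  simp_rw [hts] at h1 h2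
  simp_rw [hφ.integral_minorTerm hψ] at h2
  have hn : ∀ n : Fin k → J, ‖(Matrix.of fun i j => ∫ x, ψ (n i) x * φ (n j) x ∂μ).det‖ ≤
      ∫ x, ‖minorTerm φ ψ n x‖ ∂(Measure.pi fun _ => μ) := fun n => by
    rw [← hφ.integral_minorTerm hψ]
    exact norm_integral_le_integral_norm _
  have hsn := Summable.of_nonneg_of_le (fun _ => norm_nonneg _) hn hs
  exact ⟨h1.1, h1.2.trans hle, hsn, (hsn.tsum_le_tsum hn hs).trans hle, h2.tsum_eq⟩

end SqFamily

end AndreiefIdentity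

end KPZ

/-! ### Sums of principal minors and the infinite block determinant formula. -/

namespace KPZ

section Minors

variable {I : Type*}

open Classical in
/-- The principal minor of `M` on a finite set. -/
noncomputable def minor (M : I → I → ℂ) (S : Finset I) : ℂ := (Matrix.of fun i j : S => M i j).det

theorem minor_eq_det {n : Type*} [Fintype n] [DecidableEq n] (M : I → I → ℂ) (S : Finset I)
    (e : n ≃ S) : minor M S = (Matrix.of fun i j => M (e i) (e j)).det := by
  classical
  rw [minor, ← Matrix.det_submatrix_equiv_self e]
  congr!

theorem minor_neg (M : I → I → ℂ) (S : Finset I) :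
    minor (fun i j => -M i j) S = (-1) ^ S.card * minor M S := by
  classical
  have := Matrix.det_neg (Matrix.of fun i j : S => M i j)
  rw [Fintype.card_coe] at this
  exact this

/-- Injective tuples with a given range. -/
noncomputable def embeddingFiberEquiv {k : ℕ} (S : Finset I) (hS : S.card = k) :
    {n : Fin k ↪ I // Finset.univ.map n = S} ≃ (Fin k ≃ S) where
  toFun n := Equiv.ofBijective (fun i => ⟨n.1 i, by
      have := Finset.mem_map_of_mem n.1 (Finset.mem_univ i)
      rwa [n.2] at this⟩)
    ((Fintype.bijective_iff_injective_and_card _).2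
      ⟨fun i j h => n.1.injective (Subtype.ext_iff.1 h), by simp [hS]⟩)
  invFun e := ⟨e.toEmbedding.trans (Function.Embedding.subtype _), by
    ext x
    simp only [Finset.mem_map, Finset.mem_univ, true_and, Function.Embedding.trans_apply,
      Equiv.coe_toEmbedding, Function.Embedding.subtype_apply]
    exact ⟨fun ⟨i, hi⟩ => hi ▸ (e i).2, fun hx => ⟨e.symm ⟨x, hx⟩, by simp⟩⟩⟩
  left_inv n := by
    ext i
    rfl
  right_inv e := by
    ext i
    rfl

/-- A sum over tuples of a function of the range that vanishes on non-injective tuples. -/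
theorem hasSum_finset_of_tuple {k : ℕ} {F : (Fin k → I) → ℂ} {g : Finset I → ℂ} {a : ℂ}
    (hF : HasSum F a) (h0 : ∀ n, ¬ Function.Injective n → F n = 0)
    (hg : ∀ (S : Finset I) (e : Fin k ≃ S), F (fun i => e i) = g S) :
    HasSum (fun S : {S : Finset I // S.card = k} => (k.factorial : ℂ) * g S) a := by
  let p : (Fin k ↪ I) → {S : Finset I // S.card = k} := fun n => ⟨Finset.univ.map n, by simp⟩
  have h1 : HasSum (fun n : Fin k ↪ I => F n) a := by
    refine (Function.Injective.hasSum_iff (g := fun n : Fin k ↪ I => (n : Fin k → I))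
      DFunLike.coe_injective fun n hn => h0 n fun hinj => hn ⟨⟨n, hinj⟩, rfl⟩).2 hF
  -- The injective tuples are fibred over their ranges; a set with k elements is the range of k!
  -- tuples, all with the same value.
  have h2 := (Equiv.sigmaFiberEquiv p).hasSum_iff.2 h1
  refine h2.sigma fun S => ?_
  have e : {n // p n = S} ≃ (Fin k ≃ S.1) :=
    (Equiv.subtypeEquivRight fun n => by simp [p, Subtype.ext_iff]).trans
      (embeddingFiberEquiv S.1 S.2)
  have hval : ∀ c : {n // p n = S}, F (Equiv.sigmaFiberEquiv p ⟨S, c⟩ : Fin k ↪ I) = g S.1 := by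
    rintro ⟨n, hn⟩
    have hn' : Finset.univ.map n = S.1 := congrArg Subtype.val hn
    exact hg S.1 (embeddingFiberEquiv S.1 S.2 ⟨n, hn'⟩)
  classical
  have : Fintype {n // p n = S} := Fintype.ofEquiv _ e.symm
  have hcard : Fintype.card {n // p n = S} = k.factorial := by
    have hk : Fintype.card (Fin k) = Fintype.card S.1 := by simp [S.2]
    rw [Fintype.card_congr e, Fintype.card_equiv (Fintype.equivOfCardEq hk), Fintype.card_fin]
  have hs := hasSum_fintype fun c : {n // p n = S} => F (Equiv.sigmaFiberEquiv p ⟨S, c⟩ : Fin k ↪ I)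
  simp_rw [hval, Finset.sum_const, Finset.card_univ, hcard, nsmul_eq_mul] at hs
  have hval' : (fun c => ((fun n : Fin k ↪ I => F n) ∘ Equiv.sigmaFiberEquiv p) ⟨S, c⟩) =
      fun _ => g S.1 := funext hval
  rw [hval']
  exact hs

/-- The term is split as 2⁻ᵏ times (2s)ᵏ/√k!; the squares of the two factors form a geometric and an
exponential series. -/
theorem summable_pow_div_sqrt_factorial (s : ℝ) (hs : 0 ≤ s) :
    Summable fun k : ℕ => s ^ k / Real.sqrt k.factorial := by
  have h1 : Summable fun k : ℕ => ((1 / 2 : ℝ) ^ k) ^ 2 := by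
    simp_rw [← pow_mul, mul_comm _ 2, pow_mul]
    exact summable_geometric_of_lt_one (by norm_num) (by norm_num)
  have h2 : Summable fun k : ℕ => ((2 * s) ^ k / Real.sqrt k.factorial) ^ 2 := by
    refine (Real.summable_pow_div_factorial ((2 * s) ^ 2)).congr fun k => ?_
    rw [div_pow, Real.sq_sqrt (Nat.cast_nonneg _), ← pow_mul, ← pow_mul, mul_comm 2 k]
  refine (summable_mul_of_sq h1 h2 (fun _ => by positivity) (fun _ => by positivity)).congr
    fun k => ?_
  rw [← mul_div_assoc, ← mul_pow]
  congr 2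
  ring

theorem hasSum_finset_of_card {g : Finset I → ℂ} {a : ℕ → ℂ} {b : ℕ → ℝ}
    (ha : ∀ k, HasSum (fun S : {S : Finset I // S.card = k} => g S) (a k))
    (hb : ∀ k, HasSum (fun S : {S : Finset I // S.card = k} => ‖g S‖) (b k)) (hs : Summable b) :
    HasSum g (∑' k, a k) := by
  obtain ⟨e, he⟩ : ∃ e : (Σ k, {S : Finset I // S.card = k}) ≃ Finset I, ∀ x, e x = x.2.1 :=
    ⟨Equiv.sigmaFiberEquiv Finset.card, fun _ => rfl⟩
  have hsn : Summable fun x : Σ k, {S : Finset I // S.card = k} => ‖g x.2‖ :=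
    (summable_sigma_of_nonneg fun _ => norm_nonneg _).2
      ⟨fun k => (hb k).summable, hs.congr fun k => (hb k).tsum_eq.symm⟩
  have hfun : g ∘ e = fun x => g x.2.1 := funext fun x => by rw [Function.comp_apply, he]
  rw [← e.hasSum_iff, hfun]
  have h := hsn.of_norm.hasSum
  rwa [hsn.of_norm.tsum_sigma' fun k => (ha k).summable, tsum_congr fun k => (ha k).tsum_eq] at h

theorem tsum_finset_sum {J K : Type*} {g : Finset (J ⊕ K) → ℂ} (hs : Summable g) :
    (∀ S : Finset J, Summable fun T : Finset K => g (S.disjSum T)) ∧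
      ∑' S, g S = ∑' S : Finset J, ∑' T : Finset K, g (S.disjSum T) := by
  obtain ⟨e, he⟩ : ∃ e : Finset J × Finset K ≃ Finset (J ⊕ K),
      ∀ S T, e (S, T) = S.disjSum T := ⟨Finset.sumEquiv.symm.toEquiv, fun _ _ => rfl⟩
  have hse : Summable fun x : Finset J × Finset K => g (e x) := e.summable_iff.2 hs
  have hf : ∀ S : Finset J, Summable fun T : Finset K => g (S.disjSum T) := fun S =>
    (hse.prod_factor S).congr fun T => by rw [he]
  refine ⟨hf, ?_⟩
  rw [← e.tsum_eq, hse.tsum_prod' fun S => hse.prod_factor S]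
  simp only [he]

/-- The value `∑ₖ (-1)ᵏ/k! ∑ det M(n_i, n_j)` of a Fredholm determinant over tuples. -/
noncomputable def tupleDet (M : I → I → ℂ) : ℂ :=
  ∑' k : ℕ, (-1) ^ k / (k.factorial : ℂ) *
    ∑' n : Fin k → I, (Matrix.of fun i j => M (n i) (n j)).det

/-- Passage from ordered tuples, which integrals produce, to finite sets, on which `HasFredholmDet`
is based. Each minor of size k is counted k! times, so the assumed bound leaves sᵏ/√k! at level k.
-/
theorem hasSum_minor (M : I → I → ℂ) (s : ℝ) (hs : 0 ≤ s)
    (h1 : ∀ k, Summable fun n : Fin k → I => ‖(Matrix.of fun i j => M (n i) (n j)).det‖)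
    (h2 : ∀ k, ∑' n : Fin k → I, ‖(Matrix.of fun i j => M (n i) (n j)).det‖ ≤
      Real.sqrt k.factorial * s ^ k) :
    HasSum (minor fun i j => -M i j) (tupleDet M) := by
  have hinj : ∀ (k : ℕ) (n : Fin k → I), ¬ Function.Injective n →
      (Matrix.of fun i j => M (n i) (n j)).det = 0 := fun k n hn => by
    simp only [Function.Injective, not_forall] at hn
    obtain ⟨i, j, hij, hne⟩ := hn
    exact Matrix.det_zero_of_row_eq hne (by ext l; simp [hij])
  have hk : ∀ k, HasSum (fun S : {S : Finset I // S.card = k} => (k.factorial : ℂ) * minor M S)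
      (∑' n : Fin k → I, (Matrix.of fun i j => M (n i) (n j)).det) := fun k =>
    hasSum_finset_of_tuple (h1 k).of_norm.hasSum (hinj k) fun S e => (minor_eq_det M S e).symm
  -- The norms are regarded as complex numbers so that `hasSum_finset_of_tuple` applies to them too;
  -- this provides the absolute convergence at each level.
  have hkn : ∀ k, HasSum (fun S : {S : Finset I // S.card = k} =>
      (k.factorial : ℂ) * (‖minor M S‖ : ℂ))
      (∑' n : Fin k → I, (‖(Matrix.of fun i j => M (n i) (n j)).det‖ : ℂ)) := fun k =>
    hasSum_finset_of_tuple (F := fun n => (‖(Matrix.of fun i j => M (n i) (n j)).det‖ : ℂ))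
      (g := fun S => (‖minor M S‖ : ℂ)) (Complex.hasSum_ofReal.2 (h1 k).hasSum |>.summable.hasSum)
      (fun n hn => by simp [hinj k n hn]) fun S e => by rw [minor_eq_det M S e]
  have hkr : ∀ k, HasSum (fun S : {S : Finset I // S.card = k} => ‖minor M S‖)
      ((k.factorial : ℝ)⁻¹ * ∑' n : Fin k → I, ‖(Matrix.of fun i j => M (n i) (n j)).det‖) :=
    fun k => by
      have h := (hkn k).mul_left ((k.factorial : ℂ)⁻¹)
      have h3 : ∀ z : ℂ, (k.factorial : ℂ)⁻¹ * (k.factorial * z) = z := fun z => by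
        rw [← mul_assoc, inv_mul_cancel₀ (Nat.cast_ne_zero.2 k.factorial_ne_zero), one_mul]
      simp_rw [h3] at h
      rw [← Complex.ofReal_tsum, ← Complex.ofReal_natCast, ← Complex.ofReal_inv,
        ← Complex.ofReal_mul] at h
      exact Complex.hasSum_ofReal.1 h
  have hneg : ∀ k (S : {S : Finset I // S.card = k}),
      minor (fun i j => -M i j) S = (-1) ^ k / k.factorial * (k.factorial * minor M S) :=
    fun k S => by
      rw [minor_neg, S.2, ← mul_assoc, div_mul_cancel₀ _ (Nat.cast_ne_zero.2 k.factorial_ne_zero)]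
  rw [tupleDet]
  refine hasSum_finset_of_card (fun k => ?_) (fun k => ?_) ?_ (b := fun k =>
    (k.factorial : ℝ)⁻¹ * ∑' n : Fin k → I, ‖(Matrix.of fun i j => M (n i) (n j)).det‖)
  · simp_rw [hneg]
    exact (hk k).mul_left _
  · refine (hkr k).congr_fun fun S => ?_
    rw [minor_neg]
    simp
  · refine Summable.of_nonneg_of_le (fun k => by positivity) (fun k => ?_)
      (summable_pow_div_sqrt_factorial s hs)
    have hf : (0 : ℝ) < k.factorial := Nat.cast_pos.2 k.factorial_pos
    calc _ ≤ (k.factorial : ℝ)⁻¹ * (Real.sqrt k.factorial * s ^ k) := by gcongr; exact h2 k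
      _ = s ^ k / Real.sqrt k.factorial := by
        rw [div_eq_mul_inv, mul_comm (s ^ k), ← mul_assoc]
        congr 1
        rw [inv_mul_eq_div, Real.sqrt_div_self']
        simp

theorem sum_powerset_minor {n : Type*} [Fintype n] [DecidableEq n] (M : I → I → ℂ) (F : Finset I)
    (e : n ≃ F) :
    ∑ S ∈ F.powerset, minor M S = (1 + Matrix.of fun i j => M (e i) (e j)).det := by
  classical
  rw [det_one_add_eq_sum_minors]
  let emb : n ↪ I := e.toEmbedding.trans (Function.Embedding.subtype _)
  have hF : Finset.univ.map emb = F := by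
    ext x
    simp only [Finset.mem_map, Finset.mem_univ, true_and, emb, Function.Embedding.trans_apply,
      Equiv.coe_toEmbedding, Function.Embedding.subtype_apply]
    exact ⟨fun ⟨i, hi⟩ => hi ▸ (e i).2, fun hx => ⟨e.symm ⟨x, hx⟩, by simp⟩⟩
  refine (Finset.sum_bij (fun (s : Finset n) _ => s.map emb) ?_ ?_ ?_ ?_).symm
  · intro s _
    rw [Finset.mem_powerset, ← hF]
    exact Finset.map_subset_map.2 (Finset.subset_univ _)
  · intro s _ t _ h
    exact Finset.map_injective _ h
  · intro S hS
    rw [Finset.mem_powerset, ← hF] at hS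
    obtain ⟨s, -, hs⟩ := Finset.subset_map_iff.1 hS
    exact ⟨s, Finset.mem_univ _, hs.symm⟩
  · intro s _
    let e' : s ≃ s.map emb := Equiv.ofBijective
      (fun i => ⟨emb i, Finset.mem_map_of_mem _ i.2⟩)
      ⟨fun i j h => Subtype.ext (emb.injective (by simpa using congrArg Subtype.val h)), fun ⟨x, hx⟩ => by
        obtain ⟨i, hi, rfl⟩ := Finset.mem_map.1 hx
        exact ⟨⟨i, hi⟩, rfl⟩⟩
    rw [minor_eq_det M (s.map emb) e']
    rfl

/-- Equivalence between a disjoint sum of finite sets and the sum type. -/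
noncomputable def disjSumEquiv {J K : Type*} (F : Finset J) (G : Finset K) : F ⊕ G ≃ F.disjSum G :=
  Equiv.ofBijective (Sum.elim (fun a => ⟨Sum.inl a, Finset.inl_mem_disjSum.2 a.2⟩)
      fun b => ⟨Sum.inr b, Finset.inr_mem_disjSum.2 b.2⟩) (by
    constructor
    · rintro (a | a) (b | b) h
      · exact congrArg Sum.inl (Subtype.ext (Sum.inl.inj (congrArg Subtype.val h)))
      · exact absurd (congrArg Subtype.val h) Sum.inl_ne_inr
      · exact absurd (congrArg Subtype.val h) Sum.inr_ne_inl
      · exact congrArg Sum.inr (Subtype.ext (Sum.inr.inj (congrArg Subtype.val h)))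
    · rintro ⟨a | a, ha⟩
      · exact ⟨Sum.inl ⟨a, Finset.inl_mem_disjSum.1 ha⟩, rfl⟩
      · exact ⟨Sum.inr ⟨a, Finset.inr_mem_disjSum.1 ha⟩, rfl⟩)

@[simp] theorem disjSumEquiv_inl {J K : Type*} (F : Finset J) (G : Finset K) (a : F) :
    (disjSumEquiv F G (Sum.inl a) : J ⊕ K) = Sum.inl (a : J) := rfl

@[simp] theorem disjSumEquiv_inr {J K : Type*} (F : Finset J) (G : Finset K) (b : G) :
    (disjSumEquiv F G (Sum.inr b) : J ⊕ K) = Sum.inr (b : K) := rfl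

/-- Infinite Cauchy–Binet formula: `det (1 - M) = det (1 - XY)` for the off-diagonal block matrix
`M = (0 X; Y 0)`. -/
theorem tsum_minor_sum {J K : Type*} (M : J ⊕ K → J ⊕ K → ℂ) (P : J → J → ℂ)
    (hs : Summable (minor fun i j => -M i j))
    (h11 : ∀ n n', M (Sum.inl n) (Sum.inl n') = 0) (h22 : ∀ n n', M (Sum.inr n) (Sum.inr n') = 0)
    (hP : ∀ n n', HasSum (fun l => M (Sum.inl n) (Sum.inr l) * M (Sum.inr l) (Sum.inl n'))
      (P n n')) :
    ∑' S, minor (fun i j => -M i j) S = ∑' S, minor (fun i j => -P i j) S := by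
  classical
  obtain ⟨hf, htsum⟩ := tsum_finset_sum hs
  rw [htsum]
  have hA := fun S => (hf S).hasSum
  -- For finite F and G the minors supported in F ⊔ G add up to the determinant of a finite matrix
  -- with identity diagonal blocks. The Schur complement reduces it to size F, where letting G grow
  -- only affects finitely many entries.
  have key : ∀ F : Finset J, ∑ S ∈ F.powerset, ∑' T, minor (fun i j => -M i j) (S.disjSum T) =
      ∑ S ∈ F.powerset, minor (fun i j => -P i j) S := fun F => by
    have h1 : HasSum (fun T => ∑ S ∈ F.powerset, minor (fun i j => -M i j) (S.disjSum T))
        (∑ S ∈ F.powerset, ∑' T, minor (fun i j => -M i j) (S.disjSum T)) :=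
      hasSum_sum fun S _ => hA S
    have h2 : Tendsto (fun G : Finset K => ∑ T ∈ G.powerset, ∑ S ∈ F.powerset,
        minor (fun i j => -M i j) (S.disjSum T)) atTop
        (𝓝 (∑ S ∈ F.powerset, ∑' T, minor (fun i j => -M i j) (S.disjSum T))) :=
      by
      rw [HasSum, SummationFilter.unconditional_filter] at h1
      exact h1.comp tendsto_finset_powerset_atTop_atTop
    have h3 : ∀ G : Finset K, ∑ T ∈ G.powerset, ∑ S ∈ F.powerset,
        minor (fun i j => -M i j) (S.disjSum T) =
          (1 + Matrix.of fun i j : F =>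
            -∑ l ∈ G, M (Sum.inl i) (Sum.inr l) * M (Sum.inr l) (Sum.inl j)).det := fun G => by
      have h4 : ∑ T ∈ G.powerset, ∑ S ∈ F.powerset, minor (fun i j => -M i j) (S.disjSum T) =
          ∑ S ∈ (F.disjSum G).powerset, minor (fun i j => -M i j) S := by
        rw [Finset.sum_comm, ← Finset.sum_product']
        refine Finset.sum_bij (fun x _ => x.1.disjSum x.2) ?_ ?_ ?_ ?_
        · rintro ⟨S, T⟩ h
          rw [Finset.mem_product, Finset.mem_powerset, Finset.mem_powerset] at h
          exact Finset.mem_powerset.2 (Finset.disjSum_mono h.1 h.2)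
        · rintro ⟨S, T⟩ _ ⟨S', T'⟩ _ h
          exact Finset.sumEquiv.symm.injective h
        · intro S hS
          rw [Finset.mem_powerset] at hS
          refine ⟨(S.toLeft, S.toRight), ?_, Finset.toLeft_disjSum_toRight⟩
          rw [Finset.mem_product, Finset.mem_powerset, Finset.mem_powerset]
          exact ⟨fun x hx => Finset.inl_mem_disjSum.1 (hS (Finset.mem_toLeft.1 hx)),
            fun x hx => Finset.inr_mem_disjSum.1 (hS (Finset.mem_toRight.1 hx))⟩
        · intros
          rfl
      rw [h4, sum_powerset_minor _ _ (disjSumEquiv F G)]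
      have h5 : (1 + Matrix.of fun i j : F ⊕ G =>
          -M (disjSumEquiv F G i) (disjSumEquiv F G j) : Matrix (F ⊕ G) (F ⊕ G) ℂ) =
          Matrix.fromBlocks 1 (Matrix.of fun (i : F) (l : G) => -M (Sum.inl i) (Sum.inr l))
            (Matrix.of fun (l : G) (i : F) => -M (Sum.inr l) (Sum.inl i)) 1 := by
        ext (i | i) (j | j) <;> simp [h11, h22, Matrix.one_apply]
      rw [h5, Matrix.det_fromBlocks_one₂₂, sub_eq_add_neg]
      congr 2
      ext i j
      simp only [Matrix.neg_apply, Matrix.mul_apply, Matrix.of_apply, neg_mul_neg]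
      rw [Finset.sum_coe_sort G fun l => M (Sum.inl i) (Sum.inr l) * M (Sum.inr l) (Sum.inl j)]
    simp_rw [h3] at h2
    have h6 : Tendsto (fun G : Finset K => (1 + Matrix.of fun i j : F =>
            -∑ l ∈ G, M (Sum.inl i) (Sum.inr l) * M (Sum.inr l) (Sum.inl j)).det) atTop
        (𝓝 (1 + Matrix.of fun i j : F => -P i j).det) := by
      have hc : Continuous fun N : Matrix F F ℂ => (1 + N).det :=
        (continuous_const.add continuous_id).matrix_det
      refine (hc.tendsto _).comp ?_
      refine tendsto_pi_nhds.2 fun i => tendsto_pi_nhds.2 fun j => ?_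
      have h := (hP i j).neg
      rw [HasSum, SummationFilter.unconditional_filter] at h
      simpa only [Matrix.of_apply, Finset.sum_neg_distrib] using h
    rw [tendsto_nhds_unique h2 h6, sum_powerset_minor _ F (Equiv.refl F)]
    rfl
  refine tsum_congr fun S => ?_
  -- The equality of the sums over all subsets of each F determines the individual terms, by
  -- induction on inclusion.
  induction S using Finset.strongInduction with
  | H S ih =>
    have h := key S
    rw [← sub_eq_zero, ← Finset.sum_sub_distrib, Finset.sum_eq_single S] at h
    · exact sub_eq_zero.1 h
    · intro T hT hne
      exact sub_eq_zero.2 (ih T (Finset.ssubset_iff_subset_ne.2 ⟨Finset.mem_powerset.1 hT, hne⟩))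
    · intro h'
      exact absurd (Finset.mem_powerset_self S) h'

end Minors

end KPZ

/-! ### Trace class operators and basis independence of their determinants. -/

namespace KPZ

section FredholmDeterminants

/-- Distinct basis vectors have distance √2, so the balls of radius 1/2 around them are disjoint,
nonempty and open. -/
theorem _root_.HilbertBasis.countable {ι E : Type*} [NormedAddCommGroup E] [InnerProductSpace ℂ E]
    [TopologicalSpace.SeparableSpace E] (b : HilbertBasis ι ℂ E) : Countable ι := by
  refine Pairwise.countable_of_isOpen_disjoint (s := fun i => Metric.ball (b i) (1 / 2)) ?_
    (fun i => Metric.isOpen_ball) (fun i => ⟨b i, Metric.mem_ball_self (by norm_num)⟩)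
  intro i j hij
  refine Metric.ball_disjoint_ball ?_
  have h : ‖b i - b j‖ ^ 2 = 2 := by
    have := @norm_sub_sq ℂ E _ _ _ (b i) (b j)
    rw [this, b.orthonormal.1 i, b.orthonormal.1 j, b.orthonormal.2 hij]
    norm_num
  rw [dist_eq_norm]
  nlinarith [norm_nonneg (b i - b j)]

theorem _root_.HilbertBasis.hasSum_norm_inner_sq {ι E : Type*} [NormedAddCommGroup E]
    [InnerProductSpace ℂ E] [CompleteSpace E] (b : HilbertBasis ι ℂ E) (x : E) :
    HasSum (fun i => ‖(inner ℂ (b i) x : ℂ)‖ ^ 2) (‖x‖ ^ 2) := by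
  have h := b.hasSum_inner_mul_inner x x
  rw [inner_self_eq_norm_sq_to_K] at h
  rw [← Complex.hasSum_ofReal]
  have h2 : (fun i => ((‖(inner ℂ (b i) x : ℂ)‖ ^ 2 : ℝ) : ℂ)) =
      fun i => (inner ℂ x (b i) : ℂ) * inner ℂ (b i) x := funext fun i => by
    rw [← inner_conj_symm x (b i), Complex.conj_mul', Complex.ofReal_pow]
  rw [h2, Complex.ofReal_pow]
  exact h

variable {X : Type*} [MeasurableSpace X] {μ : Measure X} [SigmaFinite μ] {J : Type*} [Countable J]
  {φ ψ : J → X → ℂ}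

/-- The matrix `∫ ψ_n φ_{n'}` attached to the kernel `∑ φ_n(x) ψ_n(y)`. -/
noncomputable def pairing (μ : Measure X) (φ ψ : J → X → ℂ) (n n' : J) : ℂ :=
  ∫ x, ψ n x * φ n' x ∂μ

theorem SqFamily.hasSum_minor_pairing (hφ : SqFamily μ φ) (hψ : SqFamily μ ψ) :
    HasSum (minor fun n n' => -pairing μ φ ψ n n') (tupleDet (pairing μ φ ψ)) :=
  hasSum_minor _ _ (tsum_nonneg fun _ => mul_nonneg (l2norm_nonneg _) (l2norm_nonneg _))
    (fun k => (hφ.hasSum_det hψ k).2.2.1) fun k => (hφ.hasSum_det hψ k).2.2.2.1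

theorem SqFamily.tupleDet_pairing (hφ : SqFamily μ φ) (hψ : SqFamily μ ψ) :
    tupleDet (pairing μ φ ψ) = ∑' k : ℕ, (-1) ^ k / (k.factorial : ℂ) *
      ∫ x : Fin k → X, (Matrix.of fun i j => ∑' n, φ n (x i) * ψ n (x j)).det
        ∂(Measure.pi fun _ => μ) := by
  refine tsum_congr fun k => ?_
  rw [← (hφ.hasSum_det hψ k).2.2.2.2]
  rfl

theorem SqFamily.summable_fredholm (hφ : SqFamily μ φ) (hψ : SqFamily μ ψ) :
    Summable fun k : ℕ => (-1) ^ k / (k.factorial : ℂ) *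
      ∫ x : Fin k → X, (Matrix.of fun i j => ∑' n, φ n (x i) * ψ n (x j)).det
        ∂(Measure.pi fun _ => μ) := by
  have hs : 0 ≤ ∑' n, l2norm μ (φ n) * l2norm μ (ψ n) :=
    tsum_nonneg fun _ => mul_nonneg (l2norm_nonneg _) (l2norm_nonneg _)
  refine Summable.of_norm_bounded (summable_pow_div_sqrt_factorial _ hs) fun k => ?_
  have hf : (0 : ℝ) < k.factorial := Nat.cast_pos.2 k.factorial_pos
  rw [norm_mul, norm_div, norm_pow, norm_neg, norm_one, one_pow, Complex.norm_natCast]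
  calc _ ≤ 1 / (k.factorial : ℝ) * (Real.sqrt k.factorial *
        (∑' n, l2norm μ (φ n) * l2norm μ (ψ n)) ^ k) := by
        gcongr
        exact (norm_integral_le_integral_norm _).trans (hφ.hasSum_det hψ k).2.1
    _ = _ := by
        rw [mul_comm, mul_comm (Real.sqrt _), mul_assoc, div_eq_mul_inv _ (Real.sqrt _), mul_one_div,
          Real.sqrt_div_self', one_div]

theorem pi_count {ι : Type*} [MeasurableSpace ι] [MeasurableSingletonClass ι] [Countable ι]
    (k : ℕ) : (Measure.pi fun _ : Fin k => (Measure.count : Measure ι)) = Measure.count := by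
  refine Measure.ext_of_singleton fun x => ?_
  simp

/-- The Andreief identity is applied to counting measure on the index set of the basis `e`. By
Parseval, ⟨e_i, b_n⟩ and ⟨a_n, e_i⟩ are square summable families; their kernel is the matrix of `T`
in the basis, while their pairing ⟨a_n, b_n'⟩ no longer involves the basis. -/
theorem hasFredholmDet_of_hasSum {E : Type} [NormedAddCommGroup E] [InnerProductSpace ℂ E]
    [CompleteSpace E] [TopologicalSpace.SeparableSpace E] (T : E →L[ℂ] E) (a b : J → E)
    (ha : Summable fun n => ‖a n‖ ^ 2) (hb : Summable fun n => ‖b n‖ ^ 2)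
    (hT : ∀ x, HasSum (fun n => (inner ℂ (a n) x : ℂ) • b n) (T x)) :
    HasFredholmDet T (tupleDet fun n n' => (inner ℂ (a n) (b n') : ℂ)) := by
  intro ι e
  have hι : Countable ι := e.countable
  -- With the discrete σ-algebra every function is measurable and integrals are sums.
  let _ : MeasurableSpace ι := ⊤
  have hms : MeasurableSingletonClass ι := ⟨fun _ => trivial⟩
  have hl2 : ∀ f : ι → ℂ, Summable (fun i => ‖f i‖ ^ 2) → MemLp f 2 Measure.count := fun f hf => by
    rw [memLp_two_iff_integrable_sq_norm (Measurable.of_discrete).aestronglyMeasurable,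
      integrable_count_iff]
    exact hf.norm
  have hint : ∀ f : ι → ℂ, Summable (fun i => ‖f i‖) → ∫ i, f i ∂Measure.count = ∑' i, f i :=
    fun f hf => by
      rw [integral_countable (integrable_count_iff.2 hf)]
      exact tsum_congr fun i => by simp
  have hintr : ∀ f : ι → ℝ, Summable (fun i => ‖f i‖) → ∫ i, f i ∂Measure.count = ∑' i, f i :=
    fun f hf => by
      rw [integral_countable (integrable_count_iff.2 hf)]
      exact tsum_congr fun i => by simp
  have hbess : ∀ x : E, HasSum (fun i => ‖(inner ℂ x (e i) : ℂ)‖ ^ 2) (‖x‖ ^ 2) := fun x => by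
    refine (e.hasSum_norm_inner_sq x).congr_fun fun i => ?_
    rw [norm_inner_symm]
  have hφ : SqFamily (Measure.count : Measure ι) fun n i => (inner ℂ (e i) (b n) : ℂ) := by
    refine ⟨fun n => hl2 _ (e.hasSum_norm_inner_sq _).summable, ?_, fun i => ?_⟩
    · refine hb.congr fun n => ?_
      rw [l2norm_sq, hintr _ (e.hasSum_norm_inner_sq _).summable.norm,
        (e.hasSum_norm_inner_sq _).tsum_eq]
    · refine Summable.of_nonneg_of_le (fun _ => sq_nonneg _) (fun n => ?_) hb
      have := norm_inner_le_norm (𝕜 := ℂ) (e i) (b n)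
      rw [e.orthonormal.1, one_mul] at this
      gcongr
  have hψ : SqFamily (Measure.count : Measure ι) fun n i => (inner ℂ (a n) (e i) : ℂ) := by
    refine ⟨fun n => hl2 _ (hbess _).summable, ?_, fun i => ?_⟩
    · refine ha.congr fun n => ?_
      rw [l2norm_sq, hintr _ (hbess _).summable.norm, (hbess _).tsum_eq]
    · refine Summable.of_nonneg_of_le (fun _ => sq_nonneg _) (fun n => ?_) ha
      have := norm_inner_le_norm (𝕜 := ℂ) (a n) (e i)
      rw [e.orthonormal.1, mul_one] at this
      gcongr
  have hpair : pairing (Measure.count : Measure ι) (fun n i => (inner ℂ (e i) (b n) : ℂ))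
      (fun n i => (inner ℂ (a n) (e i) : ℂ)) = fun n n' => (inner ℂ (a n) (b n') : ℂ) := by
    ext n n'
    rw [pairing, hint, e.tsum_inner_mul_inner]
    simp_rw [norm_mul]
    exact summable_mul_of_sq (hbess _).summable (e.hasSum_norm_inner_sq _).summable
      (fun _ => norm_nonneg _) fun _ => norm_nonneg _
  have hker : ∀ i j, ∑' n, (inner ℂ (e i) (b n) : ℂ) * inner ℂ (a n) (e j) =
      inner ℂ (e i) (T (e j)) := fun i j => by
    have h := (hT (e j)).mapL (innerSL ℂ (e i))
    rw [← innerSL_apply_apply ℂ, ← h.tsum_eq]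
    exact tsum_congr fun n => by simp [mul_comm]
  have hdet := fun k => hφ.hasSum_det hψ k
  simp only [pi_count, hker] at hdet
  -- Integrability for counting measure on tuples is absolute summability, and the L¹ bound of
  -- `hasSum_det` becomes the bound that `hasSum_minor` requires.
  have hmain := hasSum_minor (fun i j => (inner ℂ (e i) (T (e j)) : ℂ))
    (∑' n, l2norm Measure.count (fun i => (inner ℂ (e i) (b n) : ℂ)) *
      l2norm Measure.count (fun i => (inner ℂ (a n) (e i) : ℂ)))
    (tsum_nonneg fun _ => mul_nonneg (l2norm_nonneg _) (l2norm_nonneg _))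
    (fun k => integrable_count_iff.1 (hdet k).1) fun k => by
      have h1 := integrable_count_iff.1 (hdet k).1
      refine le_trans (le_of_eq ?_) (hdet k).2.1
      rw [integral_countable (integrable_count_iff.2 h1.norm)]
      exact tsum_congr fun i => by simp
  have hval : tupleDet (fun i j => (inner ℂ (e i) (T (e j)) : ℂ)) =
      tupleDet fun n n' => (inner ℂ (a n) (b n') : ℂ) := by
    rw [← hpair, hφ.tupleDet_pairing hψ, tupleDet]
    refine tsum_congr fun k => ?_
    simp only [pi_count, hker]
    rw [integral_countable (hdet k).1]
    congr 1
    exact tsum_congr fun i => by simp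
  rw [← hval]
  exact hmain

/-- `IsTraceClass` asks for sequences; the index type is embedded in ℕ and the vectors are extended
by zero. -/
theorem isTraceClass_of_hasSum {E : Type} [NormedAddCommGroup E] [InnerProductSpace ℂ E]
    [CompleteSpace E] (T : E →L[ℂ] E) (a b : J → E)
    (ha : Summable fun n => ‖a n‖ ^ 2) (hb : Summable fun n => ‖b n‖ ^ 2)
    (hT : ∀ x, HasSum (fun n => (inner ℂ (a n) x : ℂ) • b n) (T x)) : IsTraceClass T := by
  obtain ⟨e, he⟩ := exists_injective_nat J
  refine ⟨Function.extend e a 0, Function.extend e b 0, ?_, fun x => ?_⟩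
  · have h : (fun n => ‖Function.extend e a 0 n‖ * ‖Function.extend e b 0 n‖) =
        Function.extend e (fun n => ‖a n‖ * ‖b n‖) 0 := by
      ext n
      by_cases hn : ∃ j, e j = n
      · obtain ⟨j, rfl⟩ := hn
        simp [he.extend_apply]
      · simp [Function.extend_apply' _ _ _ hn]
    rw [h, summable_extend_zero he]
    exact summable_mul_of_sq ha hb (fun _ => norm_nonneg _) fun _ => norm_nonneg _
  · have h : (fun n => (inner ℂ (Function.extend e a 0 n) x : ℂ) • Function.extend e b 0 n) =
        Function.extend e (fun n => (inner ℂ (a n) x : ℂ) • b n) 0 := by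
      ext n
      by_cases hn : ∃ j, e j = n
      · obtain ⟨j, rfl⟩ := hn
        simp [he.extend_apply]
      · simp [Function.extend_apply' _ _ _ hn]
    rw [h, hasSum_extend_zero he]
    exact hT x

theorem SqFamily.conj (hψ : SqFamily μ ψ) : SqFamily μ fun n x => (starRingEnd ℂ) (ψ n x) := by
  refine ⟨fun n => (hψ.memLp n).star, hψ.summable_l2norm.congr fun n => ?_, fun x => ?_⟩
  · simp [l2norm]
  · simpa using hψ.summable_apply x

/-- The operator with kernel `∑ φ_n(x) ψ_n(y)`. -/
theorem exists_kernelOperator (hφ : SqFamily μ φ) (hψ : SqFamily μ ψ) :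
    ∃ T : Lp ℂ 2 μ →L[ℂ] Lp ℂ 2 μ,
      (∀ f : Lp ℂ 2 μ, HasSum (fun n => (inner ℂ ((hψ.conj.memLp n).toLp _) f : ℂ) •
        (hφ.memLp n).toLp (φ n)) (T f)) ∧
      ∀ f : Lp ℂ 2 μ, ∀ᵐ x ∂μ, Integrable (fun y => (∑' n, φ n x * ψ n y) * f y) μ ∧
        T f x = ∫ y, (∑' n, φ n x * ψ n y) * f y ∂μ := by
  -- Conjugation compensates for the inner product being antilinear in its first argument: ⟨a_n, f⟩
  -- is the bilinear integral ∫ ψ_n f.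
  set a := fun n => (hψ.conj.memLp n).toLp (fun x => (starRingEnd ℂ) (ψ n x)) with ha
  set b := fun n => (hφ.memLp n).toLp (φ n) with hb
  have hna : ∀ n, ‖a n‖ = l2norm μ (ψ n) := fun n => by
    rw [ha, norm_toLp_eq]
    simp [l2norm]
  have hnb : ∀ n, ‖b n‖ = l2norm μ (φ n) := fun n => by rw [hb, norm_toLp_eq]
  have hsum : Summable fun n => ‖(innerSL ℂ (a n)).smulRight (b n)‖ := by
    simp_rw [ContinuousLinearMap.norm_smulRight_apply, innerSL_apply_norm, hna, hnb]
    exact hψ.summable_l2norm_mul hφ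
  have hT : ∀ f : Lp ℂ 2 μ, HasSum (fun n => (inner ℂ (a n) f : ℂ) • b n)
      ((∑' n, (innerSL ℂ (a n)).smulRight (b n)) f) := fun f =>
    hsum.of_norm.hasSum.mapL (ContinuousLinearMap.apply ℂ (Lp ℂ 2 μ) f)
  have hin : ∀ n (f : Lp ℂ 2 μ), (inner ℂ (a n) f : ℂ) = ∫ y, ψ n y * f y ∂μ := fun n f => by
    rw [L2.inner_def]
    refine integral_congr_ae ?_
    filter_upwards [(hψ.conj.memLp n).coeFn_toLp] with x hx
    rw [ha, hx, RCLike.inner_apply, Complex.conj_conj, mul_comm]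
  refine ⟨∑' n, (innerSL ℂ (a n)).smulRight (b n), hT, fun f => ?_⟩
  have hsf : Summable fun n => ‖(inner ℂ (a n) f : ℂ) • b n‖ := by
    refine Summable.of_nonneg_of_le (fun _ => norm_nonneg _) (fun n => ?_)
      (hsum.mul_right ‖f‖)
    exact ((innerSL ℂ (a n)).smulRight (b n)).le_opNorm f
  -- A series that converges absolutely in L² also converges almost everywhere to its sum, which
  -- allows a comparison with the termwise integral at fixed x.
  have hae := Lp.hasSum_coeFn_tsum (tsum_enorm_ne_top_iff_summable_norm.2 hsf)
  rw [(hT f).tsum_eq] at hae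
  have hall : ∀ᵐ x ∂μ, ∀ n, ((inner ℂ (a n) f : ℂ) • b n) x = (∫ y, ψ n y * f y ∂μ) * φ n x :=
    ae_all_iff.2 fun n => by
      filter_upwards [Lp.coeFn_smul (inner ℂ (a n) f : ℂ) (b n), (hφ.memLp n).coeFn_toLp]
        with x hx hx'
      rw [hx, Pi.smul_apply, hb, hx', hin, smul_eq_mul]
  have hfm : MemLp (fun y => f y) 2 μ := Lp.memLp f
  filter_upwards [hae, hall] with x hx hx'
  have hF : ∀ n, Integrable (fun y => φ n x * ψ n y * f y) μ := fun n => by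
    simp_rw [mul_assoc]
    exact (MemLp.integrable_mul (p := 2) (q := 2) (hψ.memLp n) hfm).const_mul _
  have hFs : Summable fun n => ∫ y, ‖φ n x * ψ n y * f y‖ ∂μ := by
    refine Summable.of_nonneg_of_le (fun n => integral_nonneg fun _ => norm_nonneg _) (fun n => ?_)
      ((summable_mul_of_sq (hφ.summable_apply x) hψ.summable_l2norm (fun _ => norm_nonneg _)
        fun _ => l2norm_nonneg _).mul_right (l2norm μ fun y => f y))
    simp_rw [mul_assoc, norm_mul (φ n x)]
    rw [integral_const_mul]
    exact mul_le_mul_of_nonneg_left (integral_norm_mul_le (hψ.memLp n) hfm) (norm_nonneg _)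
  have h1 := (integrable_tsum_of_summable_integral_norm hF hFs).1
  have h2 := hasSum_integral_of_summable_integral_norm hF hFs
  simp_rw [tsum_mul_right] at h1 h2
  refine ⟨h1, ?_⟩
  simp_rw [hx'] at hx
  rw [← h2.tsum_eq, ← hx.tsum_eq]
  refine tsum_congr fun n => ?_
  simp_rw [mul_assoc]
  rw [integral_const_mul, mul_comm]

end FredholmDeterminants

end KPZ

/-! ### Composition of kernels. -/

namespace KPZ

section Composition

variable {X : Type*} [MeasurableSpace X] {μ : Measure X} [SigmaFinite μ] {J : Type*} [Countable J]

/-- An absolutely convergent series in `L²`, summed pointwise. -/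
theorem memLp_tsum_mul {c : J → ℂ} {θ : J → X → ℂ} (hθ : ∀ n, MemLp (θ n) 2 μ)
    (hs : Summable fun n => ‖c n‖ * l2norm μ (θ n)) :
    MemLp (fun x => ∑' n, c n * θ n x) 2 μ ∧
      l2norm μ (fun x => ∑' n, c n * θ n x) ≤ ∑' n, ‖c n‖ * l2norm μ (θ n) ∧
      ∀ g : X → ℂ, MemLp g 2 μ →
        HasSum (fun n => c n * ∫ x, θ n x * g x ∂μ) (∫ x, (∑' n, c n * θ n x) * g x ∂μ) := by
  set v : J → Lp ℂ 2 μ := fun n => c n • (hθ n).toLp (θ n) with hv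
  have hn : ∀ n, ‖v n‖ = ‖c n‖ * l2norm μ (θ n) := fun n => by rw [hv, norm_smul, norm_toLp_eq]
  have hsv : Summable fun n => ‖v n‖ := hs.congr fun n => (hn n).symm
  have hae := Lp.coeFn_tsum (tsum_enorm_ne_top_iff_summable_norm.2 hsv)
  have hall : ∀ᵐ x ∂μ, ∀ n, v n x = c n * θ n x := ae_all_iff.2 fun n => by
    filter_upwards [Lp.coeFn_smul (c n) ((hθ n).toLp (θ n)), (hθ n).coeFn_toLp] with x hx hx'
    rw [hv, hx, Pi.smul_apply, hx', smul_eq_mul]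
  have heq : (∑' n, v n : Lp ℂ 2 μ) =ᵐ[μ] fun x => ∑' n, c n * θ n x := by
    filter_upwards [hae, hall] with x hx hx'
    rw [hx]
    exact tsum_congr hx'
  have hm : MemLp (fun x => ∑' n, c n * θ n x) 2 μ := (memLp_congr_ae heq).1 (Lp.memLp _)
  have hL : hm.toLp _ = ∑' n, v n := by
    refine Lp.ext ?_
    filter_upwards [hm.coeFn_toLp, heq] with x hx hx'
    rw [hx, hx']
  refine ⟨hm, ?_, fun g hg => ?_⟩
  · rw [← norm_toLp_eq hm, hL]
    refine (norm_tsum_le_tsum_norm hsv).trans (le_of_eq (tsum_congr hn))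
  · have h := hsv.of_norm.hasSum.mapL (innerSL ℂ (hg.star.toLp _))
    have hin : ∀ w : Lp ℂ 2 μ, innerSL ℂ (hg.star.toLp _) w = ∫ x, w x * g x ∂μ := fun w => by
      rw [innerSL_apply_apply, L2.inner_def]
      refine integral_congr_ae ?_
      filter_upwards [hg.star.coeFn_toLp] with x hx
      rw [hx, RCLike.inner_apply]
      simp
    simp_rw [hin] at h
    have h1 : ∫ x, (∑' n, v n : Lp ℂ 2 μ) x * g x ∂μ = ∫ x, (∑' n, c n * θ n x) * g x ∂μ :=
      integral_congr_ae (heq.mono fun x hx => by simp only [hx])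
    have h2 : ∀ n, ∫ x, v n x * g x ∂μ = c n * ∫ x, θ n x * g x ∂μ := fun n => by
      rw [← integral_const_mul]
      refine integral_congr_ae (hall.mono fun x hx => ?_)
      simp only [hx n, mul_assoc]
    rw [h1] at h
    simpa only [h2] using h

variable {φ₁ ψ₁ φ₂ ψ₂ : J → X → ℂ}

/-- The second family in the expansion of a product of two kernels. -/
noncomputable def composeFamily (μ : Measure X) (ψ₁ φ₂ ψ₂ : J → X → ℂ) (n : J) (y : X) : ℂ :=
  ∑' l, pairing μ φ₂ ψ₁ n l * ψ₂ l y

theorem SqFamily.row (hφ : SqFamily μ φ₁) (hψ : SqFamily μ ψ₁) (x : X) :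
    MemLp (fun y => ∑' n, φ₁ n x * ψ₁ n y) 2 μ ∧ ∀ g : X → ℂ, MemLp g 2 μ →
      HasSum (fun n => φ₁ n x * ∫ y, ψ₁ n y * g y ∂μ)
        (∫ y, (∑' n, φ₁ n x * ψ₁ n y) * g y ∂μ) := by
  have h := memLp_tsum_mul (c := fun n => φ₁ n x) hψ.memLp
    (summable_mul_of_sq (hφ.summable_apply x) hψ.summable_l2norm (fun _ => norm_nonneg _)
      fun _ => l2norm_nonneg _)
  exact ⟨h.1, h.2.2⟩

theorem norm_pairing_le (hψ : SqFamily μ ψ₁) (hφ : SqFamily μ φ₂) (n l : J) :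
    ‖pairing μ φ₂ ψ₁ n l‖ ≤ l2norm μ (ψ₁ n) * l2norm μ (φ₂ l) :=
  norm_integral_mul_le (hψ.memLp n) (hφ.memLp l)

/-- By Cauchy–Schwarz the pairing is at most a product of norms. Hence the n-th function is bounded,
in L² and at each point y, by `l2norm μ (ψ₁ n)` times a factor that does not depend on n. -/
theorem SqFamily.compose (hψ₁ : SqFamily μ ψ₁) (hφ₂ : SqFamily μ φ₂) (hψ₂ : SqFamily μ ψ₂) :
    SqFamily μ (composeFamily μ ψ₁ φ₂ ψ₂) := by
  have hs := hφ₂.summable_l2norm_mul hψ₂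
  have hle : ∀ n l, ‖pairing μ φ₂ ψ₁ n l‖ * l2norm μ (ψ₂ l) ≤
      l2norm μ (ψ₁ n) * (l2norm μ (φ₂ l) * l2norm μ (ψ₂ l)) := fun n l => by
    rw [← mul_assoc]
    exact mul_le_mul_of_nonneg_right (norm_pairing_le hψ₁ hφ₂ n l) (l2norm_nonneg _)
  have hsn : ∀ n, Summable fun l => ‖pairing μ φ₂ ψ₁ n l‖ * l2norm μ (ψ₂ l) := fun n =>
    Summable.of_nonneg_of_le (fun l => mul_nonneg (norm_nonneg _) (l2norm_nonneg _)) (hle n)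
      (hs.mul_left _)
  have hmain := fun n => memLp_tsum_mul hψ₂.memLp (hsn n)
  refine ⟨fun n => (hmain n).1, ?_, fun y => ?_⟩
  · refine Summable.of_nonneg_of_le (fun n => sq_nonneg _) (fun n => ?_)
      (hψ₁.summable_l2norm.mul_right ((∑' l, l2norm μ (φ₂ l) * l2norm μ (ψ₂ l)) ^ 2))
    rw [← mul_pow]
    refine pow_le_pow_left₀ (l2norm_nonneg _) ((hmain n).2.1.trans ?_) 2
    rw [← tsum_mul_left]
    exact (hsn n).tsum_le_tsum (hle n) (hs.mul_left _)
  · have hsy : Summable fun l => l2norm μ (φ₂ l) * ‖ψ₂ l y‖ :=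
      summable_mul_of_sq hφ₂.summable_l2norm (hψ₂.summable_apply y) (fun _ => l2norm_nonneg _)
        fun _ => norm_nonneg _
    refine Summable.of_nonneg_of_le (fun n => sq_nonneg _) (fun n => ?_)
      (hψ₁.summable_l2norm.mul_right ((∑' l, l2norm μ (φ₂ l) * ‖ψ₂ l y‖) ^ 2))
    rw [← mul_pow]
    have hb : ∀ l, ‖pairing μ φ₂ ψ₁ n l * ψ₂ l y‖ ≤
        l2norm μ (ψ₁ n) * (l2norm μ (φ₂ l) * ‖ψ₂ l y‖) := fun l => by
      rw [norm_mul, ← mul_assoc]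
      exact mul_le_mul_of_nonneg_right (norm_pairing_le hψ₁ hφ₂ n l) (norm_nonneg _)
    refine pow_le_pow_left₀ (norm_nonneg _) ?_ 2
    rw [← tsum_mul_left]
    exact tsum_of_norm_bounded (hsy.mul_left _).hasSum hb

/-- The product of two kernels given by square summable families. -/
theorem integral_kernel_mul_kernel (hφ₁ : SqFamily μ φ₁) (hψ₁ : SqFamily μ ψ₁)
    (hφ₂ : SqFamily μ φ₂) (hψ₂ : SqFamily μ ψ₂) (x y : X) :
    Integrable (fun z => (∑' n, φ₁ n x * ψ₁ n z) * ∑' n, φ₂ n z * ψ₂ n y) μ ∧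
      ∫ z, (∑' n, φ₁ n x * ψ₁ n z) * ∑' n, φ₂ n z * ψ₂ n y ∂μ =
        ∑' n, φ₁ n x * composeFamily μ ψ₁ φ₂ ψ₂ n y := by
  have hr := hφ₁.row hψ₁ x
  have hc := hψ₂.row hφ₂ y
  simp_rw [mul_comm (ψ₂ _ y)] at hc
  refine ⟨MemLp.integrable_mul (p := 2) (q := 2) hr.1 hc.1, ?_⟩
  rw [← (hr.2 _ hc.1).tsum_eq]
  refine tsum_congr fun n => ?_
  congr 1
  have := (hc.2 _ (hψ₁.memLp n)).tsum_eq
  rw [composeFamily]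
  calc _ = ∫ z, (∑' l, φ₂ l z * ψ₂ l y) * ψ₁ n z ∂μ := by simp_rw [mul_comm]
    _ = _ := by
      rw [← this]
      refine tsum_congr fun l => ?_
      rw [pairing, mul_comm]
      simp_rw [mul_comm]

/-- The matrix of the composed kernel is the product of the two off-diagonal matrices. This is the
hypothesis on `P` in `tsum_minor_sum`. -/
theorem hasSum_pairing_composeFamily (hφ₁ : SqFamily μ φ₁) (hψ₁ : SqFamily μ ψ₁)
    (hφ₂ : SqFamily μ φ₂) (hψ₂ : SqFamily μ ψ₂) (n n' : J) :
    HasSum (fun l => pairing μ φ₂ ψ₁ n l * pairing μ φ₁ ψ₂ l n')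
      (pairing μ φ₁ (composeFamily μ ψ₁ φ₂ ψ₂) n n') := by
  have hs := hφ₂.summable_l2norm_mul hψ₂
  have hsn : Summable fun l => ‖pairing μ φ₂ ψ₁ n l‖ * l2norm μ (ψ₂ l) := by
    refine Summable.of_nonneg_of_le (fun l => mul_nonneg (norm_nonneg _) (l2norm_nonneg _))
      (fun l => ?_) (hs.mul_left (l2norm μ (ψ₁ n)))
    rw [← mul_assoc]
    exact mul_le_mul_of_nonneg_right (norm_pairing_le hψ₁ hφ₂ n l) (l2norm_nonneg _)
  exact (memLp_tsum_mul hψ₂.memLp hsn).2.2 _ (hφ₁.memLp n')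

end Composition

end KPZ

/-! ### Integral operators on `Ω` and the determinant of an off-diagonal kernel. -/

namespace KPZ

section Operators

variable {Ω : SpectralSet} [SigmaFinite Ω.absMeasure] {J : Type} [Countable J]
  {φ ψ : J → ℂ → ℂ}

/-- The phase is measurable and bounded. -/
structure SpectralSet.PhaseRegular (Ω : SpectralSet) : Prop where
  meas : AEStronglyMeasurable Ω.phase Ω.absMeasure
  norm_le : ∀ z, ‖Ω.phase z‖ ≤ 1

theorem memLp_mul_of_norm_le_one {X : Type*} [MeasurableSpace X] {μ : Measure X} {f c : X → ℂ}
    (hf : MemLp f 2 μ) (hc : AEStronglyMeasurable c μ) (h1 : ∀ x, ‖c x‖ ≤ 1) :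
    MemLp (fun x => c x * f x) 2 μ :=
  hf.of_le (hc.mul hf.1) (ae_of_all _ fun x => by
    rw [norm_mul]
    exact mul_le_of_le_one_left (norm_nonneg _) (h1 x))

theorem l2norm_le_of_norm_le {X : Type*} [MeasurableSpace X] {μ : Measure X} {f g : X → ℂ}
    (hf : MemLp f 2 μ) (hle : ∀ x, ‖g x‖ ≤ ‖f x‖) : l2norm μ g ≤ l2norm μ f := by
  refine Real.sqrt_le_sqrt (integral_mono_of_nonneg (ae_of_all _ fun _ => sq_nonneg _)
    hf.integrable_normSq (ae_of_all _ fun x => ?_))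
  exact pow_le_pow_left₀ (norm_nonneg _) (hle x) 2

theorem SqFamily.mul {X : Type*} [MeasurableSpace X] {μ : Measure X} {φ : J → X → ℂ} {c : X → ℂ}
    (hφ : SqFamily μ φ) (hc : AEStronglyMeasurable c μ) (h1 : ∀ x, ‖c x‖ ≤ 1) :
    SqFamily μ fun n x => c x * φ n x := by
  have hle : ∀ n x, ‖c x * φ n x‖ ≤ ‖φ n x‖ := fun n x => by
    rw [norm_mul]
    exact mul_le_of_le_one_left (norm_nonneg _) (h1 x)
  refine ⟨fun n => memLp_mul_of_norm_le_one (hφ.memLp n) hc h1, ?_, fun x => ?_⟩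
  · exact Summable.of_nonneg_of_le (fun _ => sq_nonneg _) (fun n => pow_le_pow_left₀
      (l2norm_nonneg _) (l2norm_le_of_norm_le (hφ.memLp n) (hle n)) 2) hφ.summable_l2norm
  · exact Summable.of_nonneg_of_le (fun _ => sq_nonneg _) (fun n => pow_le_pow_left₀
      (norm_nonneg _) (hle n x) 2) (hφ.summable_apply x)

/-- The kernel prescribes the values almost everywhere; therefore the choice made in
`CubicFamily.operator` is harmless. -/
theorem SpectralSet.IsIntegralOperator.unique {K : ℂ → ℂ → ℂ} {T S : Ω.L2 →L[ℂ] Ω.L2}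
    (hT : Ω.IsIntegralOperator K T) (hS : Ω.IsIntegralOperator K S) : T = S := by
  ext f
  filter_upwards [hT f, hS f] with x hx hx'
  rw [hx.2, hx'.2]

/-- Integration against dμ is integration against |dμ| with the extra factor `phase`, which is
absorbed into the right family; the pairing thereby becomes an integral against dμ. -/
theorem exists_isIntegralOperator (hΩ : Ω.PhaseRegular) (hφ : SqFamily Ω.absMeasure φ)
    (hψ : SqFamily Ω.absMeasure ψ) {K : ℂ → ℂ → ℂ} (hK : ∀ u v, K u v = ∑' n, φ n u * ψ n v) :
    ∃ T, Ω.IsIntegralOperator K T ∧ IsTraceClass T ∧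
      HasFredholmDet T (tupleDet (pairing Ω.absMeasure φ fun n v => Ω.phase v * ψ n v)) := by
  have hψ' := hψ.mul hΩ.meas hΩ.norm_le
  have : Fact ((2 : ENNReal) ≠ ⊤) := ⟨by norm_num⟩
  have : TopologicalSpace.SeparableSpace Ω.L2 := inferInstance
  obtain ⟨T, hT, hTi⟩ := exists_kernelOperator hφ hψ'
  have hker : ∀ u v, ∑' n, φ n u * (Ω.phase v * ψ n v) = K u v * Ω.phase v := fun u v => by
    rw [hK, ← tsum_mul_right]
    exact tsum_congr fun n => by ring
  have ha : Summable fun n => ‖(hψ'.conj.memLp n).toLp _‖ ^ 2 :=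
    hψ'.conj.summable_l2norm.congr fun n => by rw [norm_toLp_eq]
  have hb : Summable fun n => ‖(hφ.memLp n).toLp _‖ ^ 2 :=
    hφ.summable_l2norm.congr fun n => by rw [norm_toLp_eq]
  refine ⟨T, fun f => ?_, isTraceClass_of_hasSum T _ _ ha hb hT, ?_⟩
  · filter_upwards [hTi f] with x hx
    simp_rw [hker] at hx
    refine ⟨hx.1.congr (ae_of_all _ fun v => by ring), hx.2.trans ?_⟩
    exact integral_congr_ae (ae_of_all _ fun v => by ring)
  · have h := hasFredholmDet_of_hasSum T _ _ ha hb hT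
    convert h using 2
    ext n n'
    rw [inner_toLp]
    simp [pairing]

open Classical in
theorem norm_chi_le_one (S : Set ℂ) (z : ℂ) : ‖chi S z‖ ≤ 1 := by
  rw [chi, Set.indicator_apply]
  split_ifs <;> simp

theorem aestronglyMeasurable_chi {S : Set ℂ} (hS : MeasurableSet S) {μ : Measure ℂ} :
    AEStronglyMeasurable (chi S) μ :=
  (stronglyMeasurable_const.indicator hS).aestronglyMeasurable

theorem chi_mul_chi_of_disjoint {S T : Set ℂ} (h : Disjoint S T) (z : ℂ) :
    chi S z * chi T z = 0 := by
  by_cases hS : z ∈ S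
  · have hT : z ∉ T := Set.disjoint_left.1 h hS
    simp [chi, hT]
  · simp [chi, hS]

theorem hasSum_sum_type {J K E : Type*} [NormedAddCommGroup E] {f : J ⊕ K → E} {a b : E}
    (h₁ : HasSum (fun n => f (Sum.inl n)) a) (h₂ : HasSum (fun n => f (Sum.inr n)) b) :
    HasSum f (a + b) :=
  HasSum.sum h₁ h₂

theorem SqFamily.sum {X K : Type*} [MeasurableSpace X] {μ : Measure X} {φ : J → X → ℂ}
    {φ' : K → X → ℂ} (h : SqFamily μ φ) (h' : SqFamily μ φ') :
    SqFamily μ (Sum.elim φ φ') := by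
  refine ⟨fun n => ?_, ?_, fun x => ?_⟩
  · rcases n with n | n
    · exact h.memLp n
    · exact h'.memLp n
  · exact (hasSum_sum_type (f := fun n => l2norm μ (Sum.elim φ φ' n) ^ 2)
      h.summable_l2norm.hasSum h'.summable_l2norm.hasSum).summable
  · exact (hasSum_sum_type (f := fun n => ‖Sum.elim φ φ' n x‖ ^ 2)
      (h.summable_apply x).hasSum (h'.summable_apply x).hasSum).summable

/-- The Fredholm determinant of a kernel that interchanges two sets `W₁, W₂` is the Fredholm series
of the product of its two blocks; the blocks may be conjugated by a non-vanishing function. -/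
theorem block_fredholm (hΩ : Ω.PhaseRegular) (hφ : SqFamily Ω.absMeasure φ)
    (hψ : SqFamily Ω.absMeasure ψ) {H : ℂ → ℂ → ℂ} (hH : ∀ u v, H u v = ∑' n, φ n u * ψ n v)
    {W₁ W₂ : Set ℂ} (hW₁ : MeasurableSet W₁) (hW₂ : MeasurableSet W₂) (hW : Disjoint W₁ W₂)
    (hHW : ∀ u v, H u v = chi W₁ u * H u v * chi W₂ v + chi W₂ u * H u v * chi W₁ v)
    {h : ℂ → ℂ} (hh : ∀ z, h z ≠ 0) {K₁ K₂ : ℂ → ℂ → ℂ}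
    (hK₁ : ∀ u v, K₁ u v = h u * (chi W₁ u * H u v * chi W₂ v) * (h v)⁻¹)
    (hK₂ : ∀ u v, K₂ u v = h u * (chi W₂ u * H u v * chi W₁ v) * (h v)⁻¹) :
    (∀ u u', Integrable (fun v => K₁ u v * K₂ v u' * Ω.phase v) Ω.absMeasure) ∧
      Ω.FredholmSeriesConverges (fun u u' => Ω.integral fun v => K₁ u v * K₂ v u') ∧
      ∃ T, Ω.IsIntegralOperator H T ∧ IsTraceClass T ∧
        HasFredholmDet T (Ω.fredholmSeries fun u u' => Ω.integral fun v => K₁ u v * K₂ v u') := by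
  set μ := Ω.absMeasure with hμ
  set φ₁ : J → ℂ → ℂ := fun n u => chi W₁ u * φ n u with hφ₁d
  set φ₂ : J → ℂ → ℂ := fun n u => chi W₂ u * φ n u with hφ₂d
  set ψ₁ : J → ℂ → ℂ := fun n v => chi W₂ v * ψ n v with hψ₁d
  set ψ₂ : J → ℂ → ℂ := fun n v => chi W₁ v * ψ n v with hψ₂d
  have hφ₁ : SqFamily μ φ₁ := hφ.mul (aestronglyMeasurable_chi hW₁) (norm_chi_le_one _)
  have hφ₂ : SqFamily μ φ₂ := hφ.mul (aestronglyMeasurable_chi hW₂) (norm_chi_le_one _)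
  have hψ₁ : SqFamily μ ψ₁ := hψ.mul (aestronglyMeasurable_chi hW₂) (norm_chi_le_one _)
  have hψ₂ : SqFamily μ ψ₂ := hψ.mul (aestronglyMeasurable_chi hW₁) (norm_chi_le_one _)
  have hψ₁' : SqFamily μ fun n v => Ω.phase v * ψ₁ n v := hψ₁.mul hΩ.meas hΩ.norm_le
  have hψ₂' : SqFamily μ fun n v => Ω.phase v * ψ₂ n v := hψ₂.mul hΩ.meas hΩ.norm_le
  have hk₁ : ∀ u v, chi W₁ u * H u v * chi W₂ v = ∑' n, φ₁ n u * ψ₁ n v := fun u v => by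
    rw [hH, ← tsum_mul_left, ← tsum_mul_right]
    exact tsum_congr fun n => by simp only [hφ₁d, hψ₁d]; ring
  have hk₂ : ∀ u v, chi W₂ u * H u v * chi W₁ v = ∑' n, φ₂ n u * ψ₂ n v := fun u v => by
    rw [hH, ← tsum_mul_left, ← tsum_mul_right]
    exact tsum_congr fun n => by simp only [hφ₂d, hψ₂d]; ring
  -- the operator
  have hsum : ∀ u v, H u v = ∑' n, Sum.elim φ₁ φ₂ n u * Sum.elim ψ₁ ψ₂ n v := fun u v => by
    have h1 := (hφ₁.summable_norm_mul hψ₁ u v).of_norm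
    have h2 := (hφ₂.summable_norm_mul hψ₂ u v).of_norm
    have h3 : HasSum (fun n => Sum.elim φ₁ φ₂ n u * Sum.elim ψ₁ ψ₂ n v) (H u v) := by
      rw [hHW u v, hk₁, hk₂]
      exact hasSum_sum_type (f := fun n => Sum.elim φ₁ φ₂ n u * Sum.elim ψ₁ ψ₂ n v)
        h1.hasSum h2.hasSum
    exact h3.tsum_eq.symm
  obtain ⟨T, hT, hTt, hTd⟩ := exists_isIntegralOperator hΩ (hφ₁.sum hφ₂) (hψ₁.sum hψ₂) hsum
  -- the product kernel
  set χ := composeFamily μ (fun n v => Ω.phase v * ψ₁ n v) φ₂ ψ₂ with hχd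
  set χ' := composeFamily μ (fun n v => Ω.phase v * ψ₁ n v) φ₂ (fun n v => Ω.phase v * ψ₂ n v)
    with hχd'
  have hχχ' : ∀ n v, χ' n v = Ω.phase v * χ n v := fun n v => by
    rw [hχd, hχd', composeFamily, composeFamily, ← tsum_mul_left]
    exact tsum_congr fun l => by ring
  have hχ' : SqFamily μ χ' := hψ₁'.compose hφ₂ hψ₂'
  have hprod := fun u u' => integral_kernel_mul_kernel hφ₁ hψ₁' hφ₂ hψ₂ u u'
  -- The conjugating factors cancel at the intermediate variable v and survive only at the outer
  -- variables.
  have hcomb : ∀ u u' v, (∑' n, φ₁ n u * (Ω.phase v * ψ₁ n v)) * ∑' n, φ₂ n v * ψ₂ n u' =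
      (h u)⁻¹ * h u' * (K₁ u v * K₂ v u' * Ω.phase v) := fun u u' v => by
    have h0 : ∑' n, φ₁ n u * (Ω.phase v * ψ₁ n v) =
        Ω.phase v * (chi W₁ u * H u v * chi W₂ v) := by
      rw [hk₁, ← tsum_mul_left]
      exact tsum_congr fun n => by ring
    rw [h0, hK₁, hK₂, ← hk₂]
    have := hh u
    have := hh v
    have := hh u'
    field_simp
  simp_rw [hcomb] at hprod
  have hint : ∀ u u', Integrable (fun v => K₁ u v * K₂ v u' * Ω.phase v) μ := fun u u' => by
    refine (((hprod u u').1).const_mul (h u * (h u')⁻¹)).congr (ae_of_all _ fun v => ?_)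
    have := hh u
    have := hh u'
    simp only
    field_simp
  have hR : ∀ u u', ∑' n, φ₁ n u * χ' n u' = (h u)⁻¹ *
      ((Ω.integral fun v => K₁ u v * K₂ v u') * (h u' * Ω.phase u')) := fun u u' => by
    have h1 : ∑' n, φ₁ n u * χ' n u' = Ω.phase u' * ∑' n, φ₁ n u * χ n u' := by
      rw [← tsum_mul_left]
      exact tsum_congr fun n => by rw [hχχ']; ring
    rw [h1, ← (hprod u u').2, integral_const_mul, SpectralSet.integral]
    ring
  set R : ℂ → ℂ → ℂ := fun u u' => Ω.integral fun v => K₁ u v * K₂ v u' with hRd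
  -- Rows contribute the factors 1/h(u_i) and columns the factors h(u_j): conjugation does not
  -- change the determinant. The remaining column factors are the phases of `fredholmIntegrand`.
  have hdet : ∀ (k : ℕ) (u : Fin k → ℂ), Ω.fredholmIntegrand R k u =
      (Matrix.of fun i j => ∑' n, φ₁ n (u i) * χ' n (u j)).det := fun k u => by
    simp_rw [hR]
    have e1 := Matrix.det_mul_column (fun i => (h (u i))⁻¹)
      (Matrix.of fun i j => R (u i) (u j) * (h (u j) * Ω.phase (u j)))
    have e2 := Matrix.det_mul_row (fun j => h (u j) * Ω.phase (u j))
      (Matrix.of fun i j => R (u i) (u j))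
    simp only [Matrix.of_apply] at e1 e2
    have e3 : (Matrix.of fun i j => R (u i) (u j) * (h (u j) * Ω.phase (u j))) =
        Matrix.of fun i j => (h (u j) * Ω.phase (u j)) * R (u i) (u j) := by
      ext i j
      simp only [Matrix.of_apply, mul_comm]
    rw [e1, e3, e2, SpectralSet.fredholmIntegrand, Finset.prod_mul_distrib, Finset.prod_inv_distrib]
    have : ∏ i, h (u i) ≠ 0 := Finset.prod_ne_zero_iff.2 fun i _ => hh _
    field_simp
  have hterm : ∀ k : ℕ, Ω.fredholmTerm R k = (-1) ^ k / (k.factorial : ℂ) *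
      ∫ x : Fin k → ℂ, (Matrix.of fun i j => ∑' n, φ₁ n (x i) * χ' n (x j)).det
        ∂(Measure.pi fun _ => μ) := fun k => by
    rw [SpectralSet.fredholmTerm]
    simp_rw [hdet]
    rfl
  refine ⟨hint, ⟨fun k => ?_, ?_⟩, T, hT, hTt, ?_⟩
  · exact ((hφ₁.hasSum_det hχ' k).1).congr (ae_of_all _ fun u => (hdet k u).symm)
  · exact (hφ₁.summable_fredholm hχ').congr fun k => (hterm k).symm
  · have hval : Ω.fredholmSeries R = tupleDet (pairing μ φ₁ χ') := by
      rw [hφ₁.tupleDet_pairing hχ']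
      exact tsum_congr hterm
    have hψs : SqFamily μ fun n v => Ω.phase v * Sum.elim ψ₁ ψ₂ n v :=
      (hψ₁.sum hψ₂).mul hΩ.meas hΩ.norm_le
    have hM := (hφ₁.sum hφ₂).hasSum_minor_pairing hψs
    have hP := hφ₁.hasSum_minor_pairing hχ'
    have hdisj := chi_mul_chi_of_disjoint hW
    -- The families indexed by the doubled set J ⊕ J have a pairing matrix with vanishing diagonal
    -- blocks, because the supports `W₁` and `W₂` are disjoint; so `tsum_minor_sum` reduces the
    -- determinant of the whole kernel to that of the product.
    rw [hval, ← hP.tsum_eq, ← tsum_minor_sum _ _ hM.summable ?_ ?_ ?_, hM.tsum_eq]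
    · exact hTd
    · intro n n'
      refine integral_eq_zero_of_ae (ae_of_all _ fun v => ?_)
      simp only [Sum.elim_inl, hψ₁d, hφ₁d, Pi.zero_apply]
      linear_combination (Ω.phase v * ψ n v * φ n' v) * hdisj v
    · intro n n'
      refine integral_eq_zero_of_ae (ae_of_all _ fun v => ?_)
      simp only [Sum.elim_inr, hψ₂d, hφ₂d, Pi.zero_apply]
      linear_combination (Ω.phase v * ψ n v * φ n' v) * hdisj v
    · intro n n'
      exact hasSum_pairing_composeFamily hφ₁ hψ₁' hφ₂ hψ₂' n n'

end Operators

end KPZ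

/-! ### The vectors `F`, `G` and the factorisation of the kernel `H`. -/

namespace KPZ

/-- The index `0`-based of the component attached to `k`: `0` is sent to the last one. -/
def idx (m k : ℕ) : Fin (m + 1) := if h : 1 ≤ k ∧ k ≤ m then ⟨k - 1, by omega⟩ else Fin.last m

/-- The odd number among `j - 1, j`. -/
def oddOf (j : ℕ) : ℕ := if Odd j then j else j - 1

/-- The even number among `j - 1, j`. -/
def evenOf (j : ℕ) : ℕ := if Odd j then j - 1 else j

theorem odd_oddOf {j : ℕ} (hj : 1 ≤ j) : Odd (oddOf j) := by
  rw [oddOf]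
  split_ifs with h
  · exact h
  · rw [Nat.odd_iff] at h ⊢
    omega

theorem even_evenOf {j : ℕ} (hj : 1 ≤ j) : Even (evenOf j) := by
  rw [evenOf]
  split_ifs with h
  · rw [Nat.odd_iff] at h
    rw [Nat.even_iff]
    omega
  · exact Nat.not_odd_iff_even.1 h

theorem oddOf_le {m j : ℕ} (hj : j ∈ Finset.Icc 1 m) : oddOf j ≤ m := by
  rw [Finset.mem_Icc] at hj
  rw [oddOf]
  split_ifs <;> omega

theorem evenOf_le {m j : ℕ} (hj : j ∈ Finset.Icc 1 m) : evenOf j ≤ m := by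
  rw [Finset.mem_Icc] at hj
  rw [evenOf]
  split_ifs <;> omega

theorem idx_inj {m k l : ℕ} (hk : k ≤ m) (hl : l ≤ m) : idx m k = idx m l ↔ k = l := by
  refine ⟨fun h => ?_, fun h => by rw [h]⟩
  simp only [idx] at h
  split_ifs at h with h1 h2 h2
  all_goals simp only [Fin.ext_iff, Fin.val_last] at h
  all_goals omega

/-- This parity obstruction is the source both of F_n G_n = 0 and of the vanishing of F(u)ᵀG(v) on
`Ω₁ × Ω₁` and `Ω₂ × Ω₂`. -/
theorem idx_odd_ne_even {m i j : ℕ} (hi : i ∈ Finset.Icc 1 m) (hj : j ∈ Finset.Icc 1 m) :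
    idx m (oddOf i) ≠ idx m (evenOf j) := by
  rw [Ne, idx_inj (oddOf_le hi) (evenOf_le hj)]
  intro h
  have h1 := odd_oddOf (Finset.mem_Icc.1 hi).1
  rw [h] at h1
  exact Nat.not_even_iff_odd.2 h1 (even_evenOf (Finset.mem_Icc.1 hj).1)

/-- Each block `U` adds two neighbouring entries into its first row. In `Lambda1` the blocks collect
the indices with the same odd member of {i-1, i}, in `Lambda2` those with the same even member.
`E11` moves the entry with even member 0 to the last row. -/
theorem assemble_eq {m : ℕ} (a b : ℕ → ℂ) (n : Fin (m + 1)) :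
    KernelData.assemble m (fun j => a (j + 1)) (fun j => b (j + 1)) n =
      ∑ i ∈ Finset.Icc 1 m, ((if n = idx m (oddOf i) then a i else 0) +
        if n = idx m (evenOf i) then b i else 0) := by
  have hre : ∀ g : ℕ → ℂ, ∑ i ∈ Finset.Icc 1 m, g i = ∑ j : Fin m, g (j + 1) := fun g => by
    rw [Fin.sum_univ_eq_sum_range (fun j => g (j + 1)), Finset.range_eq_Ico,
      Finset.sum_Ico_add' g 0 m 1]
    rfl
  rw [hre]
  obtain ⟨n, hn⟩ := n
  rw [KernelData.assemble]
  simp only [Matrix.mulVec, dotProduct, Pi.add_apply]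
  split_ifs with h1 h2
  · rw [← Finset.sum_add_distrib]
    refine Finset.sum_congr rfl fun j _ => ?_
    have hj := j.2
    have e1 : (⟨n, hn⟩ : Fin (m + 1)) = idx m (oddOf (j + 1)) ↔
        Even n ∧ ((j : ℕ) = n ∨ (j : ℕ) = n + 1) := by
      rw [Nat.even_iff]
      rcases Nat.even_or_odd ((j : ℕ) + 1) with h | h
      · rw [oddOf, if_neg (Nat.not_odd_iff_even.2 h)]
        rw [Nat.even_iff] at h
        rw [idx, dif_pos (by omega), Fin.ext_iff]
        simp only
        omega
      · rw [oddOf, if_pos h]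
        rw [Nat.odd_iff] at h
        rw [idx, dif_pos (by omega), Fin.ext_iff]
        simp only
        omega
    have e2 : (⟨n, hn⟩ : Fin (m + 1)) = idx m (evenOf (j + 1)) ↔
        Odd n ∧ ((j : ℕ) = n ∨ (j : ℕ) = n + 1) := by
      rw [Nat.odd_iff]
      rcases Nat.even_or_odd ((j : ℕ) + 1) with h | h
      · rw [evenOf, if_neg (Nat.not_odd_iff_even.2 h)]
        rw [Nat.even_iff] at h
        rw [idx, dif_pos (by omega), Fin.ext_iff]
        simp only
        omega
      · rw [evenOf, if_pos h]
        rw [Nat.odd_iff] at h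
        rw [idx]
        split_ifs <;> rw [Fin.ext_iff] <;> simp only [Fin.val_last] <;> omega
    simp only [KernelData.Lambda1, KernelData.Lambda2, KernelData.E11, Matrix.of_apply,
      Matrix.sub_apply, e1, e2]
    congr 1
    · simp [ite_mul]
    · by_cases h0 : n = 0 ∧ (j : ℕ) = 0
      · simp [h0]
      · simp [h0, ite_mul]
  · refine Finset.sum_congr rfl fun j _ => ?_
    have hj := j.2
    have e1 : ¬ (⟨n, hn⟩ : Fin (m + 1)) = idx m (oddOf (j + 1)) := by
      have h := odd_oddOf (Nat.le_add_left 1 (j : ℕ))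
      have h' := oddOf_le (Finset.mem_Icc.2 ⟨Nat.le_add_left 1 (j : ℕ), hj⟩)
      rw [Nat.odd_iff] at h
      rw [idx, dif_pos ⟨by omega, h'⟩, Fin.ext_iff]
      simp only
      omega
    have e2 : (⟨n, hn⟩ : Fin (m + 1)) = idx m (evenOf (j + 1)) ↔ (j : ℕ) = 0 := by
      have h' := evenOf_le (Finset.mem_Icc.2 ⟨Nat.le_add_left 1 (j : ℕ), hj⟩)
      have h0 : evenOf ((j : ℕ) + 1) = 0 ↔ (j : ℕ) = 0 := by
        rw [evenOf]
        split_ifs with h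
        · omega
        · rw [Nat.odd_iff] at h
          refine iff_of_false id fun h5 => ?_
          rw [h5] at h
          norm_num at h
      rw [← h0, idx]
      split_ifs with h1' <;> rw [Fin.ext_iff] <;> simp only [Fin.val_last] <;> omega
    simp [KernelData.E11, e1, e2]
  · have : m = 0 := by omega
    subst this
    simp

namespace KernelData

variable {m : ℕ} (K : KernelData) (p : CubicParams m)

/-- The sets `Ω_{ℓ,j}` are measurable and pairwise disjoint. -/
structure HasCells (m : ℕ) : Prop where
  meas1 : ∀ j ∈ Finset.Icc 1 m, MeasurableSet (K.set1 j)
  meas2 : ∀ j ∈ Finset.Icc 1 m, MeasurableSet (K.set2 j)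
  disj11 : ∀ i ∈ Finset.Icc 1 m, ∀ j ∈ Finset.Icc 1 m, i ≠ j → Disjoint (K.set1 i) (K.set1 j)
  disj22 : ∀ i ∈ Finset.Icc 1 m, ∀ j ∈ Finset.Icc 1 m, i ≠ j → Disjoint (K.set2 i) (K.set2 j)
  disj12 : ∀ i ∈ Finset.Icc 1 m, ∀ j ∈ Finset.Icc 1 m, Disjoint (K.set1 i) (K.set2 j)
  cover : K.Ω.carrier ⊆ ⋃ j ∈ Finset.Icc 1 m, K.set1 j ∪ K.set2 j

/-- A function with prescribed values on the sets `Ω_{ℓ,j}`, extended by zero. -/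
noncomputable def glue (m : ℕ) (a b : ℕ → ℂ) (z : ℂ) : ℂ :=
  ∑ j ∈ Finset.Icc 1 m, (chi (K.set1 j) z * a j + chi (K.set2 j) z * b j)

variable {K}

theorem chi_of_mem {S : Set ℂ} {z : ℂ} (h : z ∈ S) : chi S z = 1 := by simp [chi, h]

theorem chi_of_notMem {S : Set ℂ} {z : ℂ} (h : z ∉ S) : chi S z = 0 := by simp [chi, h]

theorem HasCells.glue1 (hK : K.HasCells m) {i : ℕ} (hi : i ∈ Finset.Icc 1 m) {z : ℂ}
    (hz : z ∈ K.set1 i) (a b : ℕ → ℂ) : K.glue m a b z = a i := by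
  rw [glue, Finset.sum_eq_single_of_mem i hi fun j hj hji => ?_]
  · rw [chi_of_mem hz, chi_of_notMem (Set.disjoint_left.1 (hK.disj12 i hi i hi) hz)]
    ring
  · rw [chi_of_notMem (Set.disjoint_left.1 (hK.disj11 i hi j hj hji.symm) hz),
      chi_of_notMem (Set.disjoint_left.1 (hK.disj12 i hi j hj) hz)]
    ring

theorem HasCells.glue2 (hK : K.HasCells m) {i : ℕ} (hi : i ∈ Finset.Icc 1 m) {z : ℂ}
    (hz : z ∈ K.set2 i) (a b : ℕ → ℂ) : K.glue m a b z = b i := by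
  rw [glue, Finset.sum_eq_single_of_mem i hi fun j hj hji => ?_]
  · rw [chi_of_mem hz, chi_of_notMem (Set.disjoint_right.1 (hK.disj12 i hi i hi) hz)]
    ring
  · rw [chi_of_notMem (Set.disjoint_left.1 (hK.disj22 i hi j hj hji.symm) hz),
      chi_of_notMem (Set.disjoint_right.1 (hK.disj12 j hj i hi) hz)]
    ring

theorem glue0 {z : ℂ} (hz : ∀ j ∈ Finset.Icc 1 m, z ∉ K.set1 j ∧ z ∉ K.set2 j) (a b : ℕ → ℂ) :
    K.glue m a b z = 0 :=
  Finset.sum_eq_zero fun j hj => by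
    rw [chi_of_notMem (hz j hj).1, chi_of_notMem (hz j hj).2]
    ring

theorem cases_cell (K : KernelData) (m : ℕ) (z : ℂ) :
    (∃ i ∈ Finset.Icc 1 m, z ∈ K.set1 i) ∨ (∃ i ∈ Finset.Icc 1 m, z ∈ K.set2 i) ∨
      ∀ j ∈ Finset.Icc 1 m, z ∉ K.set1 j ∧ z ∉ K.set2 j := by
  by_cases h1 : ∃ i ∈ Finset.Icc 1 m, z ∈ K.set1 i
  · exact Or.inl h1
  by_cases h2 : ∃ i ∈ Finset.Icc 1 m, z ∈ K.set2 i
  · exact Or.inr (Or.inl h2)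
  · push Not at h1 h2
    exact Or.inr (Or.inr fun j hj => ⟨h1 j hj, h2 j hj⟩)

variable (K)

theorem family_F (z : ℂ) (n : Fin (m + 1)) : (K.family m).F z n =
    K.glue m (fun i => if n = idx m (oddOf i) then K.A i z else 0)
      (fun i => if n = idx m (evenOf i) then K.A i z else 0) z := by
  refine (assemble_eq (fun j => K.A j z * chi (K.set1 j) z) (fun j => K.A j z * chi (K.set2 j) z)
    n).trans (Finset.sum_congr rfl fun i _ => ?_)
  simp only [mul_ite, zero_mul, mul_comm]

theorem family_G (z : ℂ) (n : Fin (m + 1)) : (K.family m).G z n =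
    K.glue m (fun i => if n = idx m (evenOf i) then K.B i z else 0)
      (fun i => if n = idx m (oddOf i) then K.B i z else 0) z := by
  refine (assemble_eq (fun j => K.B j z * chi (K.set2 j) z) (fun j => K.B j z * chi (K.set1 j) z)
    n).trans (Finset.sum_congr rfl fun i _ => ?_)
  simp only [mul_ite, zero_mul, mul_comm, add_comm]

theorem family_c (z : ℂ) : (K.family m).c p z =
    K.glue m (fun i => Complex.exp (-(p.expo (i - 1) z + p.expo i z) / 2))
      (fun i => Complex.exp (-(p.expo (i - 1) z + p.expo i z) / 2)) z :=
  show ∑ _ ∈ Finset.Icc 1 m, _ = _ from Finset.sum_congr rfl fun _ _ => add_mul _ _ _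

/-- The exponent of `halfExp`. -/
noncomputable def halfExpo (z : ℂ) : ℂ :=
  K.glue m (fun i => (p.expo (oddOf i) z - p.expo (evenOf i) z) / 2)
    (fun i => (p.expo (evenOf i) z - p.expo (oddOf i) z) / 2) z

/-- The common exponential factor of `f` and `g`. -/
noncomputable def halfExp (z : ℂ) : ℂ := Complex.exp (K.halfExpo p z)

variable {K p}

theorem diagDelta_idx {k : ℕ} (hk : k ≤ m) (z : ℂ) :
    p.diagDelta z (idx m k) = Complex.exp (p.expo k z) := by
  rw [CubicParams.diagDelta, CubicParams.expFun, idx]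
  split_ifs with h
  · rw [show k - 1 + 1 = k by omega]
  · have h0 : k = 0 := by omega
    simp [CubicParams.expo, h0]

theorem expo_odd_add_even (i : ℕ) (z : ℂ) :
    p.expo (i - 1) z + p.expo i z = p.expo (oddOf i) z + p.expo (evenOf i) z := by
  rw [oddOf, evenOf]
  split_ifs <;> ring

/-- On `Ω_{1,i}` let k be the odd and l the even member of {i-1, i}. There c = (m_k m_l)^(-1/2), `F`
lives in component k and `G` in component l, so c m_k and 1/(c m_l) are both equal to
(m_k/m_l)^(1/2). On `Ω_{2,i}` the roles of k and l are exchanged. Hence f and g share one scalar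
factor. -/
theorem HasCells.f_eq (hK : K.HasCells m) (z : ℂ) (n : Fin (m + 1)) :
    (K.family m).f p z n = K.halfExp p z * (K.family m).F z n := by
  rw [CubicFamily.f, family_c, family_F, halfExp, halfExpo]
  rcases K.cases_cell m z with ⟨i, hi, hz⟩ | ⟨i, hi, hz⟩ | hz
  · simp only [hK.glue1 hi hz]
    split_ifs with h
    · rw [h, diagDelta_idx (oddOf_le hi), ← Complex.exp_add, expo_odd_add_even i]
      congr 2
      ring
    · ring
  · simp only [hK.glue2 hi hz]
    split_ifs with h
    · rw [h, diagDelta_idx (evenOf_le hi), ← Complex.exp_add, expo_odd_add_even i]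
      congr 2
      ring
    · ring
  · simp only [glue0 hz]
    ring

theorem HasCells.g_eq (hK : K.HasCells m) (z : ℂ) (n : Fin (m + 1)) :
    (K.family m).g p z n = K.halfExp p z * (K.family m).G z n := by
  rw [CubicFamily.g, family_c, family_G, halfExp, halfExpo]
  rcases K.cases_cell m z with ⟨i, hi, hz⟩ | ⟨i, hi, hz⟩ | hz
  · simp only [hK.glue1 hi hz]
    split_ifs with h
    · rw [h, diagDelta_idx (evenOf_le hi), ← Complex.exp_neg, ← Complex.exp_neg,
        ← Complex.exp_add, expo_odd_add_even i]
      congr 2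
      ring
    · ring
  · simp only [hK.glue2 hi hz]
    split_ifs with h
    · rw [h, diagDelta_idx (oddOf_le hi), ← Complex.exp_neg, ← Complex.exp_neg,
        ← Complex.exp_add, expo_odd_add_even i]
      congr 2
      ring
    · ring
  · simp only [glue0 hz]
    ring

theorem HasCells.orthogonal (hK : K.HasCells m) (z : ℂ) (n : Fin (m + 1)) :
    (K.family m).F z n * (K.family m).G z n = 0 := by
  rw [family_F, family_G]
  rcases K.cases_cell m z with ⟨i, hi, hz⟩ | ⟨i, hi, hz⟩ | hz
  · simp only [hK.glue1 hi hz]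
    split_ifs with h h'
    · exact absurd (h.symm.trans h') (idx_odd_ne_even hi hi)
    all_goals simp
  · simp only [hK.glue2 hi hz]
    split_ifs with h h'
    · exact absurd (h'.symm.trans h) (idx_odd_ne_even hi hi)
    all_goals simp
  · simp only [glue0 hz]
    ring

theorem HasCells.c_ne_zero (hK : K.HasCells m) {z : ℂ} (hz : z ∈ K.Ω.carrier) :
    (K.family m).c p z ≠ 0 := by
  rw [family_c]
  have := hK.cover hz
  simp only [Set.mem_iUnion, Set.mem_union] at this
  obtain ⟨i, hi, h | h⟩ := this
  · rw [hK.glue1 hi h]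
    exact Complex.exp_ne_zero _
  · rw [hK.glue2 hi h]
    exact Complex.exp_ne_zero _

variable (K)

/-- The part of `F(u)ᵀ G(v)` on `Ω₁ × Ω₂`. -/
noncomputable def pairing12 (m : ℕ) (u v : ℂ) : ℂ :=
  ∑ i ∈ Finset.Icc 1 m, ∑ j ∈ Finset.Icc 1 m, chi (K.set1 i) u * chi (K.set2 j) v *
    (if oddOf i = oddOf j then K.A i u * K.B j v else 0)

/-- The part of `F(u)ᵀ G(v)` on `Ω₂ × Ω₁`. -/
noncomputable def pairing21 (m : ℕ) (u v : ℂ) : ℂ :=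
  ∑ i ∈ Finset.Icc 1 m, ∑ j ∈ Finset.Icc 1 m, chi (K.set2 i) u * chi (K.set1 j) v *
    (if evenOf i = evenOf j then K.A i u * K.B j v else 0)

theorem sum_F_mul_G (u v : ℂ) : ∑ n, (K.family m).F u n * (K.family m).G v n =
    K.pairing12 m u v + K.pairing21 m u v := by
  simp only [family_F, family_G, glue, Finset.sum_mul_sum]
  rw [Finset.sum_comm, pairing12, pairing21, ← Finset.sum_add_distrib]
  refine Finset.sum_congr rfl fun i hi => ?_
  rw [Finset.sum_comm, ← Finset.sum_add_distrib]
  refine Finset.sum_congr rfl fun j hj => ?_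
  have key : ∀ (k l : Fin (m + 1)) (x y : ℂ), ∑ n, (if n = k then x else 0) *
      (if n = l then y else 0) = if k = l then x * y else 0 := fun k l x y => by
    simp only [ite_mul, zero_mul]
    simp
  calc _ = ∑ n, (chi (K.set1 i) u * chi (K.set1 j) v *
          ((if n = idx m (oddOf i) then K.A i u else 0) *
            (if n = idx m (evenOf j) then K.B j v else 0)) +
        chi (K.set1 i) u * chi (K.set2 j) v *
          ((if n = idx m (oddOf i) then K.A i u else 0) *
            (if n = idx m (oddOf j) then K.B j v else 0)) +
        chi (K.set2 i) u * chi (K.set1 j) v *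
          ((if n = idx m (evenOf i) then K.A i u else 0) *
            (if n = idx m (evenOf j) then K.B j v else 0)) +
        chi (K.set2 i) u * chi (K.set2 j) v *
          ((if n = idx m (evenOf i) then K.A i u else 0) *
            (if n = idx m (oddOf j) then K.B j v else 0))) :=
        Finset.sum_congr rfl fun n _ => by ring
    _ = _ := by
      simp only [Finset.sum_add_distrib, ← Finset.mul_sum, key]
      rw [if_neg (idx_odd_ne_even hi hj), if_neg (idx_odd_ne_even hj hi).symm]
      simp only [idx_inj (oddOf_le hi) (oddOf_le hj), idx_inj (evenOf_le hi) (evenOf_le hj)]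
      ring

variable {K}

theorem HasCells.kernel_eq (hK : K.HasCells m) (u v : ℂ) : (K.family m).kernel p u v =
    K.halfExp p u * K.halfExp p v * (K.pairing12 m u v + K.pairing21 m u v) / (u - v) := by
  rw [← sum_F_mul_G, CubicFamily.kernel]
  split_ifs with h
  -- Division by zero gives 0, which agrees with the convention for the kernel on the diagonal.
  · rw [h, sub_self, div_zero]
  · rw [Finset.mul_sum]
    congr 1
    refine Finset.sum_congr rfl fun n _ => ?_
    rw [hK.f_eq, hK.g_eq]
    ring

theorem ratio_eq {i : ℕ} (z : ℂ) :
    p.ratio i z = Complex.exp (p.expo (oddOf i) z - p.expo (evenOf i) z) := by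
  rw [CubicParams.ratio, oddOf, evenOf]
  split_ifs <;> rw [CubicParams.expFun, CubicParams.expFun, ← Complex.exp_sub]

theorem HasCells.halfExp_sq1 (hK : K.HasCells m) {i : ℕ} (hi : i ∈ Finset.Icc 1 m) (u : ℂ) :
    chi (K.set1 i) u * p.ratio i u = chi (K.set1 i) u * K.halfExp p u ^ 2 := by
  by_cases hu : u ∈ K.set1 i
  · rw [ratio_eq, halfExp, halfExpo, hK.glue1 hi hu, ← Complex.exp_nat_mul]
    congr 2
    push_cast
    ring
  · rw [chi_of_notMem hu]
    ring

theorem HasCells.halfExp_sq2 (hK : K.HasCells m) {i : ℕ} (hi : i ∈ Finset.Icc 1 m) (u : ℂ) :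
    chi (K.set2 i) u * (p.ratio i u)⁻¹ = chi (K.set2 i) u * K.halfExp p u ^ 2 := by
  by_cases hu : u ∈ K.set2 i
  · rw [ratio_eq, halfExp, halfExpo, hK.glue2 hi hu, ← Complex.exp_nat_mul, ← Complex.exp_neg]
    congr 2
    push_cast
    ring
  · rw [chi_of_notMem hu]
    ring

/-- The kernel of K̂₁ carries `halfExp` squared at u, while `H` carries one factor at u and one at
v. The two therefore differ by conjugation with `halfExp`. -/
theorem HasCells.kernel1_eq (hK : K.HasCells m) (u v : ℂ) : K.kernel1 m p u v =
    K.halfExp p u ^ 2 * K.pairing12 m u v / (u - v) := by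
  rw [kernel1, pairing12, Finset.mul_sum, Finset.sum_div]
  refine Finset.sum_congr rfl fun i hi => ?_
  rw [Finset.mul_sum, Finset.sum_div]
  refine Finset.sum_congr rfl fun j hj => ?_
  rw [Finset.mem_Icc] at hi hj
  -- The pairs selected by the Kronecker symbols are those with equal odd members: an odd i goes
  -- with i and i + 1, an even i with i and i - 1. For K̂₂ the even members play this part.
  have hc : ((if j = i then 1 else 0) + (if (j : ℤ) + (-1) ^ i = i then 1 else 0) : ℂ) =
      if oddOf i = oddOf j then 1 else 0 := by
    rw [oddOf, oddOf]
    simp only [Nat.odd_iff]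
    rcases Nat.even_or_odd i with h | h
    · rw [h.neg_one_pow]
      rw [Nat.even_iff] at h
      split_ifs <;> first | (exfalso; omega) | norm_num
    · rw [h.neg_one_pow]
      rw [Nat.odd_iff] at h
      split_ifs <;> first | (exfalso; omega) | norm_num
  have hs := hK.halfExp_sq1 (p := p) (Finset.mem_Icc.2 hi) u
  rw [hc]
  split_ifs with h
  · linear_combination (chi (K.set2 j) v * K.A i u * K.B j v / (u - v)) * hs
  · ring

theorem HasCells.kernel2_eq (hK : K.HasCells m) (u v : ℂ) : K.kernel2 m p u v =
    K.halfExp p u ^ 2 * K.pairing21 m u v / (u - v) := by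
  rw [kernel2, pairing21, Finset.mul_sum, Finset.sum_div]
  refine Finset.sum_congr rfl fun i hi => ?_
  rw [Finset.mul_sum, Finset.sum_div]
  refine Finset.sum_congr rfl fun j hj => ?_
  rw [Finset.mem_Icc] at hi hj
  have hc : ((if j = i then 1 else 0) + (if (j : ℤ) - (-1) ^ i = i then 1 else 0) : ℂ) =
      if evenOf i = evenOf j then 1 else 0 := by
    rw [evenOf, evenOf]
    simp only [Nat.odd_iff]
    rcases Nat.even_or_odd i with h | h
    · rw [h.neg_one_pow]
      rw [Nat.even_iff] at h
      split_ifs <;> first | (exfalso; omega) | norm_num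
    · rw [h.neg_one_pow]
      rw [Nat.odd_iff] at h
      split_ifs <;> first | (exfalso; omega) | norm_num
  have hs := hK.halfExp_sq2 (p := p) (Finset.mem_Icc.2 hi) u
  rw [hc]
  split_ifs with h
  · linear_combination (chi (K.set1 j) v * K.A i u * K.B j v / (u - v)) * hs
  · ring

end KernelData

theorem CubicFamily.operator_eq {m : ℕ} (D : CubicFamily m) [SigmaFinite D.Ω.absMeasure] {p : CubicParams m}
    {T : D.Ω.L2 →L[ℂ] D.Ω.L2} (hT : D.Ω.IsIntegralOperator (D.kernel p) T) :
    D.operator p = T := by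
  have h : ∃ T, D.Ω.IsIntegralOperator (D.kernel p) T := ⟨T, hT⟩
  rw [CubicFamily.operator, dif_pos h]
  exact h.choose_spec.unique hT

namespace KernelData

variable {m : ℕ} {K : KernelData} {p : CubicParams m} {J : Type} [Countable J] {φ ψ : J → ℂ → ℂ}

/-- The determinant `det(1 - K̂₁ K̂₂)` is well defined and equal to the Fredholm determinant of the
associated integrable operator, if the kernel of the latter is given by square summable families. -/
theorem HasCells.fredholm (hK : K.HasCells m) [SigmaFinite K.Ω.absMeasure]
    (hΩ : K.Ω.PhaseRegular) (hφ : SqFamily K.Ω.absMeasure φ) (hψ : SqFamily K.Ω.absMeasure ψ)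
    (hH : ∀ u v, (K.family m).kernel p u v = ∑' n, φ n u * ψ n v) :
    K.WellDefined m p ∧ (∃ T, (K.family m).Ω.IsIntegralOperator ((K.family m).kernel p) T) ∧
      IsTraceClass ((K.family m).operator p) ∧
      HasFredholmDet ((K.family m).operator p) (K.det m p) := by
  set W₁ : Set ℂ := ⋃ j ∈ Finset.Icc 1 m, K.set1 j with hW₁
  set W₂ : Set ℂ := ⋃ j ∈ Finset.Icc 1 m, K.set2 j with hW₂
  have hm1 : MeasurableSet W₁ := Finset.measurableSet_biUnion _ hK.meas1
  have hm2 : MeasurableSet W₂ := Finset.measurableSet_biUnion _ hK.meas2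
  have hd : Disjoint W₁ W₂ := by
    simp only [hW₁, hW₂, Set.disjoint_iUnion_left, Set.disjoint_iUnion_right]
    exact fun i hi j hj => hK.disj12 j hj i hi
  have c11 : ∀ i ∈ Finset.Icc 1 m, ∀ u, chi W₁ u * chi (K.set1 i) u = chi (K.set1 i) u := by
    intro i hi u
    by_cases h : u ∈ K.set1 i
    · have hu : u ∈ W₁ := Set.mem_iUnion₂.2 ⟨i, hi, h⟩
      rw [chi_of_mem hu, one_mul]
    · rw [chi_of_notMem h, mul_zero]
  have c22 : ∀ i ∈ Finset.Icc 1 m, ∀ u, chi W₂ u * chi (K.set2 i) u = chi (K.set2 i) u := by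
    intro i hi u
    by_cases h : u ∈ K.set2 i
    · have hu : u ∈ W₂ := Set.mem_iUnion₂.2 ⟨i, hi, h⟩
      rw [chi_of_mem hu, one_mul]
    · rw [chi_of_notMem h, mul_zero]
  have c12 : ∀ i ∈ Finset.Icc 1 m, ∀ u, chi W₁ u * chi (K.set2 i) u = 0 := fun i hi u => by
    rw [← c22 i hi, ← mul_assoc, chi_mul_chi_of_disjoint hd, zero_mul]
  have c21 : ∀ i ∈ Finset.Icc 1 m, ∀ u, chi W₂ u * chi (K.set1 i) u = 0 := fun i hi u => by
    rw [← c11 i hi, ← mul_assoc, chi_mul_chi_of_disjoint hd.symm, zero_mul]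
  have p1 : ∀ u v, chi W₁ u * K.pairing12 m u v * chi W₂ v = K.pairing12 m u v := fun u v => by
    simp only [pairing12, Finset.mul_sum, Finset.sum_mul]
    refine Finset.sum_congr rfl fun i hi => Finset.sum_congr rfl fun j hj => ?_
    conv_rhs => rw [← c11 i hi u, ← c22 j hj v]
    ring
  have p2 : ∀ u v, chi W₂ u * K.pairing21 m u v * chi W₁ v = K.pairing21 m u v := fun u v => by
    simp only [pairing21, Finset.mul_sum, Finset.sum_mul]
    refine Finset.sum_congr rfl fun i hi => Finset.sum_congr rfl fun j hj => ?_
    conv_rhs => rw [← c22 i hi u, ← c11 j hj v]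
    ring
  have q1 : ∀ u v, chi W₂ u * K.pairing12 m u v = 0 := fun u v => by
    simp only [pairing12, Finset.mul_sum]
    refine Finset.sum_eq_zero fun i hi => Finset.sum_eq_zero fun j hj => ?_
    rw [← mul_assoc, ← mul_assoc, c21 i hi u]
    ring
  have q2 : ∀ u v, chi W₁ u * K.pairing21 m u v = 0 := fun u v => by
    simp only [pairing21, Finset.mul_sum]
    refine Finset.sum_eq_zero fun i hi => Finset.sum_eq_zero fun j hj => ?_
    rw [← mul_assoc, ← mul_assoc, c12 i hi u]
    ring
  have hh : ∀ z, K.halfExp p z ≠ 0 := fun z => Complex.exp_ne_zero _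
  have e1 : ∀ u v, chi W₁ u * (K.family m).kernel p u v * chi W₂ v =
      K.halfExp p u * K.halfExp p v * K.pairing12 m u v / (u - v) := fun u v => by
    rw [hK.kernel_eq]
    linear_combination (K.halfExp p u * K.halfExp p v / (u - v)) * p1 u v +
      (K.halfExp p u * K.halfExp p v / (u - v) * chi W₂ v) * q2 u v
  have e2 : ∀ u v, chi W₂ u * (K.family m).kernel p u v * chi W₁ v =
      K.halfExp p u * K.halfExp p v * K.pairing21 m u v / (u - v) := fun u v => by
    rw [hK.kernel_eq]
    linear_combination (K.halfExp p u * K.halfExp p v / (u - v)) * p2 u v +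
      (K.halfExp p u * K.halfExp p v / (u - v) * chi W₁ v) * q1 u v
  -- Here `halfExp` serves as the conjugating function of `block_fredholm`; it never vanishes, being
  -- an exponential, even off Ω.
  obtain ⟨h1, h2, T, hT, hTt, hTd⟩ := block_fredholm hΩ hφ hψ hH hm1 hm2 hd
    (fun u v => by rw [e1, e2, hK.kernel_eq]; ring) hh
    (K₁ := K.kernel1 m p) (K₂ := K.kernel2 m p)
    (fun u v => by
      rw [e1, hK.kernel1_eq]
      have := hh v
      field_simp)
    (fun u v => by
      rw [e2, hK.kernel2_eq]
      have := hh v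
      field_simp)
  have : SigmaFinite (K.family m).Ω.absMeasure := ‹SigmaFinite K.Ω.absMeasure›
  have hop : (K.family m).operator p = T := (K.family m).operator_eq hT
  refine ⟨⟨fun u _ u' _ => h1 u u', h2⟩, ⟨T, hT⟩, ?_, ?_⟩
  · rw [hop]
    exact hTt
  · rw [hop]
    exact hTd

end KernelData

end KPZ

/-! ### Expansion of Cauchy kernels between separated sets. -/

namespace KPZ

section Cauchy

/-- The cell of the square grid of mesh `r / 2` that contains `u`. -/
noncomputable def gridCell (r : ℝ) (u : ℂ) : ℤ × ℤ := (⌊2 * u.re / r⌋, ⌊2 * u.im / r⌋)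

/-- The corner of a cell. -/
noncomputable def gridCorner (r : ℝ) (k : ℤ × ℤ) : ℂ := ⟨k.1 * (r / 2), k.2 * (r / 2)⟩

/-- The weight multiplies the left family and divides the right one. Its inverse square is summable
over the grid, which compensates for the right functions not being localised in cells. -/
noncomputable def gridWeight (k : ℤ × ℤ) : ℝ := (1 + (k.1 : ℝ) ^ 2) * (1 + (k.2 : ℝ) ^ 2)

open Classical in
/-- The left family in the expansion of a Cauchy kernel. -/
noncomputable def cauchyLeft (r : ℝ) (f : ℂ → ℂ) (n : (ℤ × ℤ) × ℕ) (u : ℂ) : ℂ :=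
  if gridCell r u = n.1 then
    (gridWeight n.1 : ℂ) * f u * ((gridCorner r n.1 - u) / (2 * r)) ^ n.2 else 0

open Classical in
/-- The right family in the expansion of a Cauchy kernel. -/
noncomputable def cauchyRight (r : ℝ) (g : ℂ → ℂ) (n : (ℤ × ℤ) × ℕ) (v : ℂ) : ℂ :=
  if 4 * r ≤ ‖gridCorner r n.1 - v‖ then
    (gridWeight n.1 : ℂ)⁻¹ * g v * (2 * r / (gridCorner r n.1 - v)) ^ n.2 /
      (gridCorner r n.1 - v) else 0

theorem gridWeight_pos (k : ℤ × ℤ) : 0 < gridWeight k := by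
  unfold gridWeight
  positivity

theorem measurable_gridCell (r : ℝ) : Measurable (gridCell r) :=
  (Int.measurable_floor.comp ((Complex.measurable_re.const_mul 2).div_const r)).prodMk
    (Int.measurable_floor.comp ((Complex.measurable_im.const_mul 2).div_const r))

theorem norm_gridCorner_sub_le {r : ℝ} (hr : 0 < r) (u : ℂ) :
    ‖gridCorner r (gridCell r u) - u‖ ≤ r := by
  have key : ∀ x : ℝ, |(⌊2 * x / r⌋ : ℝ) * (r / 2) - x| ≤ r / 2 := fun x => by
    have h1 := Int.floor_le (2 * x / r)
    have h2 := (Int.lt_floor_add_one (2 * x / r)).le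
    have h3 : 2 * x / r * (r / 2) = x := by field_simp
    have h4 := mul_le_mul_of_nonneg_right h1 (half_pos hr).le
    have h5 := mul_le_mul_of_nonneg_right h2 (half_pos hr).le
    rw [abs_le]
    constructor <;> nlinarith
  refine (Complex.norm_le_abs_re_add_abs_im _).trans ?_
  have h1 := key u.re
  have h2 := key u.im
  simp only [gridCorner, gridCell, Complex.sub_re, Complex.sub_im]
  linarith

/-- The weight of the cell of u grows like the fourth power of ‖u‖; this is why the factor (1 +
‖u‖)⁴ accompanies f below. -/
theorem gridWeight_le {r : ℝ} (hr : 0 < r) (u : ℂ) :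
    gridWeight (gridCell r u) ≤ (2 + 2 / r) ^ 4 * (1 + ‖u‖) ^ 4 := by
  have key : ∀ x : ℝ, |x| ≤ ‖u‖ → 1 + (⌊2 * x / r⌋ : ℝ) ^ 2 ≤ ((2 + 2 / r) * (1 + ‖u‖)) ^ 2 := by
    intro x hx
    have h1 := Int.floor_le (2 * x / r)
    have h2 := (Int.lt_floor_add_one (2 * x / r)).le
    have h6 : |2 * x / r| ≤ 2 / r * ‖u‖ := by
      rw [abs_div, abs_mul, abs_two, abs_of_pos hr, mul_div_right_comm]
      exact mul_le_mul_of_nonneg_left hx (by positivity)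
    rw [abs_le] at h6
    have h3 : |(⌊2 * x / r⌋ : ℝ)| ≤ 2 / r * ‖u‖ + 1 := by
      rw [abs_le]
      constructor <;> linarith
    have h4 : (⌊2 * x / r⌋ : ℝ) ^ 2 ≤ (2 / r * ‖u‖ + 1) ^ 2 := by
      rw [← sq_abs]
      exact pow_le_pow_left₀ (abs_nonneg _) h3 2
    have h5 : 0 ≤ 2 / r := by positivity
    nlinarith [norm_nonneg u, mul_nonneg h5 (norm_nonneg u)]
  calc gridWeight (gridCell r u) ≤ ((2 + 2 / r) * (1 + ‖u‖)) ^ 2 * ((2 + 2 / r) * (1 + ‖u‖)) ^ 2 :=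
        mul_le_mul (key _ (Complex.abs_re_le_norm u)) (key _ (Complex.abs_im_le_norm u))
          (by positivity) (by positivity)
    _ = _ := by ring

theorem summable_gridWeight_inv_sq : Summable fun k : ℤ × ℤ => (gridWeight k)⁻¹ ^ 2 := by
  have h1 : Summable fun k : ℤ => (1 + (k : ℝ) ^ 2)⁻¹ ^ 2 := by
    refine Summable.of_norm_bounded_eventually
      ((Real.summable_one_div_int_pow (p := 2)).2 (by norm_num)) ?_
    filter_upwards [(Set.finite_singleton (0 : ℤ)).compl_mem_cofinite] with k hk
    have hk0 : (k : ℝ) ≠ 0 := by exact_mod_cast hk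
    have hk2 : 0 < (k : ℝ) ^ 2 := by positivity
    rw [Real.norm_of_nonneg (by positivity), one_div]
    have h3 : (1 + (k : ℝ) ^ 2)⁻¹ ≤ ((k : ℝ) ^ 2)⁻¹ := inv_anti₀ hk2 (by linarith)
    have h4 : (1 + (k : ℝ) ^ 2)⁻¹ ≤ 1 := inv_le_one_of_one_le₀ (by linarith)
    have h5 : 0 ≤ (1 + (k : ℝ) ^ 2)⁻¹ := by positivity
    nlinarith
  refine (h1.mul_of_nonneg h1 (fun _ => sq_nonneg _) fun _ => sq_nonneg _).congr fun k => ?_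
  rw [gridWeight, mul_inv, mul_pow]

variable {μ : Measure ℂ} {f g : ℂ → ℂ} {r : ℝ}

/-- The scale 2r is a compromise: on its cell u is within r of the corner, and v is at distance at
least 4r, so the geometric ratios in the left and in the right family are both at most 1/2. -/
theorem norm_cauchyLeft_le (hr : 0 < r) (n : (ℤ × ℤ) × ℕ) (u : ℂ) : ‖cauchyLeft r f n u‖ ≤
    (gridCell r ⁻¹' {n.1}).indicator (fun u => (2 + 2 / r) ^ 4 * ‖((1 + ‖u‖ : ℝ) : ℂ) ^ 4 * f u‖) u *
      (1 / 2) ^ n.2 := by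
  rw [cauchyLeft]
  split_ifs with h
  · rw [Set.indicator_of_mem (by exact h)]
    have h1 := norm_gridCorner_sub_le hr u
    have h2 := gridWeight_le hr u
    rw [h] at h1 h2
    have h3 : ‖(gridCorner r n.1 - u) / (2 * r)‖ ≤ 1 / 2 := by
      rw [norm_div, norm_mul, Complex.norm_ofNat, Complex.norm_real, Real.norm_of_nonneg hr.le,
        div_le_div_iff₀ (by positivity) two_pos]
      linarith
    rw [norm_mul, norm_mul, norm_pow, Complex.norm_real, Real.norm_of_nonneg (gridWeight_pos _).le]
    refine mul_le_mul ?_ (pow_le_pow_left₀ (norm_nonneg _) h3 _) (by positivity) (by positivity)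
    rw [norm_mul, norm_pow, Complex.norm_real, Real.norm_of_nonneg (by positivity), ← mul_assoc]
    exact mul_le_mul_of_nonneg_right h2 (norm_nonneg _)
  · rw [norm_zero]
    refine mul_nonneg (Set.indicator_nonneg (fun _ _ => ?_) _) (by positivity)
    positivity

theorem norm_cauchyRight_le (hr : 0 < r) (n : (ℤ × ℤ) × ℕ) (v : ℂ) : ‖cauchyRight r g n v‖ ≤
    ((gridWeight n.1)⁻¹ * (1 / 2) ^ n.2) * (‖g v‖ / (4 * r)) := by
  rw [cauchyRight]
  have hw := gridWeight_pos n.1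
  split_ifs with h
  · have h3 : ‖2 * (r : ℂ) / (gridCorner r n.1 - v)‖ ≤ 1 / 2 := by
      rw [norm_div, norm_mul, Complex.norm_ofNat, Complex.norm_real, Real.norm_of_nonneg hr.le,
        div_le_div_iff₀ (by linarith) two_pos]
      linarith
    rw [norm_div, norm_mul, norm_mul, norm_pow, norm_inv, Complex.norm_real,
      Real.norm_of_nonneg hw.le]
    calc _ ≤ (gridWeight n.1)⁻¹ * ‖g v‖ * (1 / 2) ^ n.2 / (4 * r) := by gcongr
      _ = _ := by ring
  · rw [norm_zero]
    positivity

theorem summable_prod_half {κ : Type*} {a : κ → ℝ} (ha : Summable a) (h0 : ∀ k, 0 ≤ a k) :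
    Summable fun n : κ × ℕ => a n.1 * ((1 / 2 : ℝ) ^ n.2) ^ 2 := by
  have h : Summable fun n : ℕ => ((1 / 2 : ℝ) ^ n) ^ 2 := by
    refine (summable_geometric_of_lt_one (r := 1 / 4) (by norm_num) (by norm_num)).congr fun n => ?_
    rw [← pow_mul, mul_comm, pow_mul]
    norm_num
  exact ha.mul_of_nonneg h h0 fun _ => sq_nonneg _

/-- The cells are disjoint. So the squared L² norms over all cells add up to a single integral, and
at a given point only one cell contributes. -/
theorem sqFamily_cauchyLeft (hr : 0 < r) (hfm : AEStronglyMeasurable f μ)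
    (hf : MemLp (fun u => ((1 + ‖u‖ : ℝ) : ℂ) ^ 4 * f u) 2 μ) : SqFamily μ (cauchyLeft r f) := by
  have hmeas : ∀ k, MeasurableSet (gridCell r ⁻¹' {k}) := fun k =>
    measurable_gridCell r (measurableSet_singleton k)
  set F : ℂ → ℝ := fun u => (2 + 2 / r) ^ 4 * ‖((1 + ‖u‖ : ℝ) : ℂ) ^ 4 * f u‖ with hF
  have hFL : MemLp F 2 μ := hf.norm.const_mul _
  have hF2 : Integrable (fun u => F u ^ 2) μ := hFL.integrable_sq
  have hF0 : ∀ u, 0 ≤ F u := fun u => by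
    simp only [hF]
    positivity
  have hind : ∀ k u, ((gridCell r ⁻¹' {k}).indicator F u) ^ 2 =
      (gridCell r ⁻¹' {k}).indicator (fun u => F u ^ 2) u := fun k u => by
    by_cases h : u ∈ gridCell r ⁻¹' {k} <;> simp [h]
  have hle : ∀ n u, ‖cauchyLeft r f n u‖ ^ 2 ≤
      (gridCell r ⁻¹' {n.1}).indicator (fun u => F u ^ 2) u * ((1 / 2 : ℝ) ^ n.2) ^ 2 := fun n u => by
    rw [← hind, ← mul_pow]
    exact pow_le_pow_left₀ (norm_nonneg _) (norm_cauchyLeft_le hr n u) 2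
  have hms : ∀ n, AEStronglyMeasurable (cauchyLeft r f n) μ := fun n => by
    have h1 : cauchyLeft r f n = (gridCell r ⁻¹' {n.1}).indicator fun u => (gridWeight n.1 : ℂ) *
        f u * ((gridCorner r n.1 - u) / (2 * r)) ^ n.2 := by
      ext u
      by_cases h : gridCell r u = n.1
      · rw [Set.indicator_of_mem (by exact h), cauchyLeft, if_pos h]
      · rw [Set.indicator_of_notMem (by exact h), cauchyLeft, if_neg h]
    rw [h1]
    refine AEStronglyMeasurable.indicator ((hfm.const_mul _).mul ?_) (hmeas _)
    exact (by fun_prop : Continuous fun u : ℂ =>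
      ((gridCorner r n.1 - u) / (2 * r)) ^ n.2).aestronglyMeasurable
  refine ⟨fun n => ?_, ?_, fun u => ?_⟩
  · refine (hFL.norm).of_le (hms n) (ae_of_all _ fun u => (norm_cauchyLeft_le hr n u).trans ?_)
    rw [Real.norm_of_nonneg (norm_nonneg _), Real.norm_of_nonneg (hF0 u)]
    refine (mul_le_of_le_one_right (Set.indicator_nonneg (fun u _ => hF0 u) _)
      (pow_le_one₀ (by norm_num) (by norm_num))).trans ?_
    exact Set.indicator_le_self' (fun u _ => hF0 u) u
  · have hsum := (hasSum_integral_iUnion (f := fun u => F u ^ 2) (μ := μ) hmeas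
      (fun i j hij => Set.disjoint_left.2 fun u hu hu' => hij (hu.symm.trans hu'))
      hF2.integrableOn).summable
    refine Summable.of_nonneg_of_le (fun _ => sq_nonneg _) (fun n => ?_)
      (summable_prod_half hsum fun k => integral_nonneg fun _ => sq_nonneg _)
    rw [l2norm_sq, ← integral_indicator (hmeas _), ← integral_mul_const]
    exact integral_mono_of_nonneg (ae_of_all _ fun _ => sq_nonneg _)
      ((hF2.indicator (hmeas _)).mul_const _) (ae_of_all _ fun u => hle n u)
  · refine Summable.of_nonneg_of_le (fun _ => sq_nonneg _) (fun n => hle n u)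
      (summable_prod_half (a := fun k => (gridCell r ⁻¹' {k}).indicator (fun u => F u ^ 2) u) ?_
        fun k => Set.indicator_nonneg (fun _ _ => sq_nonneg _) _)
    refine summable_of_ne_finset_zero (s := {gridCell r u}) fun k hk => ?_
    rw [Finset.mem_singleton] at hk
    exact Set.indicator_of_notMem (fun h => hk h.symm) _

theorem sqFamily_cauchyRight (hr : 0 < r) (hg : MemLp g 2 μ) : SqFamily μ (cauchyRight r g) := by
  have hle := fun n v => norm_cauchyRight_le (g := g) hr n v
  have hle2 : ∀ n v, ‖cauchyRight r g n v‖ ^ 2 ≤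
      ((gridWeight n.1)⁻¹ ^ 2 * ((1 / 2 : ℝ) ^ n.2) ^ 2) * (‖g v‖ / (4 * r)) ^ 2 := fun n v => by
    rw [← mul_pow, ← mul_pow]
    exact pow_le_pow_left₀ (norm_nonneg _) (hle n v) 2
  have hms : ∀ n, AEStronglyMeasurable (cauchyRight r g n) μ := fun n => by
    have hS : MeasurableSet {v : ℂ | 4 * r ≤ ‖gridCorner r n.1 - v‖} :=
      measurableSet_le measurable_const (by fun_prop)
    have h1 : cauchyRight r g n = {v : ℂ | 4 * r ≤ ‖gridCorner r n.1 - v‖}.indicator fun v =>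
        (gridWeight n.1 : ℂ)⁻¹ * g v * ((2 * r / (gridCorner r n.1 - v)) ^ n.2 /
          (gridCorner r n.1 - v)) := by
      classical
      ext v
      rw [Set.indicator_apply, cauchyRight]
      simp only [Set.mem_ofPred_eq, mul_div_assoc]
    rw [h1]
    refine AEStronglyMeasurable.indicator ((hg.1.const_mul _).mul ?_) hS
    exact (by fun_prop : Measurable fun v : ℂ => (2 * (r : ℂ) / (gridCorner r n.1 - v)) ^ n.2 /
      (gridCorner r n.1 - v)).aestronglyMeasurable
  have hs := summable_prod_half summable_gridWeight_inv_sq fun _ => sq_nonneg _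
  have hgi : Integrable (fun v => (‖g v‖ / (4 * r)) ^ 2) μ := by
    simp_rw [div_pow]
    exact hg.integrable_normSq.div_const _
  refine ⟨fun n => ?_, ?_, fun v => ?_⟩
  · refine ((hg.norm.mul_const (4 * r)⁻¹).const_mul ((gridWeight n.1)⁻¹ * (1 / 2) ^ n.2)).of_le
      (hms n) (ae_of_all _ fun v => (hle n v).trans (le_of_eq ?_))
    have := gridWeight_pos n.1
    rw [Real.norm_of_nonneg (by positivity), div_eq_mul_inv ‖g v‖]
  · refine Summable.of_nonneg_of_le (fun _ => sq_nonneg _) (fun n => ?_)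
      (hs.mul_right (∫ v, (‖g v‖ / (4 * r)) ^ 2 ∂μ))
    rw [l2norm_sq, ← integral_const_mul]
    exact integral_mono_of_nonneg (ae_of_all _ fun _ => sq_nonneg _) (hgi.const_mul _)
      (ae_of_all _ fun v => hle2 n v)
  · exact Summable.of_nonneg_of_le (fun _ => sq_nonneg _) (fun n => hle2 n v)
      (hs.mul_right _)

/-- With c the corner of the cell of u, one has u - v = (c - v) - (c - u), and 1/(u - v) is a
geometric series in (c - u)/(c - v). From ‖u - v‖ ≥ 5r and ‖c - u‖ ≤ r follows ‖c - v‖ ≥ 4r, so the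
ratio is less than 1 and the cut-off in `cauchyRight` is inactive. -/
theorem hasSum_cauchy (hr : 0 < r) (hsep : ∀ u v, f u ≠ 0 → g v ≠ 0 → 5 * r ≤ ‖u - v‖) (u v : ℂ) :
    ∑' n, cauchyLeft r f n u * cauchyRight r g n v = f u * g v / (u - v) := by
  classical
  set k := gridCell r u with hk
  have hinj : Function.Injective fun n : ℕ => (k, n) := fun a b h => (Prod.mk.inj h).2
  rw [← hinj.tsum_eq fun n hn => ?_]
  swap
  · have : cauchyLeft r f n u ≠ 0 := left_ne_zero_of_mul hn
    refine ⟨n.2, ?_⟩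
    by_contra h
    refine this (if_neg fun h' => h ?_)
    exact Prod.ext h' rfl
  -- Where f(u) g(v) vanishes nothing is known about ‖u - v‖, but then both sides are zero.
  by_cases hfg : f u * g v = 0
  · rw [hfg, zero_div]
    refine (tsum_congr fun n => ?_).trans tsum_zero
    rw [cauchyLeft, cauchyRight, if_pos rfl]
    split_ifs
    · linear_combination ((gridWeight k : ℂ) * ((gridCorner r k - u) / (2 * r)) ^ n *
        ((gridWeight k : ℂ)⁻¹ * (2 * r / (gridCorner r k - v)) ^ n / (gridCorner r k - v))) * hfg
    · rw [mul_zero]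
  · have h5 := hsep u v (left_ne_zero_of_mul hfg) (right_ne_zero_of_mul hfg)
    have h1 := norm_gridCorner_sub_le hr u
    have h4 : 4 * r ≤ ‖gridCorner r k - v‖ := by
      have := norm_sub_le_norm_sub_add_norm_sub u (gridCorner r k) v
      rw [norm_sub_rev u (gridCorner r k)] at this
      linarith
    have hv0 : gridCorner r k - v ≠ 0 := norm_pos_iff.1 (by linarith)
    have hq : ‖(gridCorner r k - u) / (gridCorner r k - v)‖ < 1 := by
      rw [norm_div, div_lt_one (by linarith)]
      linarith
    have hw : (gridWeight k : ℂ) ≠ 0 := Complex.ofReal_ne_zero.2 (gridWeight_pos k).ne'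
    have hr0 : (r : ℂ) ≠ 0 := Complex.ofReal_ne_zero.2 hr.ne'
    have huv : u - v ≠ 0 := norm_pos_iff.1 (by linarith)
    calc _ = ∑' n : ℕ, f u * g v / (gridCorner r k - v) *
          ((gridCorner r k - u) / (gridCorner r k - v)) ^ n := tsum_congr fun n => by
            rw [cauchyLeft, cauchyRight, if_pos rfl, if_pos h4, div_pow, div_pow, div_pow]
            field_simp
      _ = _ := by
        rw [tsum_mul_left, tsum_geometric_of_norm_lt_one hq]
        have : 1 - (gridCorner r k - u) / (gridCorner r k - v) =
            (u - v) / (gridCorner r k - v) := by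
          field_simp
          ring
        rw [this]
        field_simp

theorem SqFamily.finite_prod {N J : Type*} [Finite N] {φ : N → J → ℂ → ℂ}
    (h : ∀ i, SqFamily μ (φ i)) : SqFamily μ fun n : N × J => φ n.1 n.2 := by
  have key : ∀ a : N × J → ℝ, (∀ n, 0 ≤ a n) → (∀ i, Summable fun j => a (i, j)) → Summable a :=
    fun a h0 hs => (summable_prod_of_nonneg h0).2 ⟨hs, .of_finite⟩
  exact ⟨fun n => (h n.1).memLp n.2, key _ (fun _ => sq_nonneg _) fun i => (h i).summable_l2norm,
    fun x => key _ (fun _ => sq_nonneg _) fun i => (h i).summable_apply x⟩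

/-- A kernel `∑ᵢ fᵢ(u) gᵢ(v) / (u - v)` with separated supports is given by square summable
families. -/
theorem exists_sqFamily_cauchy [SigmaFinite μ] {N : Type} [Fintype N] {f g : N → ℂ → ℂ} (hr : 0 < r)
    (hfm : ∀ i, AEStronglyMeasurable (f i) μ)
    (hf : ∀ i, MemLp (fun u => ((1 + ‖u‖ : ℝ) : ℂ) ^ 4 * f i u) 2 μ) (hg : ∀ i, MemLp (g i) 2 μ)
    (hsep : ∀ i u v, f i u ≠ 0 → g i v ≠ 0 → 5 * r ≤ ‖u - v‖) :
    ∃ φ ψ : N × ((ℤ × ℤ) × ℕ) → ℂ → ℂ, SqFamily μ φ ∧ SqFamily μ ψ ∧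
      ∀ u v, (∑ i, f i u * g i v) / (u - v) = ∑' n, φ n u * ψ n v := by
  have h1 := SqFamily.finite_prod fun i => sqFamily_cauchyLeft hr (hfm i) (hf i)
  have h2 := SqFamily.finite_prod fun i => sqFamily_cauchyRight hr (hg i)
  refine ⟨_, _, h1, h2, fun u v => ?_⟩
  have h3 := (h1.summable_norm_mul h2 u v).of_norm.tsum_prod
  rw [Finset.sum_div, h3, tsum_fintype]
  exact Finset.sum_congr rfl fun i _ => (hasSum_cauchy hr (hsep i) u v).symm

end Cauchy

end KPZ

/-! ### Contours that are Lipschitz graphs over the imaginary axis. -/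

namespace KPZ

section Graphs

/-- The graph of `ψ` over the imaginary axis. -/
def graphCurve (ψ : ℝ → ℝ) (s : ℝ) : ℂ := ⟨ψ s, s⟩

/-- The union of the graphs of a family of functions. -/
def graphSet {Q : Type} (ψ : Q → ℝ → ℝ) : SpectralSet :=
  .contours fun q => ⟨Set.univ, graphCurve (ψ q)⟩

variable {ψ : ℝ → ℝ}

theorem graphCurve_injective : Function.Injective (graphCurve ψ) := fun _ _ h =>
  congrArg Complex.im h

theorem continuous_graphCurve (h : Continuous ψ) : Continuous (graphCurve ψ) := by
  have : graphCurve ψ = fun s => (ψ s : ℂ) + s * Complex.I := by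
    ext s
    exact Complex.ext (by simp [graphCurve]) (by simp [graphCurve])
  rw [this]
  fun_prop

theorem exists_lipschitzWith_graphCurve (h : ∃ κ, LipschitzWith κ ψ) :
    ∃ κ, LipschitzWith κ (graphCurve ψ) := by
  obtain ⟨κ, hκ⟩ := h
  refine ⟨κ + 1, LipschitzWith.of_dist_le_mul fun s t => ?_⟩
  rw [Complex.dist_eq]
  refine (Complex.norm_le_abs_re_add_abs_im _).trans ?_
  have h1 := hκ.dist_le_mul s t
  rw [Real.dist_eq, Real.dist_eq] at h1
  simp only [graphCurve, Complex.sub_re, Complex.sub_im, Real.dist_eq, NNReal.coe_add,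
    NNReal.coe_one]
  linarith

theorem abs_le_norm_graphCurve (s : ℝ) : |s| ≤ ‖graphCurve ψ s‖ :=
  Complex.abs_im_le_norm (graphCurve ψ s)

theorem exists_norm_graphCurve_le (h : ∃ κ, LipschitzWith κ ψ) :
    ∃ c : ℝ, 0 ≤ c ∧ ∀ s, 1 + ‖graphCurve ψ s‖ ≤ c * (1 + |s|) := by
  obtain ⟨κ, hκ⟩ := h
  refine ⟨2 + |ψ 0| + κ, by positivity, fun s => ?_⟩
  have h1 := hκ.dist_le_mul s 0
  rw [Real.dist_eq, Real.dist_eq, sub_zero] at h1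
  have h2 := Complex.norm_le_abs_re_add_abs_im (graphCurve ψ s)
  have h3 : |ψ s| ≤ |ψ 0| + κ * |s| := by
    have := abs_sub_abs_le_abs_sub (ψ s) (ψ 0)
    linarith
  simp only [graphCurve] at h2 ⊢
  nlinarith [abs_nonneg s, abs_nonneg (ψ 0), κ.coe_nonneg, mul_nonneg (abs_nonneg s) (abs_nonneg (ψ 0))]

theorem isClosed_range_graphCurve (h : Continuous ψ) : IsClosed (Set.range (graphCurve ψ)) := by
  have : Set.range (graphCurve ψ) = {z : ℂ | z.re = ψ z.im} := by
    ext z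
    constructor
    · rintro ⟨s, rfl⟩
      rfl
    · intro hz
      exact ⟨z.im, Complex.ext hz.symm rfl⟩
  rw [this]
  exact isClosed_eq Complex.continuous_re (h.comp Complex.continuous_im)

variable {Q : Type} [Finite Q] {ψ : Q → ℝ → ℝ}

theorem continuous_of_exists_lipschitzWith {ψ : ℝ → ℝ} (h : ∃ κ, LipschitzWith κ ψ) :
    Continuous ψ := by
  obtain ⟨κ, hκ⟩ := h
  exact hκ.continuous

theorem carrier_graphSet : (graphSet ψ).carrier = ⋃ q, Set.range (graphCurve (ψ q)) := by
  simp [graphSet, SpectralSet.carrier, ParamCurve.image]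

theorem isValid_graphSet (h : ∀ q, ∃ κ, LipschitzWith κ (ψ q))
    (hd : ∀ q q', q ≠ q' → Disjoint (Set.range (graphCurve (ψ q))) (Set.range (graphCurve (ψ q')))) :
    (graphSet ψ).IsValid := by
  refine ⟨‹_›, fun q => ?_, fun q q' hqq' => ?_⟩
  · obtain ⟨κ, hκ⟩ := exists_lipschitzWith_graphCurve (h q)
    refine ⟨hκ.locallyLipschitz, Or.inl ⟨rfl, graphCurve_injective, ?_⟩⟩
    rw [← Metric.cobounded_eq_cocompact (α := ℂ), ← tendsto_norm_atTop_iff_cobounded]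
    refine tendsto_atTop_mono (fun s => abs_le_norm_graphCurve s) ?_
    exact tendsto_norm_cocompact_atTop
  · simpa [ParamCurve.image] using hd q q' hqq'

theorem lintegral_arcMeasure {ψ : ℝ → ℝ} (h : Continuous ψ) {G : ℂ → ENNReal} (hG : Measurable G) :
    ∫⁻ z, G z ∂(ParamCurve.arcMeasure ⟨Set.univ, graphCurve ψ⟩) =
      ∫⁻ s, ‖deriv (graphCurve ψ) s‖ₑ * G (graphCurve ψ s) := by
  have hm : Measurable (graphCurve ψ) := (continuous_graphCurve h).measurable
  rw [ParamCurve.arcMeasure, Measure.restrict_univ, lintegral_map hG hm,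
    lintegral_withDensity_eq_lintegral_mul _ (measurable_deriv _).enorm
      (g := fun s => G (graphCurve ψ s)) (hG.comp hm)]
  rfl

theorem lintegral_arcMeasure_le {ψ : ℝ → ℝ} {κ : NNReal} (hκ : LipschitzWith κ (graphCurve ψ))
    {G : ℂ → ENNReal} (hG : Measurable G) :
    ∫⁻ z, G z ∂(ParamCurve.arcMeasure ⟨Set.univ, graphCurve ψ⟩) ≤
      κ * ∫⁻ s, G (graphCurve ψ s) := by
  have hm : Measurable (graphCurve ψ) := hκ.continuous.measurable
  have hc : Continuous ψ := Complex.continuous_re.comp hκ.continuous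
  rw [lintegral_arcMeasure hc hG,
    ← lintegral_const_mul _ (f := fun s => G (graphCurve ψ s)) (hG.comp hm)]
  refine lintegral_mono fun s => ?_
  gcongr
  have h1 := norm_deriv_le_of_lipschitz (x₀ := s) hκ
  rw [enorm_eq_nnnorm]
  exact ENNReal.coe_le_coe.2 (NNReal.coe_le_coe.1 h1)

/-- The Lipschitz constant bounds the speed, so arc length is dominated by a multiple of ds and
integrability on Ω is reduced to integrability on the line. -/
theorem exists_lintegral_graphSet_le (h : ∀ q, ∃ κ, LipschitzWith κ (ψ q)) :
    ∃ κ : NNReal, ∀ G : ℂ → ENNReal, Measurable G → ∫⁻ z, G z ∂(graphSet ψ).absMeasure ≤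
      κ * ∑' q, ∫⁻ s, G (graphCurve (ψ q) s) := by
  choose κ hκ using fun q => exists_lipschitzWith_graphCurve (h q)
  have := Fintype.ofFinite Q
  refine ⟨∑ q, κ q, fun G hG => ?_⟩
  rw [graphSet, SpectralSet.absMeasure, lintegral_sum_measure, ← ENNReal.tsum_mul_left]
  refine ENNReal.tsum_le_tsum fun q => (lintegral_arcMeasure_le (hκ q) hG).trans ?_
  gcongr
  exact_mod_cast Finset.single_le_sum (f := κ) (fun _ _ => zero_le) (Finset.mem_univ q)

/-- The horizontal strips |Im z| ≤ n exhaust the plane and meet each graph in a set of finite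
length. -/
theorem sigmaFinite_graphSet (h : ∀ q, ∃ κ, LipschitzWith κ (ψ q)) :
    SigmaFinite (graphSet ψ).absMeasure := by
  obtain ⟨κ, hκ⟩ := exists_lintegral_graphSet_le h
  have hS : ∀ n : ℕ, MeasurableSet {z : ℂ | |z.im| ≤ n} := fun n =>
    measurableSet_le (by fun_prop) measurable_const
  refine ⟨⟨⟨fun n : ℕ => {z : ℂ | |z.im| ≤ n}, fun n => trivial, fun n => ?_, ?_⟩⟩⟩
  · rw [← lintegral_indicator_one (hS n)]
    refine (hκ _ (measurable_one.indicator (hS n))).trans_lt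
      (ENNReal.mul_lt_top ENNReal.coe_lt_top ?_)
    have := Fintype.ofFinite Q
    rw [tsum_fintype]
    refine ENNReal.sum_lt_top.2 fun q _ => ?_
    have : (fun s => {z : ℂ | |z.im| ≤ n}.indicator (1 : ℂ → ENNReal) (graphCurve (ψ q) s)) =
        (Set.Icc (-n : ℝ) n).indicator 1 := by
      ext s
      simp only [Set.indicator_apply, graphCurve, Set.mem_Icc, Set.mem_ofPred_eq, abs_le]
      rfl
    rw [this, lintegral_indicator_one measurableSet_Icc, Real.volume_Icc]
    exact ENNReal.ofReal_lt_top
  · ext z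
    obtain ⟨n, hn⟩ := exists_nat_ge |z.im|
    simp only [Set.mem_iUnion, Set.mem_univ, iff_true]
    exact ⟨n, hn⟩

theorem ae_mem_carrier_graphSet (h : ∀ q, ∃ κ, LipschitzWith κ (ψ q)) :
    ∀ᵐ z ∂(graphSet ψ).absMeasure, z ∈ (graphSet ψ).carrier := by
  obtain ⟨κ, hκ⟩ := exists_lintegral_graphSet_le h
  have hS : MeasurableSet (graphSet ψ).carrier := by
    rw [carrier_graphSet]
    exact MeasurableSet.iUnion fun q =>
      (isClosed_range_graphCurve (continuous_of_exists_lipschitzWith (h q))).measurableSet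
  rw [ae_iff]
  have hc : {z | z ∉ (graphSet ψ).carrier} = (graphSet ψ).carrierᶜ := rfl
  rw [hc, ← lintegral_indicator_one hS.compl]
  refine le_antisymm ((hκ _ (measurable_one.indicator hS.compl)).trans (le_of_eq ?_)) zero_le
  have : ∀ q s, (graphSet ψ).carrierᶜ.indicator (1 : ℂ → ENNReal) (graphCurve (ψ q) s) = 0 := by
    intro q s
    refine Set.indicator_of_notMem ?_ _
    rw [Set.notMem_compl_iff, carrier_graphSet]
    exact Set.mem_iUnion.2 ⟨q, s, rfl⟩
  simp [this]

theorem integrable_exp_neg_abs : Integrable fun s : ℝ => Real.exp (-|s|) := by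
  have h1 : IntegrableOn (fun s : ℝ => Real.exp (-|s|)) (Set.Ioi 0) :=
    (integrableOn_exp_neg_Ioi 0).congr_fun
      (fun s hs => by simp only [abs_of_pos (Set.mem_Ioi.1 hs)]) measurableSet_Ioi
  have h2 : IntegrableOn (fun s : ℝ => Real.exp (-|s|)) (Set.Iic 0) :=
    (integrableOn_exp_Iic 0).congr_fun
      (fun s hs => by simp only [abs_of_nonpos (Set.mem_Iic.1 hs), neg_neg]) measurableSet_Iic
  have h3 := h2.union h1
  rwa [Set.Iic_union_Ioi, integrableOn_univ] at h3

/-- Exponential decay along the curves implies square integrability and boundedness. -/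
theorem memLp_graphSet (h : ∀ q, ∃ κ, LipschitzWith κ (ψ q)) {F : ℂ → ℂ} (hF : Measurable F)
    (hb : ∀ q, ∃ c, ∀ s, ‖F (graphCurve (ψ q) s)‖ ≤ c * Real.exp (-(|s| / 2))) :
    MemLp F 2 (graphSet ψ).absMeasure ∧ MemLp F ⊤ (graphSet ψ).absMeasure := by
  choose c hc using hb
  have hc0 : ∀ q, 0 ≤ c q := fun q => by
    have := (norm_nonneg _).trans (hc q 0)
    simpa using this
  obtain ⟨κ, hκ⟩ := exists_lintegral_graphSet_le h
  have := Fintype.ofFinite Q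
  constructor
  · rw [memLp_two_iff_integrable_sq_norm hF.aestronglyMeasurable]
    refine ⟨(hF.norm.pow_const 2).aestronglyMeasurable, ?_⟩
    rw [hasFiniteIntegral_iff_enorm]
    refine (hκ _ (hF.norm.pow_const 2).enorm).trans_lt
      (ENNReal.mul_lt_top ENNReal.coe_lt_top ?_)
    rw [tsum_fintype]
    refine ENNReal.sum_lt_top.2 fun q _ => ?_
    have hi : Integrable fun s : ℝ => c q ^ 2 * Real.exp (-|s|) :=
      integrable_exp_neg_abs.const_mul _
    refine lt_of_le_of_lt (lintegral_mono fun s => ?_) hi.hasFiniteIntegral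
    refine enorm_le_iff_norm_le.2 ?_
    rw [Real.norm_of_nonneg (by positivity), Real.norm_of_nonneg (by positivity)]
    refine (pow_le_pow_left₀ (norm_nonneg _) (hc q s) 2).trans (le_of_eq ?_)
    rw [mul_pow, ← Real.exp_nat_mul]
    congr 2
    push_cast
    ring
  · refine memLp_top_of_bound hF.aestronglyMeasurable (∑ q, c q) ?_
    filter_upwards [ae_mem_carrier_graphSet h] with z hz
    rw [carrier_graphSet, Set.mem_iUnion] at hz
    obtain ⟨q, s, rfl⟩ := hz
    refine (hc q s).trans ((mul_le_of_le_one_right (hc0 q) ?_).trans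
      (Finset.single_le_sum (f := c) (fun q _ => hc0 q) (Finset.mem_univ q)))
    rw [Real.exp_le_one_iff]
    linarith [abs_nonneg s]

/-- Half of the exponential rate pays for the weight: 1 + |s| ≤ 8 exp(|s|/8), whose fourth power is
4096 exp(|s|/2). -/
theorem exists_weight_mul_le {ψ : ℝ → ℝ} (h : ∃ κ, LipschitzWith κ ψ) {F : ℂ → ℂ}
    (hb : ∃ c, ∀ s, ‖F (graphCurve ψ s)‖ ≤ c * Real.exp (-|s|)) :
    ∃ c, ∀ s, ‖((1 + ‖graphCurve ψ s‖ : ℝ) : ℂ) ^ 4 * F (graphCurve ψ s)‖ ≤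
      c * Real.exp (-(|s| / 2)) := by
  obtain ⟨c, hc⟩ := hb
  obtain ⟨d, hd0, hd⟩ := exists_norm_graphCurve_le h
  refine ⟨d ^ 4 * 4096 * c, fun s => ?_⟩
  have h1 : 1 + |s| ≤ 8 * Real.exp (|s| / 8) := by
    have := Real.add_one_le_exp (|s| / 8)
    linarith
  have h2 : (1 + |s|) ^ 4 ≤ 4096 * Real.exp (|s| / 2) := by
    refine (pow_le_pow_left₀ (by positivity) h1 4).trans (le_of_eq ?_)
    rw [mul_pow, ← Real.exp_nat_mul]
    norm_num
    ring
  rw [norm_mul, norm_pow, Complex.norm_real, Real.norm_of_nonneg (by positivity)]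
  have h4 : Real.exp (|s| / 2) * Real.exp (-|s|) = Real.exp (-(|s| / 2)) := by
    rw [← Real.exp_add]
    congr 1
    ring
  have hc0 : 0 ≤ c * Real.exp (-|s|) := (norm_nonneg _).trans (hc s)
  calc _ ≤ (d * (1 + |s|)) ^ 4 * (c * Real.exp (-|s|)) :=
        mul_le_mul (pow_le_pow_left₀ (by positivity) (hd s) 4) (hc s) (norm_nonneg _)
          (by positivity)
    _ = d ^ 4 * (1 + |s|) ^ 4 * (c * Real.exp (-|s|)) := by ring
    _ ≤ d ^ 4 * (4096 * Real.exp (|s| / 2)) * (c * Real.exp (-|s|)) := by gcongr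
    _ = d ^ 4 * 4096 * c * (Real.exp (|s| / 2) * Real.exp (-|s|)) := by ring
    _ = _ := by rw [h4]

/-- The unit tangent vector of a graph. -/
noncomputable def unitTangent (ψ : ℝ → ℝ) (s : ℝ) : ℂ :=
  deriv (graphCurve ψ) s / (‖deriv (graphCurve ψ) s‖ : ℂ)

/-- `phase` uses an arbitrarily chosen parameter above the point. As the curves are disjoint and
injective, there is only one. -/
theorem phase_graphSet
    (hd : ∀ q q', q ≠ q' → Disjoint (Set.range (graphCurve (ψ q))) (Set.range (graphCurve (ψ q'))))
    (q : Q) (s : ℝ) : (graphSet ψ).phase (graphCurve (ψ q) s) = unitTangent (ψ q) s := by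
  have hex : ∃ r : Q × ℝ, r.2 ∈ (Set.univ : Set ℝ) ∧ graphCurve (ψ r.1) r.2 = graphCurve (ψ q) s :=
    ⟨(q, s), trivial, rfl⟩
  have h : (graphSet ψ).phase (graphCurve (ψ q) s) =
      unitTangent (ψ hex.choose.1) hex.choose.2 := dif_pos hex
  have h2 := hex.choose_spec.2
  have h1 : hex.choose.1 = q := by
    by_contra hne
    exact Set.disjoint_left.1 (hd _ _ hne) ⟨_, rfl⟩ ⟨s, h2.symm⟩
  rw [h]
  rw [h1] at h2 ⊢
  rw [graphCurve_injective h2]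

theorem phase_graphSet_of_notMem {z : ℂ} (hz : z ∉ (graphSet ψ).carrier) :
    (graphSet ψ).phase z = 0 := by
  refine dif_neg fun h => hz ?_
  obtain ⟨⟨q, s⟩, -, h⟩ := h
  rw [carrier_graphSet]
  exact Set.mem_iUnion.2 ⟨q, s, h⟩

/-- Only an inequality: where the curve is not differentiable, `deriv` and hence the quotient are 0.
-/
theorem norm_unitTangent_le (ψ : ℝ → ℝ) (s : ℝ) : ‖unitTangent ψ s‖ ≤ 1 := by
  rw [unitTangent, norm_div, Complex.norm_real, norm_norm]
  exact div_self_le_one _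

theorem phaseRegular_graphSet (h : ∀ q, ∃ κ, LipschitzWith κ (ψ q))
    (hd : ∀ q q', q ≠ q' → Disjoint (Set.range (graphCurve (ψ q)))
      (Set.range (graphCurve (ψ q')))) : (graphSet ψ).PhaseRegular := by
  have := Fintype.ofFinite Q
  refine ⟨?_, fun z => ?_⟩
  -- On a graph over the imaginary axis the parameter is Im z, which turns the phase into an
  -- explicit measurable function.
  · have h1 : (graphSet ψ).phase = fun z => ∑ q, (Set.range (graphCurve (ψ q))).indicator
        (fun z => unitTangent (ψ q) z.im) z := by
      ext z
      by_cases hz : z ∈ (graphSet ψ).carrier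
      · rw [carrier_graphSet, Set.mem_iUnion] at hz
        obtain ⟨q, s, rfl⟩ := hz
        rw [phase_graphSet hd, Finset.sum_eq_single_of_mem q (Finset.mem_univ q)]
        · rw [Set.indicator_of_mem (Set.mem_range_self s)]
          rfl
        · exact fun q' _ hq' => Set.indicator_of_notMem
            (Set.disjoint_left.1 (hd q q' hq'.symm) (Set.mem_range_self s)) _
      · rw [phase_graphSet_of_notMem hz]
        refine (Finset.sum_eq_zero fun q _ => Set.indicator_of_notMem (fun hq => hz ?_) _).symm
        rw [carrier_graphSet]
        exact Set.mem_iUnion.2 ⟨q, hq⟩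
    rw [h1]
    refine (Finset.measurable_fun_sum _ fun q _ => ?_).aestronglyMeasurable
    have hm : Measurable (unitTangent (ψ q)) :=
      (measurable_deriv _).div (Complex.measurable_ofReal.comp (measurable_deriv _).norm)
    exact (hm.comp Complex.measurable_im).indicator
      (isClosed_range_graphCurve (continuous_of_exists_lipschitzWith (h q))).measurableSet
  · by_cases hz : z ∈ (graphSet ψ).carrier
    · rw [carrier_graphSet, Set.mem_iUnion] at hz
      obtain ⟨q, s, rfl⟩ := hz
      rw [phase_graphSet hd]
      exact norm_unitTangent_le _ _
    · rw [phase_graphSet_of_notMem hz, norm_zero]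
      exact zero_le_one

end Graphs

/-! ### Decay of cubic exponentials along the contours, and separation. -/

section Decay

theorem re_pow_eq (z : ℂ) (n : ℕ) : (z ^ n).re = ‖z‖ ^ n * Real.cos (n * z.arg) := by
  conv_lhs => rw [← Complex.norm_mul_exp_arg_mul_I z]
  rw [mul_pow, ← Complex.exp_nat_mul, ← Complex.ofReal_pow, Complex.re_ofReal_mul]
  congr 1
  rw [show (n : ℂ) * (z.arg * Complex.I) = ((n * z.arg : ℝ) : ℂ) * Complex.I by push_cast; ring,
    Complex.exp_ofReal_mul_I_re]

theorem re_cubic_eq (a b d : ℝ) (z : ℂ) : ((a : ℂ) * z ^ 3 + b * z ^ 2 + d * z).re =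
    a * Real.cos (3 * z.arg) * ‖z‖ ^ 3 + b * Real.cos (2 * z.arg) * ‖z‖ ^ 2 +
      d * Real.cos z.arg * ‖z‖ := by
  have h1 := re_pow_eq z 1
  have h2 := re_pow_eq z 2
  have h3 := re_pow_eq z 3
  rw [pow_one, pow_one, Nat.cast_one, one_mul] at h1
  push_cast at h2 h3
  rw [Complex.add_re, Complex.add_re, Complex.re_ofReal_mul, Complex.re_ofReal_mul,
    Complex.re_ofReal_mul, h1, h2, h3]
  ring

/-- The condition on the end angle under which a cubic exponential decays. -/
def DecayAngle (a b θ : ℝ) : Prop :=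
  a * Real.cos (3 * θ) < 0 ∨ (a = 0 ∧ b * Real.cos (2 * θ) < 0)

theorem DecayAngle.neg {a b θ : ℝ} (h : DecayAngle a b θ) : DecayAngle a b (-θ) := by
  rw [DecayAngle, mul_neg, mul_neg, Real.cos_neg, Real.cos_neg]
  exact h

/-- In polar coordinates the leading term, which is the cubic one or, if a = 0, the quadratic one,
has a coefficient that stays below a negative constant and dominates the rest. The constant 2 is
chosen with a view to the square root of the exponential. -/
theorem eventually_re_cubic_le {ι : Type*} {l : Filter ι} {z : ι → ℂ} {a b d θ : ℝ}
    (hz : Tendsto (fun s => ‖z s‖) l atTop) (harg : Tendsto (fun s => (z s).arg) l (𝓝 θ))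
    (h : DecayAngle a b θ) :
    ∀ᶠ s in l, ((a : ℂ) * z s ^ 3 + b * z s ^ 2 + d * z s).re ≤ -(2 * ‖z s‖) := by
  have hlt : ∀ (a : ℝ) (n : ℝ), a * Real.cos (n * θ) < 0 → ∃ ε > 0, ∀ᶠ s in l,
      a * Real.cos (n * (z s).arg) ≤ -ε := fun a n ha => by
    refine ⟨-(a * Real.cos (n * θ)) / 2, by linarith, ?_⟩
    have ht : Tendsto (fun s => a * Real.cos (n * (z s).arg)) l (𝓝 (a * Real.cos (n * θ))) :=
      (((Real.continuous_cos.tendsto _).comp (harg.const_mul n))).const_mul a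
    exact (ht.eventually (eventually_le_nhds (by linarith :
      a * Real.cos (n * θ) < a * Real.cos (n * θ) / 2))).mono fun s hs => by linarith
  have hcos : ∀ (b x : ℝ), b * Real.cos x ≤ |b| := fun b x => by
    refine (le_abs_self _).trans ?_
    rw [abs_mul]
    exact mul_le_of_le_one_right (abs_nonneg _) (Real.abs_cos_le_one x)
  rcases h with h | ⟨rfl, h⟩
  · obtain ⟨ε, hε, hev⟩ := hlt a 3 h
    filter_upwards [hev, hz.eventually_ge_atTop (max 1 ((|b| + |d| + 2) / ε))] with s hs hs'
    have h1 := (le_max_left _ _).trans hs'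
    have h2 := (le_max_right _ _).trans hs'
    rw [div_le_iff₀ hε] at h2
    rw [re_cubic_eq]
    have hb := hcos b (2 * (z s).arg)
    have hd := hcos d (z s).arg
    set ρ := ‖z s‖
    have e1 : a * Real.cos (3 * (z s).arg) * ρ ^ 3 ≤ -ε * ρ ^ 3 := by gcongr
    have e2 : b * Real.cos (2 * (z s).arg) * ρ ^ 2 ≤ |b| * ρ ^ 2 := by gcongr
    have e3 : d * Real.cos (z s).arg * ρ ≤ |d| * ρ := by gcongr
    have e4 : (|b| + |d| + 2) * ρ ^ 2 ≤ ρ * ε * ρ ^ 2 := by gcongr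
    have e5 : (|d| + 2) * ρ ≤ (|d| + 2) * ρ ^ 2 := by
      gcongr
      nlinarith
    nlinarith
  · obtain ⟨ε, hε, hev⟩ := hlt b 2 h
    filter_upwards [hev, hz.eventually_ge_atTop (max 1 ((|d| + 2) / ε))] with s hs hs'
    have h1 := (le_max_left _ _).trans hs'
    have h2 := (le_max_right _ _).trans hs'
    rw [div_le_iff₀ hε] at h2
    rw [re_cubic_eq]
    have hd := hcos d (z s).arg
    set ρ := ‖z s‖
    have e2 : b * Real.cos (2 * (z s).arg) * ρ ^ 2 ≤ -ε * ρ ^ 2 := by gcongr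
    have e3 : d * Real.cos (z s).arg * ρ ≤ |d| * ρ := by gcongr
    have e4 : (|d| + 2) * ρ ≤ ρ * ε * ρ := by gcongr
    nlinarith

theorem tendsto_norm_graphCurve (ψ : ℝ → ℝ) :
    Tendsto (fun s => ‖graphCurve ψ s‖) atTop atTop ∧
      Tendsto (fun s => ‖graphCurve ψ s‖) atBot atTop :=
  ⟨tendsto_atTop_mono (fun s => abs_le_norm_graphCurve s) tendsto_abs_atTop_atTop,
    tendsto_atTop_mono (fun s => abs_le_norm_graphCurve s) tendsto_abs_atBot_atTop⟩

/-- Outside a compact interval the tails are controlled, and on it the maximum is attained. The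
attained maximum matters where a strict inequality at every point is to become uniform. -/
theorem exists_bound_of_tails {F : ℝ → ℝ} (hF : Continuous F) {M : ℝ}
    (h1 : ∀ᶠ s in atTop, F s ≤ M) (h2 : ∀ᶠ s in atBot, F s ≤ M) :
    ∃ a b, a ≤ b ∧ (∀ s, s ∉ Set.Icc a b → F s ≤ M) ∧ ∃ s₀ ∈ Set.Icc a b,
      ∀ s ∈ Set.Icc a b, F s ≤ F s₀ := by
  obtain ⟨b, hb⟩ := eventually_atTop.1 h1
  obtain ⟨a, ha⟩ := eventually_atBot.1 h2
  refine ⟨min a b, max a b, min_le_max, fun s hs => ?_, ?_⟩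
  · rw [Set.mem_Icc, not_and_or, not_le, not_le] at hs
    rcases hs with hs | hs
    · exact ha s (hs.le.trans (min_le_left _ _))
    · exact hb s ((le_max_right _ _).trans hs.le)
  · exact isCompact_Icc.exists_isMaxOn (Set.nonempty_Icc.2 min_le_max) hF.continuousOn

/-- Decay of the square root of a cubic exponential along a graph. -/
theorem exists_exp_cubic_le {ψ : ℝ → ℝ} (h : Continuous ψ) {a b d θ₁ θ₂ : ℝ}
    (ht : Tendsto (fun s => (graphCurve ψ s).arg) atTop (𝓝 θ₂))
    (hb : Tendsto (fun s => (graphCurve ψ s).arg) atBot (𝓝 (-θ₁)))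
    (h₁ : DecayAngle a b θ₁) (h₂ : DecayAngle a b θ₂) :
    ∃ c, ∀ s, ‖Complex.exp ((a * graphCurve ψ s ^ 3 + b * graphCurve ψ s ^ 2 +
      d * graphCurve ψ s) / 2)‖ ≤ c * Real.exp (-|s|) := by
  have hc := continuous_graphCurve h
  obtain ⟨ht', hb'⟩ := tendsto_norm_graphCurve ψ
  set P : ℝ → ℝ := fun s => ((a : ℂ) * graphCurve ψ s ^ 3 + b * graphCurve ψ s ^ 2 +
      d * graphCurve ψ s).re with hP
  have hPc : Continuous fun s => P s / 2 + |s| := by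
    have : Continuous P := Complex.continuous_re.comp (by fun_prop)
    fun_prop
  have key : ∀ s, P s ≤ -(2 * ‖graphCurve ψ s‖) → P s / 2 + |s| ≤ 0 := fun s hs => by
    have := abs_le_norm_graphCurve (ψ := ψ) s
    linarith
  obtain ⟨x, y, -, hout, s₀, -, hin⟩ := exists_bound_of_tails hPc (M := 0)
    ((eventually_re_cubic_le ht' ht h₂).mono key) ((eventually_re_cubic_le hb' hb h₁.neg).mono key)
  refine ⟨Real.exp (max 0 (P s₀ / 2 + |s₀|)), fun s => ?_⟩
  rw [Complex.norm_exp, ← Real.exp_add, Real.exp_le_exp, Complex.div_ofNat_re]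
  have : P s / 2 + |s| ≤ max 0 (P s₀ / 2 + |s₀|) := by
    by_cases hs : s ∈ Set.Icc x y
    · exact (hin s hs).trans (le_max_right _ _)
    · exact (hout s hs).trans (le_max_left _ _)
  simp only [hP] at this ⊢
  linarith

/-- A graph in the left half plane with ends in open sectors of the left half plane stays away from
the imaginary axis. -/
theorem exists_re_le_of_tails {ψ : ℝ → ℝ} (h : Continuous ψ) {θ₁ θ₂ : ℝ}
    (ht : Tendsto (fun s => (graphCurve ψ s).arg) atTop (𝓝 θ₂))
    (hb : Tendsto (fun s => (graphCurve ψ s).arg) atBot (𝓝 (-θ₁)))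
    (h₁ : Real.cos θ₁ < 0) (h₂ : Real.cos θ₂ < 0) (hneg : ∀ s, ψ s < 0) :
    ∃ δ > 0, ∀ s, ψ s ≤ -δ := by
  obtain ⟨ht', hb'⟩ := tendsto_norm_graphCurve ψ
  have key : ∀ {l : Filter ℝ} {θ : ℝ}, Real.cos θ < 0 → Tendsto (fun s => ‖graphCurve ψ s‖) l atTop →
      Tendsto (fun s => (graphCurve ψ s).arg) l (𝓝 θ) → ∀ᶠ s in l, ψ s ≤ -1 := by
    intro l θ hθ hl harg
    have hc := ((Real.continuous_cos.tendsto _).comp harg).eventually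
      (eventually_le_nhds (by linarith : Real.cos θ < Real.cos θ / 2))
    filter_upwards [hc, hl.eventually_ge_atTop (-(2 / Real.cos θ))] with s hs hs'
    have h1 := re_pow_eq (graphCurve ψ s) 1
    rw [pow_one, pow_one, Nat.cast_one, one_mul] at h1
    have h2 : ψ s = (graphCurve ψ s).re := rfl
    rw [h2, h1]
    simp only [Function.comp] at hs
    have h3 : -(2 / Real.cos θ) * (Real.cos θ / 2) = -1 := by
      have := hθ.ne
      field_simp
    nlinarith [norm_nonneg (graphCurve ψ s)]
  obtain ⟨x, y, -, hout, s₀, -, hin⟩ := exists_bound_of_tails h (M := -1)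
    (key h₂ ht' ht) (key (by rwa [Real.cos_neg]) hb' hb)
  refine ⟨min 1 (-ψ s₀), lt_min one_pos (by linarith [hneg s₀]), fun s => ?_⟩
  by_cases hs : s ∈ Set.Icc x y
  · linarith [hin s hs, min_le_right 1 (-ψ s₀)]
  · linarith [hout s hs, min_le_left 1 (-ψ s₀)]

/-- Two translates of a Lipschitz graph are separated. -/
theorem le_dist_graphCurve_of_translate {φ : ℝ → ℝ} {κ : NNReal} (h : LipschitzWith κ φ)
    (a b : ℝ) (s t : ℝ) : |a - b| / (1 + κ) ≤
      ‖graphCurve (fun s => a + φ s) s - graphCurve (fun s => b + φ s) t‖ := by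
  have h1 := h.dist_le_mul s t
  rw [Real.dist_eq, Real.dist_eq] at h1
  have h2 := Complex.abs_re_le_norm
    (graphCurve (fun s => a + φ s) s - graphCurve (fun s => b + φ s) t)
  have h3 := Complex.abs_im_le_norm
    (graphCurve (fun s => a + φ s) s - graphCurve (fun s => b + φ s) t)
  set N := ‖graphCurve (fun s => a + φ s) s - graphCurve (fun s => b + φ s) t‖
  simp only [graphCurve, Complex.sub_re, Complex.sub_im] at h2 h3
  rw [div_le_iff₀ (by positivity)]
  -- The shift is at most the horizontal distance plus the variation of φ, and the latter is at most
  -- κ times the vertical distance.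
  have h4 : |a - b| ≤ |a + φ s - (b + φ t)| + |φ s - φ t| := by
    have := abs_sub (a + φ s - (b + φ t)) (φ s - φ t)
    refine le_trans (le_of_eq ?_) this
    congr 1
    ring
  nlinarith [κ.coe_nonneg]

end Decay

end KPZ

/-! ### Coefficients, measurability and the geometry of the contour system. -/

namespace KPZ

section Coefficients

variable {m : ℕ} (p : CubicParams m)

/-- The coefficient of `z³` in `expo`. -/
def CubicParams.coeffT (j : ℕ) : ℝ := if h : 1 ≤ j ∧ j ≤ m then p.t ⟨j - 1, by omega⟩ else 0

/-- The coefficient of `z²` in `expo`. -/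
def CubicParams.coeffY (j : ℕ) : ℝ := if h : 1 ≤ j ∧ j ≤ m then p.y ⟨j - 1, by omega⟩ else 0

/-- The coefficient of `z` in `expo`. -/
def CubicParams.coeffX (j : ℕ) : ℝ := if h : 1 ≤ j ∧ j ≤ m then p.x ⟨j - 1, by omega⟩ else 0

theorem CubicParams.expo_eq (j : ℕ) (z : ℂ) :
    p.expo j z = p.coeffT j * z ^ 3 + p.coeffY j * z ^ 2 + p.coeffX j * z := by
  rw [expo, coeffT, coeffY, coeffX]
  split_ifs <;> simp

theorem CubicParams.continuous_expo (j : ℕ) : Continuous (p.expo j) := by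
  have : p.expo j = fun z : ℂ => p.coeffT j * z ^ 3 + p.coeffY j * z ^ 2 + p.coeffX j * z :=
    funext (p.expo_eq j)
  rw [this]
  fun_prop

end Coefficients

section Measurability

variable {m : ℕ} {K : KernelData} {p : CubicParams m}

theorem measurable_chi {S : Set ℂ} (hS : MeasurableSet S) : Measurable (chi S) :=
  measurable_const.indicator hS

theorem KernelData.HasCells.measurable_glue (hK : K.HasCells m) {a b : ℕ → ℂ → ℂ}
    (ha : ∀ j ∈ Finset.Icc 1 m, Measurable (a j)) (hb : ∀ j ∈ Finset.Icc 1 m, Measurable (b j)) :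
    Measurable fun z => K.glue m (fun j => a j z) (fun j => b j z) z :=
  Finset.measurable_fun_sum _ fun j hj => ((measurable_chi (hK.meas1 j hj)).mul (ha j hj)).add
    ((measurable_chi (hK.meas2 j hj)).mul (hb j hj))

theorem KernelData.HasCells.measurable_halfExp (hK : K.HasCells m) : Measurable (K.halfExp p) := by
  have hc := fun j => (p.continuous_expo j).measurable
  exact Complex.measurable_exp.comp (hK.measurable_glue
    (a := fun i z => (p.expo (oddOf i) z - p.expo (evenOf i) z) / 2)
    (b := fun i z => (p.expo (evenOf i) z - p.expo (oddOf i) z) / 2)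
    (fun j _ => ((hc _).sub (hc _)).div_const _) fun j _ => ((hc _).sub (hc _)).div_const _)

theorem measurable_ite_zero {c : Prop} [Decidable c] {a : ℂ → ℂ} (ha : Measurable a) :
    Measurable fun z => if c then a z else 0 := by
  split_ifs
  · exact ha
  · exact measurable_const

theorem KernelData.HasCells.measurable_F (hK : K.HasCells m)
    (hA : ∀ j ∈ Finset.Icc 1 m, Measurable (K.A j)) (n : Fin (m + 1)) :
    Measurable fun z => (K.family m).F z n := by
  simp_rw [family_F]
  exact hK.measurable_glue (fun j hj => measurable_ite_zero (hA j hj))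
    fun j hj => measurable_ite_zero (hA j hj)

theorem KernelData.HasCells.measurable_G (hK : K.HasCells m)
    (hB : ∀ j ∈ Finset.Icc 1 m, Measurable (K.B j)) (n : Fin (m + 1)) :
    Measurable fun z => (K.family m).G z n := by
  simp_rw [family_G]
  exact hK.measurable_glue (fun j hj => measurable_ite_zero (hB j hj))
    fun j hj => measurable_ite_zero (hB j hj)

end Measurability

theorem exists_pos_forall_le {ι : Type*} [Finite ι] {δ : ι → ℝ} (h : ∀ i, 0 < δ i) :
    ∃ r > 0, ∀ i, r ≤ δ i := by
  have h1 : ∀ᶠ r in 𝓝[>] (0 : ℝ), ∀ i, r ≤ δ i := eventually_all.2 fun i =>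
    mem_of_superset (Ioc_mem_nhdsGT (h i)) fun r hr => hr.2
  obtain ⟨r, hr, hr0⟩ := (h1.and self_mem_nhdsWithin).exists
  exact ⟨r, hr0, hr⟩

namespace ContourSystem

variable (C : ContourSystem) {m : ℕ}

/-- The labels of the contours. -/
abbrev Label (m : ℕ) : Type := Bool × {k : ℤ // k.natAbs < m}

/-- The function whose graph is the contour with the given label. -/
def profile (q : Label m) : ℝ → ℝ :=
  if q.1 then fun s => -(C.aL q.2 + C.φL s) else fun s => C.aR q.2 + C.φR s

/-- The contour with the given label. -/
def curve (q : Label m) : ℝ → ℂ := graphCurve (C.profile q)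

/-- The sets `Γ_{j,L}` and `Γ_{j,R}`. -/
def gamma (b : Bool) (j : ℕ) : Set ℂ := if b then C.gammaL j else C.gammaR j

variable {C}

theorem curve_true (k : {k : ℤ // k.natAbs < m}) : C.curve (true, k) = C.leftCurve k := rfl

theorem curve_false (k : {k : ℤ // k.natAbs < m}) : C.curve (false, k) = C.rightCurve k := rfl

theorem omega_eq : C.omega m = graphSet (C.profile (m := m)) := by
  rw [omega, graphSet]
  congr 1
  ext1 q
  obtain ⟨b, k⟩ := q
  cases b <;> rfl

theorem set1_eq (j : ℕ) : C.set1 j = C.gamma (decide (Odd j)) j := by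
  by_cases h : Odd j <;> simp [set1, gamma, h]

theorem set2_eq (j : ℕ) : C.set2 j = C.gamma (!decide (Odd j)) j := by
  by_cases h : Odd j
  · simp [set2, gamma, h]
  · have h' : decide (Odd j) = false := decide_eq_false h
    rw [set2, gamma, if_neg h, h']
    rfl

instance : Finite {k : ℤ // k.natAbs < m} :=
  Set.Finite.to_subtype ((Set.finite_Icc (-(m : ℤ)) m).subset fun k hk => by
    have : k.natAbs < m := hk
    rw [Set.mem_Icc]
    omega)

namespace IsAdmissible

variable (hC : C.IsAdmissible m)
include hC

theorem lip (q : Label m) : ∃ κ, LipschitzWith κ (C.profile q) := by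
  obtain ⟨b, k⟩ := q
  cases b
  · obtain ⟨κ, hκ⟩ := hC.lipR
    exact ⟨κ, LipschitzWith.of_dist_le_mul fun s t => by
      simpa [profile] using hκ.dist_le_mul s t⟩
  · obtain ⟨κ, hκ⟩ := hC.lipL
    exact ⟨κ, LipschitzWith.of_dist_le_mul fun s t => by
      simpa [profile] using hκ.dist_le_mul s t⟩

theorem continuous_profile (q : Label m) : Continuous (C.profile q) :=
  continuous_of_exists_lipschitzWith (hC.lip q)

/-- The ends lie in open sectors of the left half plane, so the left contours keep a positive
distance from the axis. That suffices to separate them from the right contours, which have positive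
real part. -/
theorem exists_left_re_le (k : {k : ℤ // k.natAbs < m}) :
    ∃ δ > 0, ∀ s, C.profile (true, k) s ≤ -δ := by
  obtain ⟨θ₁, h1, θ₂, h2, ht, hb⟩ := (hC.ends k).1
  have hcos : ∀ θ ∈ Set.Ioo (Real.pi / 2) (5 * Real.pi / 6), Real.cos θ < 0 := fun θ hθ =>
    Real.cos_neg_of_pi_div_two_lt_of_lt hθ.1 (by linarith [hθ.2, Real.pi_pos])
  refine exists_re_le_of_tails (hC.continuous_profile _) ht hb (hcos _ h1) (hcos _ h2) fun s => ?_
  have := (hC.halfPlanes k k.2 s).1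
  simp only [profile, if_true]
  linarith

/-- Contours on opposite sides are separated by the gap between the left one and the axis; contours
on the same side are translates of one Lipschitz graph by different amounts. -/
theorem separated_aux {q q' : Label m} (h : q ≠ q') :
    ∃ δ > 0, ∀ s t, δ ≤ ‖C.curve q s - C.curve q' t‖ := by
  have hLR : ∀ k l : {k : ℤ // k.natAbs < m},
      ∃ δ > 0, ∀ s t, δ ≤ ‖C.curve (true, k) s - C.curve (false, l) t‖ := fun k l => by
    obtain ⟨δ, hδ, h⟩ := hC.exists_left_re_le k
    refine ⟨δ, hδ, fun s t => ?_⟩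
    have h1 := Complex.abs_re_le_norm (C.curve (true, k) s - C.curve (false, l) t)
    have h2 := (hC.halfPlanes l l.2 t).2
    have h3 := h s
    have h4 : (C.curve (true, k) s - C.curve (false, l) t).re =
      C.profile (true, k) s - (C.aR l + C.φR t) := rfl
    rw [h4] at h1
    exact le_trans (by linarith) ((neg_le_abs _).trans h1)
  obtain ⟨b, k⟩ := q
  obtain ⟨b', l⟩ := q'
  cases b <;> cases b'
  · have hkl : (k : ℤ) ≠ l := fun h' => h (by rw [Subtype.ext h'])
    have hne : C.aR k ≠ C.aR l := by
      rcases lt_or_gt_of_ne hkl with h' | h'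
      · exact (hC.order k l k.2 l.2 h').2.ne'
      · exact (hC.order l k l.2 k.2 h').2.ne
    obtain ⟨κ, hκ⟩ := hC.lipR
    exact ⟨|C.aR k - C.aR l| / (1 + κ), div_pos (abs_pos.2 (sub_ne_zero.2 hne)) (by positivity),
      fun s t => le_dist_graphCurve_of_translate hκ _ _ s t⟩
  · obtain ⟨δ, hδ, h⟩ := hLR l k
    exact ⟨δ, hδ, fun s t => by
      rw [norm_sub_rev]
      exact h t s⟩
  · exact hLR k l
  · have hkl : (k : ℤ) ≠ l := fun h' => h (by rw [Subtype.ext h'])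
    have hne : C.aL k ≠ C.aL l := by
      rcases lt_or_gt_of_ne hkl with h' | h'
      · exact (hC.order k l k.2 l.2 h').1.ne'
      · exact (hC.order l k l.2 k.2 h').1.ne
    obtain ⟨κ, hκ⟩ := hC.lipL
    refine ⟨|-C.aL k - -C.aL l| / (1 + κ), div_pos (abs_pos.2 ?_) (by positivity),
      fun s t => (le_dist_graphCurve_of_translate (φ := fun s => -C.φL s) hκ.neg
        (-C.aL k) (-C.aL l) s t).trans (le_of_eq ?_)⟩
    · rw [sub_ne_zero]
      exact fun h' => hne (neg_injective h')
    · congr 2 <;> simp [curve, profile, graphCurve] <;> ring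

theorem exists_separated : ∃ r > 0, ∀ q q' : Label m, q ≠ q' →
    ∀ s t, 5 * r ≤ ‖C.curve q s - C.curve q' t‖ := by
  choose δ hδ h using fun x : {x : Label m × Label m // x.1 ≠ x.2} => hC.separated_aux x.2
  obtain ⟨r, hr, hle⟩ := exists_pos_forall_le hδ
  refine ⟨r / 5, by positivity, fun q q' hq s t => ?_⟩
  have := h ⟨(q, q'), hq⟩ s t
  have := hle ⟨(q, q'), hq⟩
  linarith

theorem eq_of_curve_eq {q q' : Label m} {s t : ℝ} (h : C.curve q s = C.curve q' t) : q = q' := by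
  by_contra hq
  obtain ⟨r, hr, hsep⟩ := hC.exists_separated
  have := hsep q q' hq s t
  rw [h, sub_self, norm_zero] at this
  linarith

theorem disjoint_range {q q' : Label m} (h : q ≠ q') :
    Disjoint (Set.range (graphCurve (C.profile q))) (Set.range (graphCurve (C.profile q'))) := by
  rw [Set.disjoint_left]
  rintro _ ⟨s, rfl⟩ ⟨t, ht⟩
  exact h (hC.eq_of_curve_eq ht).symm

end IsAdmissible

/-- The labels j - 1 and -(j - 1) are those of absolute value j - 1; for j = 1 they coincide and
there is a single contour. -/
theorem mem_gamma_iff {b : Bool} {j : ℕ} (hj : j ∈ Finset.Icc 1 m) {z : ℂ} :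
    z ∈ C.gamma b j ↔ ∃ q : Label m, q.1 = b ∧ (q.2 : ℤ).natAbs + 1 = j ∧ ∃ s, C.curve q s = z := by
  rw [Finset.mem_Icc] at hj
  have key : ∀ γ : ℤ → ℝ → ℂ, z ∈ Set.range (γ ((j : ℤ) - 1)) ∪ Set.range (γ (-((j : ℤ) - 1))) ↔
      ∃ k : {k : ℤ // k.natAbs < m}, (k : ℤ).natAbs + 1 = j ∧ ∃ s, γ k s = z := fun γ => by
    constructor
    · rintro (⟨s, hs⟩ | ⟨s, hs⟩)
      · exact ⟨⟨(j : ℤ) - 1, by omega⟩, by simp only; omega, s, hs⟩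
      · exact ⟨⟨-((j : ℤ) - 1), by omega⟩, by simp only; omega, s, hs⟩
    · rintro ⟨⟨k, hk⟩, h, s, hs⟩
      simp only at h hs
      rcases (by omega : k = (j : ℤ) - 1 ∨ k = -((j : ℤ) - 1)) with rfl | rfl
      · exact Or.inl ⟨s, hs⟩
      · exact Or.inr ⟨s, hs⟩
  cases b
  · refine (key C.rightCurve).trans ⟨?_, ?_⟩
    · rintro ⟨k, hk, s, hs⟩
      exact ⟨(false, k), rfl, hk, s, hs⟩
    · rintro ⟨⟨b, k⟩, rfl, hk, s, hs⟩
      exact ⟨k, hk, s, hs⟩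
  · refine (key C.leftCurve).trans ⟨?_, ?_⟩
    · rintro ⟨k, hk, s, hs⟩
      exact ⟨(true, k), rfl, hk, s, hs⟩
    · rintro ⟨⟨b, k⟩, rfl, hk, s, hs⟩
      exact ⟨k, hk, s, hs⟩

/-- The index `j` of the set `Γ_j` to which a contour belongs. -/
def level (q : Label m) : ℕ := (q.2 : ℤ).natAbs + 1

theorem level_mem (q : Label m) : level q ∈ Finset.Icc 1 m := by
  have := q.2.2
  rw [Finset.mem_Icc, level]
  omega

theorem curve_mem_gamma (q : Label m) (s : ℝ) : C.curve q s ∈ C.gamma q.1 (level q) :=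
  (mem_gamma_iff (level_mem q)).2 ⟨q, rfl, rfl, s, rfl⟩

namespace IsAdmissible

variable (hC : C.IsAdmissible m)
include hC

theorem measurableSet_range (q : Label m) : MeasurableSet (Set.range (C.curve q)) :=
  (isClosed_range_graphCurve (hC.continuous_profile q)).measurableSet

theorem measurableSet_gamma (b : Bool) {j : ℕ} (hj : j ∈ Finset.Icc 1 m) :
    MeasurableSet (C.gamma b j) := by
  have : C.gamma b j = ⋃ q : {q : Label m // q.1 = b ∧ (q.2 : ℤ).natAbs + 1 = j},
      Set.range (C.curve q.1) := by
    ext z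
    rw [mem_gamma_iff hj, Set.mem_iUnion]
    constructor
    · rintro ⟨q, h1, h2, h3⟩
      exact ⟨⟨q, h1, h2⟩, h3⟩
    · rintro ⟨⟨q, h1, h2⟩, h3⟩
      exact ⟨q, h1, h2, h3⟩
  rw [this]
  exact MeasurableSet.iUnion fun q => hC.measurableSet_range q.1

theorem disjoint_gamma {b b' : Bool} {i j : ℕ} (hi : i ∈ Finset.Icc 1 m) (hj : j ∈ Finset.Icc 1 m)
    (h : i = j → b ≠ b') : Disjoint (C.gamma b i) (C.gamma b' j) := by
  rw [Set.disjoint_left]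
  intro z hz hz'
  rw [mem_gamma_iff hi] at hz
  rw [mem_gamma_iff hj] at hz'
  obtain ⟨q, rfl, rfl, s, rfl⟩ := hz
  obtain ⟨q', rfl, rfl, t, ht⟩ := hz'
  have := hC.eq_of_curve_eq ht
  subst this
  exact h rfl rfl

theorem hasCells (ζ : Fin (m - 1) → ℂ) : (kpzData ζ C).HasCells m := by
  have e1 : ∀ j, (kpzData ζ C).set1 j = C.gamma (decide (Odd j)) j := set1_eq
  have e2 : ∀ j, (kpzData ζ C).set2 j = C.gamma (!decide (Odd j)) j := set2_eq
  refine ⟨fun j hj => ?_, fun j hj => ?_, fun i hi j hj hij => ?_, fun i hi j hj hij => ?_,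
    fun i hi j hj => ?_, ?_⟩
  · rw [e1]
    exact hC.measurableSet_gamma _ hj
  · rw [e2]
    exact hC.measurableSet_gamma _ hj
  · rw [e1, e1]
    exact hC.disjoint_gamma hi hj fun h => absurd h hij
  · rw [e2, e2]
    exact hC.disjoint_gamma hi hj fun h => absurd h hij
  · rw [e1, e2]
    refine hC.disjoint_gamma hi hj fun h => ?_
    rw [h]
    cases decide (Odd j) <;> simp
  · have : (kpzData ζ C).Ω.carrier = ⋃ q : Label m, Set.range (graphCurve (C.profile q)) := by
      rw [← carrier_graphSet, ← omega_eq]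
      rfl
    rw [this, Set.iUnion_subset_iff]
    rintro q _ ⟨s, rfl⟩
    refine Set.mem_iUnion₂.2 ⟨level q, level_mem q, ?_⟩
    rw [e1, e2]
    have h := curve_mem_gamma (C := C) q s
    by_cases h' : decide (Odd (level q)) = q.1
    · rw [h']
      exact Or.inl h
    · have : (!decide (Odd (level q))) = q.1 := by
        revert h'
        cases decide (Odd (level q)) <;> cases q.1 <;> simp
      rw [this]
      exact Or.inr h

theorem curve_mem_range_iff (q q' : Label m) (s : ℝ) :
    C.curve q s ∈ Set.range (C.curve q') ↔ q' = q :=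
  ⟨fun ⟨_, ht⟩ => hC.eq_of_curve_eq ht, fun h => by
    rw [h]
    exact ⟨s, rfl⟩⟩

theorem curve_mem_gamma_iff (q : Label m) (s : ℝ) (b : Bool) {j : ℕ} (hj : j ∈ Finset.Icc 1 m) :
    C.curve q s ∈ C.gamma b j ↔ q.1 = b ∧ level q = j := by
  constructor
  · intro h
    obtain ⟨q', rfl, rfl, t, ht⟩ := (mem_gamma_iff hj).1 h
    rw [hC.eq_of_curve_eq ht]
    exact ⟨rfl, rfl⟩
  · rintro ⟨rfl, rfl⟩
    exact curve_mem_gamma q s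

end IsAdmissible

end ContourSystem

end KPZ

/-! ### The KPZ fixed point: decay, square summable families, admissibility. -/

namespace KPZ

namespace ContourSystem

variable {C : ContourSystem} {m : ℕ}

/-- The sign of a side: `1` on the left and `-1` on the right. -/
def sideSign (b : Bool) : ℝ := if b then 1 else -1

/-- The angles at which the contours end are such that the functions `f, g` decay. -/
def Decays (C : ContourSystem) (p : CubicParams m) : Prop :=
  ∀ q : Label m, ∃ θ₁ θ₂, Tendsto (fun s => (C.curve q s).arg) atTop (𝓝 θ₂) ∧
    Tendsto (fun s => (C.curve q s).arg) atBot (𝓝 (-θ₁)) ∧ ∀ j ∈ Finset.Icc 1 m,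
      DecayAngle (sideSign q.1 * (p.coeffT j - p.coeffT (j - 1)))
        (sideSign q.1 * (p.coeffY j - p.coeffY (j - 1))) θ₁ ∧
      DecayAngle (sideSign q.1 * (p.coeffT j - p.coeffT (j - 1)))
        (sideSign q.1 * (p.coeffY j - p.coeffY (j - 1))) θ₂

namespace IsAdmissible

variable (hC : C.IsAdmissible m) (ζ : Fin (m - 1) → ℂ) {p : CubicParams m}
include hC

theorem exists_side (q : Label m) :
    (decide (Odd (level q)) = q.1 ∧ ∀ s, C.curve q s ∈ (kpzData ζ C).set1 (level q)) ∨
      (decide (Odd (level q)) = !q.1 ∧ ∀ s, C.curve q s ∈ (kpzData ζ C).set2 (level q)) := by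
  have e1 : ∀ j, (kpzData ζ C).set1 j = C.gamma (decide (Odd j)) j := set1_eq
  have e2 : ∀ j, (kpzData ζ C).set2 j = C.gamma (!decide (Odd j)) j := set2_eq
  have h := fun s => curve_mem_gamma (C := C) q s
  by_cases h' : decide (Odd (level q)) = q.1
  · left
    rw [e1, h']
    exact ⟨rfl, h⟩
  · right
    have h2 : decide (Odd (level q)) = !q.1 := by
      revert h'
      cases decide (Odd (level q)) <;> cases q.1 <;> simp
    rw [e2, h2, Bool.not_not]
    exact ⟨rfl, h⟩

/-- The parity of the level enters twice, in the choice between `Ω₁` and `Ω₂` and in the order of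
the odd and even members of {j-1, j}. The two effects cancel, and only the side of the contour
remains, as a sign. -/
theorem halfExp_curve (q : Label m) (s : ℝ) : (kpzData ζ C).halfExp p (C.curve q s) =
    Complex.exp (sideSign q.1 * (p.expo (level q) (C.curve q s) -
      p.expo (level q - 1) (C.curve q s)) / 2) := by
  rw [KernelData.halfExp, KernelData.halfExpo]
  congr 1
  rcases hC.exists_side ζ q with ⟨h, hs⟩ | ⟨h, hs⟩
  · rw [(hC.hasCells ζ).glue1 (level_mem q) (hs s), oddOf, evenOf]
    by_cases ho : Odd (level q)
    · simp [← h, ho, sideSign]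
    · simp [← h, ho, sideSign]
  · rw [(hC.hasCells ζ).glue2 (level_mem q) (hs s), oddOf, evenOf]
    have hq : q.1 = !decide (Odd (level q)) := by rw [h, Bool.not_not]
    rw [hq]
    by_cases ho : Odd (level q)
    · simp [ho, sideSign]
    · simp [ho, sideSign]

theorem exists_halfExp_le (hp : C.Decays p) (q : Label m) :
    ∃ c, ∀ s, ‖(kpzData ζ C).halfExp p (C.curve q s)‖ ≤ c * Real.exp (-|s|) := by
  obtain ⟨θ₁, θ₂, ht, hb, h⟩ := hp q
  obtain ⟨h1, h2⟩ := h _ (level_mem q)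
  obtain ⟨c, hc⟩ := exists_exp_cubic_le (d := sideSign q.1 * (p.coeffX (level q) -
    p.coeffX (level q - 1))) (hC.continuous_profile q) ht hb h1 h2
  refine ⟨c, fun s => le_trans (le_of_eq ?_) (hc s)⟩
  rw [hC.halfExp_curve, p.expo_eq, p.expo_eq, curve]
  congr 2
  push_cast
  ring

theorem chi_curve (q : Label m) (b : Bool) {j : ℕ} (hj : j ∈ Finset.Icc 1 m) (s : ℝ) :
    chi (C.gamma b j) (C.curve q s) = chi (C.gamma b j) (C.curve q 0) := by
  by_cases h : q.1 = b ∧ level q = j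
  · rw [KernelData.chi_of_mem ((hC.curve_mem_gamma_iff q s b hj).2 h),
      KernelData.chi_of_mem ((hC.curve_mem_gamma_iff q 0 b hj).2 h)]
  · rw [KernelData.chi_of_notMem fun h' => h ((hC.curve_mem_gamma_iff q s b hj).1 h'),
      KernelData.chi_of_notMem fun h' => h ((hC.curve_mem_gamma_iff q 0 b hj).1 h')]

/-- `B` sees a point only through the contour that contains it; hence `F` and `G` are constant on
contours, as strong integrability demands. -/
theorem kpzB_curve (q : Label m) {j : ℕ} (hj : j ∈ Finset.Icc 1 m) (s : ℝ) :
    (kpzData ζ C).B j (C.curve q s) = (kpzData ζ C).B j (C.curve q 0) := by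
  have hk : ((j : ℤ) - 1).natAbs < m := by
    rw [Finset.mem_Icc] at hj
    omega
  have h1 := fun s => hC.curve_mem_range_iff q (true, ⟨(j : ℤ) - 1, hk⟩) s
  have h2 := fun s => hC.curve_mem_range_iff q (false, ⟨(j : ℤ) - 1, hk⟩) s
  simp only [curve_true, curve_false] at h1 h2
  simp only [kpzData, kpzQ, kpzP, set1_eq, set2_eq, hC.chi_curve q _ hj s, Set.mem_union, h1, h2]

theorem measurable_kpzB {j : ℕ} (hj : j ∈ Finset.Icc 1 m) :
    Measurable ((kpzData ζ C).B j) := by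
  have hk : ((j : ℤ) - 1).natAbs < m := by
    rw [Finset.mem_Icc] at hj
    omega
  have h1 : Measurable (chi (C.set1 j)) := measurable_chi ((hC.hasCells ζ).meas1 j hj)
  have h2 : Measurable (chi (C.set2 j)) := measurable_chi ((hC.hasCells ζ).meas2 j hj)
  have h3 : MeasurableSet (Set.range (C.leftCurve ((j : ℤ) - 1)) ∪
      Set.range (C.rightCurve ((j : ℤ) - 1))) :=
    (hC.measurableSet_range (true, ⟨(j : ℤ) - 1, hk⟩)).union
      (hC.measurableSet_range (false, ⟨(j : ℤ) - 1, hk⟩))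
  refine Measurable.mul ?_ ?_
  · unfold kpzQ
    split_ifs
    · exact (h1.const_mul _).add (h2.const_mul _)
    · exact (h1.const_mul _).add (h2.const_mul _)
  · unfold kpzP
    split_ifs
    · exact measurable_const
    · exact Measurable.ite h3 measurable_const measurable_const

theorem F_curve (q : Label m) (s : ℝ) :
    ((kpzData ζ C).family m).F (C.curve q s) = ((kpzData ζ C).family m).F (C.curve q 0) := by
  ext n
  rw [KernelData.family_F, KernelData.family_F]
  rcases hC.exists_side ζ q with ⟨-, hs⟩ | ⟨-, hs⟩
  · rw [(hC.hasCells ζ).glue1 (level_mem q) (hs s), (hC.hasCells ζ).glue1 (level_mem q) (hs 0)]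
    rfl
  · rw [(hC.hasCells ζ).glue2 (level_mem q) (hs s), (hC.hasCells ζ).glue2 (level_mem q) (hs 0)]
    rfl

theorem G_curve (q : Label m) (s : ℝ) :
    ((kpzData ζ C).family m).G (C.curve q s) = ((kpzData ζ C).family m).G (C.curve q 0) := by
  ext n
  rw [KernelData.family_G, KernelData.family_G]
  rcases hC.exists_side ζ q with ⟨-, hs⟩ | ⟨-, hs⟩
  · rw [(hC.hasCells ζ).glue1 (level_mem q) (hs s), (hC.hasCells ζ).glue1 (level_mem q) (hs 0),
      hC.kpzB_curve ζ q (level_mem q)]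
  · rw [(hC.hasCells ζ).glue2 (level_mem q) (hs s), (hC.hasCells ζ).glue2 (level_mem q) (hs 0),
      hC.kpzB_curve ζ q (level_mem q)]

theorem exists_curve_of_ne_zero {a b : ℕ → ℂ} {z : ℂ} (h : (kpzData ζ C).glue m a b z ≠ 0) :
    ∃ q : Label m, ∃ s, C.curve q s = z := by
  have e1 : ∀ j, (kpzData ζ C).set1 j = C.gamma (decide (Odd j)) j := set1_eq
  have e2 : ∀ j, (kpzData ζ C).set2 j = C.gamma (!decide (Odd j)) j := set2_eq
  rcases (kpzData ζ C).cases_cell m z with ⟨i, hi, hz⟩ | ⟨i, hi, hz⟩ | hz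
  · rw [e1, mem_gamma_iff hi] at hz
    obtain ⟨q, -, -, hs⟩ := hz
    exact ⟨q, hs⟩
  · rw [e2, mem_gamma_iff hi] at hz
    obtain ⟨q, -, -, hs⟩ := hz
    exact ⟨q, hs⟩
  · exact absurd (KernelData.glue0 hz a b) h

theorem absMeasure_eq : (kpzData ζ C).Ω.absMeasure = (graphSet (C.profile (m := m))).absMeasure := by
  rw [← omega_eq]
  rfl

theorem sigmaFinite : SigmaFinite (kpzData ζ C).Ω.absMeasure := by
  rw [absMeasure_eq hC]
  exact sigmaFinite_graphSet hC.lip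

theorem phaseRegular : (kpzData ζ C).Ω.PhaseRegular := by
  have : (kpzData ζ C).Ω = graphSet (C.profile (m := m)) := omega_eq
  rw [this]
  exact phaseRegular_graphSet hC.lip fun _ _ => hC.disjoint_range

theorem isValid : (kpzData ζ C).Ω.IsValid := by
  have : (kpzData ζ C).Ω = graphSet (C.profile (m := m)) := omega_eq
  rw [this]
  exact isValid_graphSet hC.lip fun _ _ => hC.disjoint_range

theorem exists_decay (hp : C.Decays p) {V : ℂ → Fin (m + 1) → ℂ}
    (hV : ∀ q s, V (C.curve (m := m) q s) = V (C.curve q 0)) (n : Fin (m + 1)) (q : Label m) :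
    ∃ c, ∀ s, ‖(kpzData ζ C).halfExp p (C.curve q s) * V (C.curve q s) n‖ ≤
      c * Real.exp (-|s|) := by
  obtain ⟨c, hc⟩ := hC.exists_halfExp_le ζ hp q
  refine ⟨c * ‖V (C.curve q 0) n‖, fun s => ?_⟩
  rw [norm_mul, hV q s, mul_right_comm]
  exact mul_le_mul_of_nonneg_right (hc s) (norm_nonneg _)

theorem memLp_of_decay (hp : C.Decays p) {V : ℂ → Fin (m + 1) → ℂ}
    (hV : ∀ q s, V (C.curve (m := m) q s) = V (C.curve q 0)) (n : Fin (m + 1))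
    (hm : Measurable fun z => V z n) :
    MemLp (fun z => (kpzData ζ C).halfExp p z * V z n) 2 (kpzData ζ C).Ω.absMeasure ∧
      MemLp (fun z => (kpzData ζ C).halfExp p z * V z n) ⊤ (kpzData ζ C).Ω.absMeasure ∧
      MemLp (fun z => ((1 + ‖z‖ : ℝ) : ℂ) ^ 4 * ((kpzData ζ C).halfExp p z * V z n)) 2
        (kpzData ζ C).Ω.absMeasure := by
  rw [absMeasure_eq hC]
  have hmeas : Measurable fun z => (kpzData ζ C).halfExp p z * V z n :=
    (hC.hasCells ζ).measurable_halfExp.mul hm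
  have h0 := hC.exists_decay ζ hp hV n
  have h1 := memLp_graphSet hC.lip hmeas fun q => by
    obtain ⟨c, hc⟩ := h0 q
    have hc0 : 0 ≤ c := by simpa using (norm_nonneg _).trans (hc 0)
    refine ⟨c, fun s => (hc s).trans (mul_le_mul_of_nonneg_left ?_ hc0)⟩
    rw [Real.exp_le_exp]
    linarith [abs_nonneg s]
  refine ⟨h1.1, h1.2, (memLp_graphSet hC.lip ?_ fun q => exists_weight_mul_le
    (F := fun z => (kpzData ζ C).halfExp p z * V z n) (hC.lip q) (h0 q)).1⟩
  exact (by fun_prop : Measurable fun z : ℂ => ((1 + ‖z‖ : ℝ) : ℂ) ^ 4).mul hmeas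

theorem isPiecewiseConstant : ((kpzData ζ C).family m).IsPiecewiseConstant := by
  change ∀ q : Label m, _
  intro q
  refine ⟨((kpzData ζ C).family m).F (C.curve q 0), ((kpzData ζ C).family m).G (C.curve q 0),
    fun u hu => ?_⟩
  obtain ⟨s, -, rfl⟩ := hu
  obtain ⟨b, k⟩ := q
  cases b
  · exact ⟨hC.F_curve ζ (false, k) s, hC.G_curve ζ (false, k) s⟩
  · exact ⟨hC.F_curve ζ (true, k) s, hC.G_curve ζ (true, k) s⟩

theorem memLp_f (hp : C.Decays p) (n : Fin (m + 1)) :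
    MemLp (fun z => ((kpzData ζ C).family m).f p z n) 2 (kpzData ζ C).Ω.absMeasure ∧
      MemLp (fun z => ((kpzData ζ C).family m).f p z n) ⊤ (kpzData ζ C).Ω.absMeasure ∧
      MemLp (fun z => ((1 + ‖z‖ : ℝ) : ℂ) ^ 4 * ((kpzData ζ C).family m).f p z n) 2
        (kpzData ζ C).Ω.absMeasure := by
  simp only [(hC.hasCells ζ).f_eq]
  exact hC.memLp_of_decay ζ hp (hC.F_curve ζ) n
    ((hC.hasCells ζ).measurable_F (fun _ _ => measurable_const) n)

theorem memLp_g (hp : C.Decays p) (n : Fin (m + 1)) :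
    MemLp (fun z => ((kpzData ζ C).family m).g p z n) 2 (kpzData ζ C).Ω.absMeasure ∧
      MemLp (fun z => ((kpzData ζ C).family m).g p z n) ⊤ (kpzData ζ C).Ω.absMeasure := by
  simp only [(hC.hasCells ζ).g_eq]
  have h := hC.memLp_of_decay ζ hp (hC.G_curve ζ) n
    ((hC.hasCells ζ).measurable_G (fun j hj => hC.measurable_kpzB ζ hj) n)
  exact ⟨h.1, h.2.1⟩

/-- The kernel of the integrable operator is given by square summable families. -/
theorem exists_sqFamily (hp : C.Decays p) : ∃ φ ψ : Fin (m + 1) × ((ℤ × ℤ) × ℕ) → ℂ → ℂ,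
    SqFamily (kpzData ζ C).Ω.absMeasure φ ∧ SqFamily (kpzData ζ C).Ω.absMeasure ψ ∧
      ∀ u v, ((kpzData ζ C).family m).kernel p u v = ∑' n, φ n u * ψ n v := by
  have hK := hC.hasCells ζ
  have := hC.sigmaFinite ζ
  have hf := hC.memLp_f ζ hp
  have hg := hC.memLp_g ζ hp
  obtain ⟨r, hr, hsep⟩ := hC.exists_separated
  obtain ⟨φ, ψ, hφ, hψ, hsum⟩ := exists_sqFamily_cauchy hr
    (f := fun n z => ((kpzData ζ C).family m).f p z n)
    (g := fun n z => ((kpzData ζ C).family m).g p z n)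
    (fun n => (hf n).1.1) (fun n => (hf n).2.2) (fun n => (hg n).1) (by
      intro n u v hu hv
      simp only [hK.f_eq] at hu
      simp only [hK.g_eq] at hv
      have hu := right_ne_zero_of_mul hu
      have hv := right_ne_zero_of_mul hv
      have hu' := hu
      have hv' := hv
      rw [KernelData.family_F] at hu'
      rw [KernelData.family_G] at hv'
      obtain ⟨q, s, rfl⟩ := hC.exists_curve_of_ne_zero ζ hu'
      obtain ⟨q', t, rfl⟩ := hC.exists_curve_of_ne_zero ζ hv'
      -- On one contour `F` and `G` are constants with F_n G_n = 0. If both are nonzero in component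
      -- n, the two points lie on different contours, which are separated.
      refine hsep q q' (fun h => ?_) s t
      subst h
      rw [hC.F_curve] at hu
      rw [hC.G_curve] at hv
      exact mul_ne_zero hu hv (hK.orthogonal _ n))
  refine ⟨φ, ψ, hφ, hψ, fun u v => ?_⟩
  rw [← hsum, CubicFamily.kernel]
  split_ifs with h
  · rw [h, sub_self, div_zero]
  · rfl

/-- The determinant of the KPZ fixed point is strongly cubic admissible. -/
theorem fredholm (hp : C.Decays p) : (kpzData ζ C).WellDefined m p ∧
    ((kpzData ζ C).family m).IsCubicIntegrable p ∧ IsTraceClass (((kpzData ζ C).family m).operator p) ∧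
      HasFredholmDet (((kpzData ζ C).family m).operator p) ((kpzData ζ C).det m p) := by
  have hK := hC.hasCells ζ
  have := hC.sigmaFinite ζ
  obtain ⟨φ, ψ, hφ, hψ, hH⟩ := hC.exists_sqFamily ζ hp
  obtain ⟨h1, h2, h3, h4⟩ := hK.fredholm (hC.phaseRegular ζ) hφ hψ hH
  exact ⟨h1, ⟨hC.isValid ζ, fun u _ i => hK.orthogonal u i, fun u hu => hK.c_ne_zero hu,
    fun i => (hC.memLp_f ζ hp i).1, fun i => (hC.memLp_f ζ hp i).2.1,
    fun i => (hC.memLp_g ζ hp i).1, fun i => (hC.memLp_g ζ hp i).2, h2⟩, h3, h4⟩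

/-- On the left, cos 3θ > 0 for π/2 < θ < 5π/6 and cos 2θ < 0 for π/2 < θ < 3π/4. On the right, cos
3θ < 0 for π/6 < θ < π/2 and cos 2θ > 0 for π/6 < θ < π/4. After multiplication by the sign of the
side, a decreasing t gives decay through the cubic term; if t is stationary, an increasing y gives
it through the quadratic term, but only in the smaller sectors. -/
theorem decays_aux (hd : ∀ j ∈ Finset.Icc 1 m, p.coeffT j - p.coeffT (j - 1) < 0 ∨
      (p.coeffT j - p.coeffT (j - 1) = 0 ∧ 0 < p.coeffY j - p.coeffY (j - 1) ∧
        C.EndsIn (3 * Real.pi / 4) (Real.pi / 4))) : C.Decays p := by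
  have hpi := Real.pi_pos
  -- One pair of end angles has to serve all levels. It is taken from the smaller sectors if these
  -- are available; otherwise no level has stationary t.
  by_cases hE : C.EndsIn (3 * Real.pi / 4) (Real.pi / 4)
  · rintro ⟨b, k⟩
    cases b
    · obtain ⟨θ₁, h1, θ₂, h2, ht, hb⟩ := (hE k).2
      have key : ∀ θ ∈ Set.Ioo (Real.pi / 6) (Real.pi / 4), ∀ j ∈ Finset.Icc 1 m,
          DecayAngle (sideSign false * (p.coeffT j - p.coeffT (j - 1)))
            (sideSign false * (p.coeffY j - p.coeffY (j - 1))) θ := fun θ hθ j hj => by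
        have c3 : Real.cos (3 * θ) < 0 :=
          Real.cos_neg_of_pi_div_two_lt_of_lt (by linarith [hθ.1]) (by linarith [hθ.2])
        have c2 : 0 < Real.cos (2 * θ) :=
          Real.cos_pos_of_mem_Ioo ⟨by linarith [hθ.1], by linarith [hθ.2]⟩
        simp only [sideSign, DecayAngle]
        rcases hd j hj with h | ⟨h, h', -⟩
        · left
          simp only [Bool.false_eq_true, if_false]
          nlinarith
        · right
          simp only [Bool.false_eq_true, if_false, h]
          constructor <;> nlinarith
      exact ⟨θ₁, θ₂, ht, hb, fun j hj => ⟨key _ h1 j hj, key _ h2 j hj⟩⟩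
    · obtain ⟨θ₁, h1, θ₂, h2, ht, hb⟩ := (hE k).1
      have key : ∀ θ ∈ Set.Ioo (Real.pi / 2) (3 * Real.pi / 4), ∀ j ∈ Finset.Icc 1 m,
          DecayAngle (sideSign true * (p.coeffT j - p.coeffT (j - 1)))
            (sideSign true * (p.coeffY j - p.coeffY (j - 1))) θ := fun θ hθ j hj => by
        have c3 : 0 < Real.cos (3 * θ) := by
          rw [← Real.cos_sub_two_pi]
          exact Real.cos_pos_of_mem_Ioo ⟨by linarith [hθ.1], by linarith [hθ.2]⟩
        have c2 : Real.cos (2 * θ) < 0 :=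
          Real.cos_neg_of_pi_div_two_lt_of_lt (by linarith [hθ.1]) (by linarith [hθ.2])
        simp only [sideSign, DecayAngle]
        rcases hd j hj with h | ⟨h, h', -⟩
        · left
          simp only [if_true]
          nlinarith
        · right
          simp only [if_true, h]
          constructor <;> nlinarith
      exact ⟨θ₁, θ₂, ht, hb, fun j hj => ⟨key _ h1 j hj, key _ h2 j hj⟩⟩
  · rintro ⟨b, k⟩
    have hd' : ∀ j ∈ Finset.Icc 1 m, p.coeffT j - p.coeffT (j - 1) < 0 := fun j hj =>
      (hd j hj).resolve_right fun h => hE h.2.2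
    cases b
    · obtain ⟨θ₁, h1, θ₂, h2, ht, hb⟩ := (hC.ends k).2
      have key : ∀ θ ∈ Set.Ioo (Real.pi / 6) (Real.pi / 2), ∀ j ∈ Finset.Icc 1 m,
          DecayAngle (sideSign false * (p.coeffT j - p.coeffT (j - 1)))
            (sideSign false * (p.coeffY j - p.coeffY (j - 1))) θ := fun θ hθ j hj => by
        have c3 : Real.cos (3 * θ) < 0 :=
          Real.cos_neg_of_pi_div_two_lt_of_lt (by linarith [hθ.1]) (by linarith [hθ.2])
        have h := hd' j hj
        left
        simp only [sideSign, Bool.false_eq_true, if_false]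
        nlinarith
      exact ⟨θ₁, θ₂, ht, hb, fun j hj => ⟨key _ h1 j hj, key _ h2 j hj⟩⟩
    · obtain ⟨θ₁, h1, θ₂, h2, ht, hb⟩ := (hC.ends k).1
      have key : ∀ θ ∈ Set.Ioo (Real.pi / 2) (5 * Real.pi / 6), ∀ j ∈ Finset.Icc 1 m,
          DecayAngle (sideSign true * (p.coeffT j - p.coeffT (j - 1)))
            (sideSign true * (p.coeffY j - p.coeffY (j - 1))) θ := fun θ hθ j hj => by
        have c3 : 0 < Real.cos (3 * θ) := by
          rw [← Real.cos_sub_two_pi]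
          exact Real.cos_pos_of_mem_Ioo ⟨by linarith [hθ.1], by linarith [hθ.2]⟩
        have h := hd' j hj
        left
        simp only [sideSign, if_true]
        nlinarith
      exact ⟨θ₁, θ₂, ht, hb, fun j hj => ⟨key _ h1 j hj, key _ h2 j hj⟩⟩

end IsAdmissible

end ContourSystem

/-- The first level is compared with the exponent 0, so there the sign of t_1 alone decides; at the
other levels two consecutive parameters are compared. -/
theorem coeffT_diff {m : ℕ} {p : CubicParams m} {j : ℕ} (hj : j ∈ Finset.Icc 1 m) :
    (∃ i : Fin m, p.coeffT j - p.coeffT (j - 1) = p.t i ∧ (i : ℕ) + 1 = j) ∨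
      ∃ i i' : Fin m, (i : ℕ) + 1 = i' ∧ p.coeffT j - p.coeffT (j - 1) = p.t i' - p.t i ∧
        p.coeffY j - p.coeffY (j - 1) = p.y i' - p.y i ∧
        p.coeffX j - p.coeffX (j - 1) = p.x i' - p.x i := by
  rw [Finset.mem_Icc] at hj
  by_cases h : j = 1
  · subst h
    refine Or.inl ⟨⟨0, by omega⟩, ?_, rfl⟩
    simp [CubicParams.coeffT, hj.2]
  · refine Or.inr ⟨⟨j - 2, by omega⟩, ⟨j - 1, by omega⟩, ?_, ?_, ?_, ?_⟩
    · simp only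
      omega
    all_goals
      simp only [CubicParams.coeffT, CubicParams.coeffY, CubicParams.coeffX]
      rw [dif_pos hj, dif_pos (by omega)]
      congr 1

theorem ContourSystem.IsAdmissible.decays_strict {C : ContourSystem} {m : ℕ}
    (hC : C.IsAdmissible m) {p : CubicParams m} (hp : p ∈ kpzStrictRegion m) : C.Decays p := by
  refine hC.decays_aux fun j hj => Or.inl ?_
  rcases coeffT_diff (p := p) hj with ⟨i, hi, -⟩ | ⟨i, i', hii', h, -⟩
  · rw [hi]
    linarith [hp.1 i]
  · rw [h]
    linarith [hp.2 i i' hii']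

theorem ContourSystem.IsAdmissible.decays {C : ContourSystem} {m : ℕ}
    (hC : C.IsAdmissible m) (hE : C.EndsIn (3 * Real.pi / 4) (Real.pi / 4)) {p : CubicParams m}
    (hp : p ∈ kpzRegion m) : C.Decays p := by
  refine hC.decays_aux fun j hj => ?_
  rcases coeffT_diff (p := p) hj with ⟨i, hi, -⟩ | ⟨i, i', hii', h, hy, -⟩
  · rw [hi]
    exact Or.inl (by linarith [hp.1 i])
  · rw [h, hy]
    obtain ⟨h1, h2⟩ := hp.2 i i' hii'
    rcases h1.lt_or_eq with h3 | h3
    · exact Or.inl (by linarith)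
    · exact Or.inr ⟨by linarith, by linarith [h2 h3], hE⟩

theorem kpzParams_self {m : ℕ} (p : CubicParams m) :
    kpzParams p.x p.y (fun i => -3 * p.t i) = p := by
  obtain ⟨x, y, t⟩ := p
  simp only [kpzParams]
  congr 1
  ext i
  ring

theorem kpzDet_eq {m : ℕ} (ζ : Fin (m - 1) → ℂ) (C : ContourSystem) (p : CubicParams m) :
    kpzDet ζ C p.x p.y (fun i => -3 * p.t i) = (kpzData ζ C).det m p := by
  rw [kpzDet, kpzParams_self]

end KPZ

/-! ### Discrete sets and kernels dominated by summable functions. -/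

namespace KPZ

section Discrete

theorem countable_of_summable {S : Set ℂ} {b : ℂ → ℝ} (hb : ∀ z ∈ S, 0 < b z)
    (hs : Summable fun z : S => b z) : S.Countable := by
  have h := hs.countable_support
  have h1 : Function.support (fun z : S => b z) = Set.univ :=
    Set.eq_univ_of_forall fun z => (hb z z.2).ne'
  rw [h1, Set.countable_univ_iff] at h
  exact h

/-- A summable function that is bounded below on the bounded parts of S allows only finitely many
points of S in each ball. -/
theorem not_accPt_of_summable {S : Set ℂ} {b : ℂ → ℝ}
    (hb : ∀ R : ℝ, ∃ ε > 0, ∀ z ∈ S, ‖z‖ ≤ R → ε ≤ b z)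
    (hs : Summable fun z : S => b z) (z : ℂ) : ¬ AccPt z (𝓟 S) := by
  rw [accPt_iff_frequently, not_frequently]
  obtain ⟨ε, hε, hR⟩ := hb (‖z‖ + 1)
  have hfin : {w : S | ¬ b w < ε}.Finite := by
    have h := hs.tendsto_cofinite_zero.eventually (gt_mem_nhds hε)
    exact h
  have hfin' : ((fun w : S => (w : ℂ)) '' {w : S | ¬ b w < ε} \ {z}).Finite :=
    (hfin.image _).subset Set.sdiff_subset
  have hn : ((fun w : S => (w : ℂ)) '' {w : S | ¬ b w < ε} \ {z})ᶜ ∈ 𝓝 z :=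
    hfin'.isClosed.isOpen_compl.mem_nhds fun h => h.2 rfl
  filter_upwards [hn, Metric.ball_mem_nhds z one_pos] with w hw hwz h
  refine hw ⟨⟨⟨w, h.2⟩, not_lt.2 (hR w h.2 ?_), rfl⟩, h.1⟩
  have h1 : ‖w - z‖ < 1 := by
    rw [← dist_eq_norm]
    exact hwz
  have h2 := norm_sub_norm_le w z
  linarith

variable {S : Set ℂ} (hS : S.Countable)
include hS

theorem sigmaFinite_discrete : SigmaFinite (SpectralSet.discrete S).absMeasure := by
  have : SigmaFinite (Measure.count.restrict S : Measure ℂ) := by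
    refine Measure.sigmaFinite_of_countable (S := insert Sᶜ ((fun z => ({z} : Set ℂ)) '' S))
      ((hS.image _).insert _) ?_ ?_
    · rintro _ (rfl | ⟨z, -, rfl⟩)
      · rw [Measure.restrict_apply' hS.measurableSet, Set.compl_inter_self, measure_empty]
        exact ENNReal.zero_lt_top
      · refine (Measure.restrict_apply_le _ _).trans_lt ?_
        simp
    · refine Set.eq_univ_of_forall fun z => ?_
      by_cases hz : z ∈ S
      · exact ⟨{z}, Or.inr ⟨z, hz, rfl⟩, rfl⟩
      · exact ⟨Sᶜ, Or.inl rfl, hz⟩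
  exact this

theorem ae_discrete {P : ℂ → Prop} (h : ∀ z ∈ S, P z) :
    ∀ᵐ z ∂(SpectralSet.discrete S).absMeasure, P z :=
  (ae_restrict_iff' hS.measurableSet).2 (ae_of_all _ h)

theorem aestronglyMeasurable_discrete (F : ℂ → ℂ) :
    AEStronglyMeasurable F (SpectralSet.discrete S).absMeasure := by
  have h1 : Measurable (S.indicator F) := by
    refine (measurable_zero (α := ℂ) (β := ℂ)).measurable_of_countable_ne (hS.mono fun z hz => ?_)
    by_contra h
    exact hz (Set.indicator_of_notMem h F).symm
  exact ⟨_, h1.stronglyMeasurable, ae_discrete hS fun z hz => (Set.indicator_of_mem hz F).symm⟩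

theorem lintegral_discrete (F : ℂ → ENNReal) :
    ∫⁻ z, F z ∂(SpectralSet.discrete S).absMeasure = ∑' z : S, F z := by
  refine (lintegral_countable F hS).trans (tsum_congr fun z => ?_)
  simp

theorem memLp_discrete {F : ℂ → ℂ} (h : Summable fun z : S => ‖F z‖ ^ 2) :
    MemLp F 2 (SpectralSet.discrete S).absMeasure ∧
      l2norm (SpectralSet.discrete S).absMeasure F ^ 2 = ∑' z : S, ‖F z‖ ^ 2 := by
  have hm := aestronglyMeasurable_discrete hS F
  have hl : ∫⁻ z, ‖(‖F z‖ ^ 2 : ℝ)‖ₑ ∂(SpectralSet.discrete S).absMeasure =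
      ∑' z : S, ENNReal.ofReal (‖F z‖ ^ 2) := by
    rw [lintegral_discrete hS]
    exact tsum_congr fun z => Real.enorm_of_nonneg (sq_nonneg _)
  constructor
  · rw [memLp_two_iff_integrable_sq_norm hm]
    refine ⟨(hm.norm.pow 2), ?_⟩
    rw [hasFiniteIntegral_iff_enorm, hl, ← ENNReal.ofReal_tsum_of_nonneg (fun _ => sq_nonneg _) h]
    exact ENNReal.ofReal_lt_top
  · rw [l2norm_sq, integral_eq_lintegral_of_nonneg_ae (ae_of_all _ fun _ => sq_nonneg _)
      (hm.norm.pow 2)]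
    have : ∀ z, ENNReal.ofReal (‖F z‖ ^ 2) = ‖(‖F z‖ ^ 2 : ℝ)‖ₑ := fun z =>
      (Real.enorm_of_nonneg (sq_nonneg _)).symm
    simp_rw [this]
    rw [hl, ← ENNReal.ofReal_tsum_of_nonneg (fun _ => sq_nonneg _) h,
      ENNReal.toReal_ofReal (tsum_nonneg fun _ => sq_nonneg _)]

/-- A kernel on a discrete set that is dominated by a product of summable functions is given by
square summable families. -/
theorem exists_sqFamily_discrete {K : ℂ → ℂ → ℂ} {b : ℂ → ℝ} (hb : ∀ z ∈ S, 0 < b z)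
    (hs : Summable fun z : S => b z) (hK0 : ∀ u v, ¬ (u ∈ S ∧ v ∈ S) → K u v = 0)
    (hK : ∀ u ∈ S, ∀ v ∈ S, ‖K u v‖ ≤ b u * b v) :
    ∃ φ ψ : S → ℂ → ℂ, SqFamily (SpectralSet.discrete S).absMeasure φ ∧
      SqFamily (SpectralSet.discrete S).absMeasure ψ ∧ ∀ u v, K u v = ∑' n, φ n u * ψ n v := by
  classical
  have hsq : Summable fun z : S => b z ^ 2 := by
    refine Summable.of_norm_bounded_eventually hs ?_
    filter_upwards [hs.tendsto_cofinite_zero.eventually (gt_mem_nhds one_pos)] with z hz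
    rw [Real.norm_of_nonneg (sq_nonneg _)]
    nlinarith [hb z z.2]
  have hφ2 : ∀ (w : S) (z : ℂ), ‖(if z = w then ((Real.sqrt (b w) : ℝ) : ℂ) else 0)‖ ^ 2 =
      if z = w then b w else 0 := fun w z => by
    split_ifs
    · rw [Complex.norm_real, Real.norm_of_nonneg (Real.sqrt_nonneg _), Real.sq_sqrt (hb w w.2).le]
    · simp
  have hψ2 : ∀ (w : S) (v : ℂ), ‖K w v / ((Real.sqrt (b w) : ℝ) : ℂ)‖ ^ 2 =
      ‖K w v‖ ^ 2 / b w := fun w v => by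
    rw [norm_div, div_pow, Complex.norm_real, Real.norm_of_nonneg (Real.sqrt_nonneg _),
      Real.sq_sqrt (hb w w.2).le]
  have hψle : ∀ (w v : S), ‖K w v‖ ^ 2 / b w ≤ b w * b v ^ 2 := fun w v => by
    rw [div_le_iff₀ (hb w w.2)]
    refine (pow_le_pow_left₀ (norm_nonneg _) (hK w w.2 v v.2) 2).trans (le_of_eq ?_)
    ring
  have hsv : ∀ w : S, Summable fun v : S => ‖K w v‖ ^ 2 / b w := fun w =>
    Summable.of_nonneg_of_le (fun v => div_nonneg (sq_nonneg _) (hb w w.2).le) (hψle w)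
      (hsq.mul_left _)
  -- The family is indexed by S itself: √b(w) times the indicator of {w} on the left, and the row
  -- K(w, ·)/√b(w) on the right. Their squared norms are b(w) and at most b(w) ∑ b².
  refine ⟨fun w z => if z = w then ((Real.sqrt (b w) : ℝ) : ℂ) else 0,
    fun w v => K w v / ((Real.sqrt (b w) : ℝ) : ℂ), ⟨fun w => ?_, ?_, fun u => ?_⟩,
    ⟨fun w => ?_, ?_, fun v => ?_⟩, fun u v => ?_⟩
  · refine (memLp_discrete hS ?_).1
    simp_rw [hφ2]
    exact summable_of_ne_finset_zero (s := {w}) fun z hz => if_neg fun h => hz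
      (Finset.mem_singleton.2 (Subtype.ext h))
  · refine hs.congr fun w => ?_
    have h1 : ∑' z : S, (if (z : ℂ) = w then b w else 0) = b w := by
      rw [tsum_eq_single w fun z hz => if_neg fun h => hz (Subtype.ext h), if_pos rfl]
    rw [(memLp_discrete hS ?_).2]
    · simp_rw [hφ2]
      exact h1.symm
    · simp_rw [hφ2]
      exact summable_of_ne_finset_zero (s := {w}) fun z hz => if_neg fun h => hz
        (Finset.mem_singleton.2 (Subtype.ext h))
  · simp_rw [hφ2]
    by_cases hu : u ∈ S
    · exact summable_of_ne_finset_zero (s := {⟨u, hu⟩}) fun z hz => if_neg fun h => hz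
        (Finset.mem_singleton.2 (Subtype.ext h.symm))
    · exact summable_of_ne_finset_zero (s := ∅) fun z _ => if_neg fun h : u = (z : ℂ) =>
        hu (by rw [h]; exact z.2)
  · refine (memLp_discrete hS ?_).1
    simp_rw [hψ2]
    exact hsv w
  · refine Summable.of_nonneg_of_le (fun _ => sq_nonneg _) (fun w => ?_)
      (hs.mul_right (∑' v : S, b v ^ 2))
    rw [(memLp_discrete hS ?_).2]
    · simp_rw [hψ2]
      rw [← tsum_mul_left]
      exact (hsv w).tsum_le_tsum (hψle w) (hsq.mul_left _)
    · simp_rw [hψ2]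
      exact hsv w
  · simp_rw [hψ2]
    by_cases hv : v ∈ S
    · exact Summable.of_nonneg_of_le (fun w => div_nonneg (sq_nonneg _) (hb w w.2).le)
        (fun w => hψle w ⟨v, hv⟩) (hs.mul_right _)
    · refine summable_of_ne_finset_zero (s := ∅) fun w _ => ?_
      rw [hK0 w v fun h => hv h.2]
      simp
  · by_cases hu : u ∈ S
    · rw [tsum_eq_single ⟨u, hu⟩ fun w hw => by
        simp only [if_neg fun h : u = (w : ℂ) => hw (Subtype.ext h.symm), zero_mul]]
      simp only [if_true]
      have : ((Real.sqrt (b u) : ℝ) : ℂ) ≠ 0 :=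
        Complex.ofReal_ne_zero.2 (Real.sqrt_pos.2 (hb u hu)).ne'
      field_simp
    · rw [hK0 u v fun h => hu h.1]
      refine ((tsum_congr fun w => ?_).trans tsum_zero).symm
      have hne : u ≠ (w : ℂ) := fun h => hu (by rw [h]; exact w.2)
      simp only [if_neg hne, zero_mul]

theorem phaseRegular_discrete : (SpectralSet.discrete S).PhaseRegular :=
  ⟨aestronglyMeasurable_discrete hS _, fun _ => by simp [SpectralSet.phase]⟩

theorem memLp_top_discrete {F : ℂ → ℂ} {c : ℝ} (h : ∀ z ∈ S, ‖F z‖ ≤ c) :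
    MemLp F ⊤ (SpectralSet.discrete S).absMeasure :=
  memLp_top_of_bound (aestronglyMeasurable_discrete hS F) c (ae_discrete hS h)

end Discrete

section Parity

variable {m : ℕ} {K : KernelData} {p : CubicParams m} {cell : Bool → ℕ → Set ℂ}

/-- The cancellation of parities of `halfExp_curve`, for any cells indexed by side and level. -/
theorem KernelData.HasCells.halfExp_of_mem (hK : K.HasCells m)
    (h1 : ∀ j, K.set1 j = cell (decide (Odd j)) j) (h2 : ∀ j, K.set2 j = cell (!decide (Odd j)) j)
    {b : Bool} {j : ℕ} (hj : j ∈ Finset.Icc 1 m) {z : ℂ} (hz : z ∈ cell b j) :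
    K.halfExp p z =
      Complex.exp (ContourSystem.sideSign b * (p.expo j z - p.expo (j - 1) z) / 2) := by
  rw [halfExp, halfExpo]
  congr 1
  by_cases ho : Odd j <;> cases b
  · rw [hK.glue2 hj (by rw [h2]; simpa [ho] using hz), oddOf, evenOf]
    simp [ho, ContourSystem.sideSign]
  · rw [hK.glue1 hj (by rw [h1]; simpa [ho] using hz), oddOf, evenOf]
    simp [ho, ContourSystem.sideSign]
  · have h3 : decide (Odd j) = false := decide_eq_false ho
    rw [hK.glue1 hj (by rwa [h1, h3]), oddOf, evenOf]
    simp [ho, ContourSystem.sideSign]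
  · have h3 : decide (Odd j) = false := decide_eq_false ho
    rw [hK.glue2 hj (by rw [h2, h3]; exact hz), oddOf, evenOf]
    simp [ho, ContourSystem.sideSign]

end Parity

end KPZ

/-! ### Distribution of the Bethe roots. -/

namespace KPZ

open ContourSystem (sideSign)

section Roots

variable {m : ℕ} (ζ : Fin m → ℂ)

/-- The Bethe roots on one side of the imaginary axis. -/
def betheSide (b : Bool) (j : ℕ) : Set ℂ :=
  {s | Complex.exp (-s ^ 2 / 2) = perZeta ζ j ∧ sideSign b * s.re < 0}

theorem betheSide_true (j : ℕ) : betheSide ζ true j = betheL ζ j := by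
  ext s
  simp [betheSide, betheL, sideSign]

theorem betheSide_false (j : ℕ) : betheSide ζ false j = betheR ζ j := by
  ext s
  simp [betheSide, betheR, sideSign]

theorem perSet1_eq (j : ℕ) : perSet1 ζ j = betheSide ζ (decide (Odd j)) j := by
  by_cases h : Odd j
  · simp [perSet1, h, betheSide_true]
  · have h' : decide (Odd j) = false := decide_eq_false h
    rw [perSet1, if_neg h, h', betheSide_false]

theorem perSet2_eq (j : ℕ) : perSet2 ζ j = betheSide ζ (!decide (Odd j)) j := by
  by_cases h : Odd j
  · simp [perSet2, h, betheSide_false]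
  · have h' : decide (Odd j) = false := decide_eq_false h
    rw [perSet2, if_neg h, h', Bool.not_false, betheSide_true]

/-- The set of all Bethe roots. -/
def betheRoots : Set ℂ := ⋃ j ∈ Finset.Icc 1 m, perSet1 ζ j ∪ perSet2 ζ j

theorem mem_betheRoots {z : ℂ} :
    z ∈ betheRoots ζ ↔ ∃ j ∈ Finset.Icc 1 m, ∃ b, z ∈ betheSide ζ b j := by
  simp only [betheRoots, Set.mem_iUnion, Set.mem_union, perSet1_eq, perSet2_eq, exists_prop]
  refine exists_congr fun j => and_congr_right fun _ => ⟨?_, ?_⟩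
  · rintro (h | h)
    · exact ⟨_, h⟩
    · exact ⟨_, h⟩
  · rintro ⟨b, h⟩
    by_cases hb : b = decide (Odd j)
    · exact Or.inl (hb ▸ h)
    · have : b = !decide (Odd j) := by
        revert hb
        cases b <;> cases decide (Odd j) <;> simp
      exact Or.inr (this ▸ h)

variable {ζ}

theorem exists_perZeta_eq {j : ℕ} (hj : j ∈ Finset.Icc 1 m) :
    ∃ i : Fin m, perZeta ζ j = ζ i ∧ (i : ℕ) + 1 = j := by
  rw [Finset.mem_Icc] at hj
  refine ⟨⟨j - 1, by omega⟩, dif_pos hj, ?_⟩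
  simp only
  omega

variable (h1 : ∀ i, 0 < ‖ζ i‖ ∧ ‖ζ i‖ < 1)
include h1

theorem perZeta_ne_zero {j : ℕ} (hj : j ∈ Finset.Icc 1 m) : perZeta ζ j ≠ 0 := by
  obtain ⟨i, hi, -⟩ := exists_perZeta_eq (ζ := ζ) hj
  rw [hi]
  exact norm_pos_iff.1 (h1 i).1

theorem norm_perZeta_lt_one (j : ℕ) : ‖perZeta ζ j‖ < 1 := by
  by_cases hj : j ∈ Finset.Icc 1 m
  · obtain ⟨i, hi, -⟩ := exists_perZeta_eq (ζ := ζ) hj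
    rw [hi]
    exact (h1 i).2
  · rw [Finset.mem_Icc] at hj
    rw [perZeta, dif_neg hj, norm_zero]
    exact one_pos

-- Taking moduli in the Bethe equation: all roots of one level lie on one hyperbola, on which Re z²
-- is constant.
omit h1 in
theorem re_sq_sub_im_sq {b : Bool} {j : ℕ} {z : ℂ} (hz : z ∈ betheSide ζ b j) :
    z.re ^ 2 - z.im ^ 2 = -2 * Real.log ‖perZeta ζ j‖ := by
  rw [← hz.1, Complex.norm_exp, Real.log_exp, Complex.div_ofNat_re, Complex.neg_re, pow_two z,
    Complex.mul_re]
  ring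

theorem log_norm_perZeta_neg {j : ℕ} (hj : j ∈ Finset.Icc 1 m) :
    Real.log ‖perZeta ζ j‖ < 0 :=
  Real.log_neg (norm_pos_iff.2 (perZeta_ne_zero h1 hj)) (norm_perZeta_lt_one h1 j)

theorem exists_le_abs_re : ∃ c > 0, ∀ z ∈ betheRoots ζ, c ≤ |z.re| := by
  obtain ⟨r, hr, hle⟩ := exists_pos_forall_le (δ := fun i : Fin m => Real.sqrt
    (-2 * Real.log ‖ζ i‖)) fun i => Real.sqrt_pos.2 (by
      have := Real.log_neg (h1 i).1 (h1 i).2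
      linarith)
  refine ⟨r, hr, fun z hz => ?_⟩
  obtain ⟨j, hj, b, hz⟩ := (mem_betheRoots ζ).1 hz
  obtain ⟨i, hi, -⟩ := exists_perZeta_eq (ζ := ζ) hj
  have h2 := re_sq_sub_im_sq hz
  rw [hi] at h2
  refine (hle i).trans (Real.sqrt_le_iff.2 ⟨abs_nonneg _, ?_⟩)
  rw [sq_abs, ← h2]
  linarith [sq_nonneg z.im]

theorem exists_int_of_mem {b : Bool} {j : ℕ} (hj : j ∈ Finset.Icc 1 m) {z : ℂ}
    (hz : z ∈ betheSide ζ b j) :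
    ∃ n : ℤ, -z ^ 2 / 2 = Complex.log (perZeta ζ j) + n * (2 * Real.pi * Complex.I) := by
  rw [← Complex.exp_eq_exp_iff_exists_int, hz.1, Complex.exp_log (perZeta_ne_zero h1 hj)]

/-- Each root has an integer n with -z²/2 = log ζ_j + 2πi n, which determines z² and, the side being
fixed, z. Since |n| ≤ M + ‖z‖², the fourth power of 1/(1 + ‖z‖) is dominated by a multiple of 1/(1 +
n²). -/
theorem summable_betheSide (b : Bool) {j : ℕ} (hj : j ∈ Finset.Icc 1 m) :
    Summable fun z : betheSide ζ b j => ((1 + ‖(z : ℂ)‖)⁻¹) ^ 4 := by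
  choose n hn using fun z : betheSide ζ b j => exists_int_of_mem h1 hj z.2
  have hinj : Function.Injective n := fun z w hzw => by
    have h2 : (z : ℂ) ^ 2 = (w : ℂ) ^ 2 := by
      have := (hn z).trans (hzw ▸ (hn w).symm)
      linear_combination -2 * this
    rcases sq_eq_sq_iff_eq_or_eq_neg.1 h2 with h | h
    · exact Subtype.ext h
    · have h3 := z.2.2
      have h4 := w.2.2
      rw [h, Complex.neg_re] at h3
      linarith
  set M := ‖Complex.log (perZeta ζ j)‖ with hM
  have hM0 : 0 ≤ M := norm_nonneg _
  have hs : Summable fun k : ℤ => (M + 1) ^ 2 * 2 * (1 + (k : ℝ) ^ 2)⁻¹ := by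
    refine Summable.mul_left _ ?_
    refine Summable.of_norm_bounded_eventually
      ((Real.summable_one_div_int_pow (p := 2)).2 (by norm_num)) ?_
    filter_upwards [(Set.finite_singleton (0 : ℤ)).compl_mem_cofinite] with k hk
    have hk0 : (k : ℝ) ≠ 0 := by exact_mod_cast hk
    have hk2 : 0 < (k : ℝ) ^ 2 := by positivity
    rw [Real.norm_of_nonneg (by positivity), one_div]
    exact inv_anti₀ hk2 (by linarith)
  refine Summable.of_nonneg_of_le (fun _ => by positivity) (fun z => ?_) (hs.comp_injective hinj)
  have h3 : |(n z : ℝ)| ≤ M + ‖(z : ℂ)‖ ^ 2 := by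
    have h4 : ‖(n z : ℂ) * (2 * Real.pi * Complex.I)‖ ≤ ‖(z : ℂ)‖ ^ 2 / 2 + M := by
      have h5 : (n z : ℂ) * (2 * Real.pi * Complex.I) =
          -(z : ℂ) ^ 2 / 2 - Complex.log (perZeta ζ j) := by rw [hn z]; ring
      rw [h5]
      refine (norm_sub_le _ _).trans (le_of_eq ?_)
      rw [norm_div, norm_neg, norm_pow, Complex.norm_ofNat]
    rw [norm_mul, norm_mul, norm_mul, Complex.norm_I, Complex.norm_real, Complex.norm_ofNat,
      Real.norm_of_nonneg Real.pi_pos.le, Complex.norm_intCast] at h4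
    nlinarith [Real.pi_gt_three, abs_nonneg (n z : ℝ), sq_nonneg ‖(z : ℂ)‖]
  simp only [Function.comp]
  rw [inv_pow, ← div_eq_mul_inv, inv_eq_one_div, div_le_div_iff₀ (by positivity) (by positivity)]
  have h6 : (n z : ℝ) ^ 2 ≤ (M + ‖(z : ℂ)‖ ^ 2) ^ 2 := by
    rw [← sq_abs]
    exact pow_le_pow_left₀ (abs_nonneg _) h3 2
  have h7 : M + ‖(z : ℂ)‖ ^ 2 ≤ (M + 1) * (1 + ‖(z : ℂ)‖) ^ 2 := by
    nlinarith [norm_nonneg (z : ℂ), mul_nonneg hM0 (norm_nonneg (z : ℂ)),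
      mul_nonneg hM0 (sq_nonneg ‖(z : ℂ)‖)]
  have h8 : (M + ‖(z : ℂ)‖ ^ 2) ^ 2 ≤ ((M + 1) * (1 + ‖(z : ℂ)‖) ^ 2) ^ 2 :=
    pow_le_pow_left₀ (by positivity) h7 2
  have h9 : 1 ≤ ((M + 1) * (1 + ‖(z : ℂ)‖) ^ 2) ^ 2 := by
    refine one_le_pow₀ ?_
    nlinarith [norm_nonneg (z : ℂ), mul_nonneg hM0 (norm_nonneg (z : ℂ)),
      mul_nonneg hM0 (sq_nonneg ‖(z : ℂ)‖)]
  nlinarith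

theorem summable_betheRoots : Summable fun z : betheRoots ζ => ((1 + ‖(z : ℂ)‖)⁻¹) ^ 4 := by
  have hcell : ∀ x : Bool × {j // j ∈ Finset.Icc 1 m}, Summable
      ((betheSide ζ x.1 x.2).indicator fun z : ℂ => ((1 + ‖z‖)⁻¹) ^ 4) := fun x =>
    summable_subtype_iff_indicator.1 (summable_betheSide h1 x.1 x.2.2)
  refine (summable_subtype_iff_indicator (f := fun z : ℂ => ((1 + ‖z‖)⁻¹) ^ 4)).2 ?_
  have h0 : ∀ z : ℂ, 0 ≤ ((1 + ‖z‖)⁻¹) ^ 4 := fun z => by positivity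
  refine Summable.of_nonneg_of_le (fun z => Set.indicator_nonneg (fun z _ => h0 z) z) (fun z => ?_)
    (summable_sum (s := Finset.univ) fun x _ => hcell x)
  by_cases hz : z ∈ betheRoots ζ
  · obtain ⟨j, hj, b, hz'⟩ := (mem_betheRoots ζ).1 hz
    rw [Set.indicator_of_mem hz]
    refine le_trans (le_of_eq ?_) (Finset.single_le_sum (f := fun x : Bool × {j // j ∈
      Finset.Icc 1 m} => (betheSide ζ x.1 x.2).indicator (fun z : ℂ => ((1 + ‖z‖)⁻¹) ^ 4) z)
      (fun x _ => Set.indicator_nonneg (fun z _ => h0 z) z) (Finset.mem_univ (b, ⟨j, hj⟩)))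
    exact (Set.indicator_of_mem hz' (fun z : ℂ => ((1 + ‖z‖)⁻¹) ^ 4)).symm
  · rw [Set.indicator_of_notMem hz]
    exact Finset.sum_nonneg fun x _ => Set.indicator_nonneg (fun z _ => h0 z) z

theorem countable_betheRoots : (betheRoots ζ).Countable :=
  countable_of_summable (b := fun z => ((1 + ‖z‖)⁻¹) ^ 4) (fun z _ => by positivity)
    (summable_betheRoots h1)

theorem not_accPt_betheRoots (z : ℂ) : ¬ AccPt z (𝓟 (betheRoots ζ)) := by
  refine not_accPt_of_summable (b := fun z => ((1 + ‖z‖)⁻¹) ^ 4) (fun R => ?_)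
    (summable_betheRoots h1) z
  refine ⟨((1 + max R 0)⁻¹) ^ 4, by positivity, fun z _ hz => ?_⟩
  have : ‖z‖ ≤ max R 0 := hz.trans (le_max_left _ _)
  gcongr

/-- The squares of distinct roots are apart: at different levels their real parts differ, and at the
same level they differ by a nonzero multiple of 4πi unless u = -v. As ‖u² - v²‖ ≤ ‖u - v‖ (‖u‖ +
‖v‖), the roots can cluster at most at a polynomial rate. -/
theorem exists_inv_norm_sub_le (h2 : ∀ i j, i < j → ‖ζ i‖ < ‖ζ j‖) : ∃ c, 0 ≤ c ∧
    ∀ u ∈ betheRoots ζ, ∀ v ∈ betheRoots ζ, u ≠ v → ‖u - v‖⁻¹ ≤ c * ((1 + ‖u‖) * (1 + ‖v‖)) := by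
  obtain ⟨c₀, hc₀, hre⟩ := exists_le_abs_re h1
  obtain ⟨δ, hδ, hle⟩ := exists_pos_forall_le (ι := {x : Fin m × Fin m // x.1 ≠ x.2})
    (δ := fun x => |-2 * Real.log ‖ζ x.1.1‖ - -2 * Real.log ‖ζ x.1.2‖|) fun x => by
      refine abs_pos.2 (sub_ne_zero.2 fun h => x.2 ?_)
      have h3 : Real.log ‖ζ x.1.1‖ = Real.log ‖ζ x.1.2‖ := by linarith
      have h4 := Real.log_injOn_pos (h1 _).1 (h1 _).1 h3
      rcases lt_trichotomy x.1.1 x.1.2 with h | h | h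
      · exact absurd h4 (h2 _ _ h).ne
      · exact h
      · exact absurd h4 (h2 _ _ h).ne'
  -- The three entries cover different levels, equal levels with u² ≠ v² (where 4π ≥ 4), and u = -v,
  -- where ‖u - v‖ (‖u‖ + ‖v‖) = 4‖v‖² ≥ 4c₀².
  set κ := min δ (min 4 (4 * c₀ ^ 2)) with hκ
  have hκ0 : 0 < κ := by positivity
  refine ⟨κ⁻¹, by positivity, fun u hu v hv huv => ?_⟩
  have hne : 0 < ‖u - v‖ := norm_pos_iff.2 (sub_ne_zero.2 huv)
  have key : κ ≤ ‖u - v‖ * (‖u‖ + ‖v‖) := by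
    have hu0 := (hre u hu).trans (Complex.abs_re_le_norm u)
    have hv0 := (hre v hv).trans (Complex.abs_re_le_norm v)
    have hsq : ‖u ^ 2 - v ^ 2‖ ≤ ‖u - v‖ * (‖u‖ + ‖v‖) := by
      rw [show u ^ 2 - v ^ 2 = (u - v) * (u + v) by ring, norm_mul]
      exact mul_le_mul_of_nonneg_left (norm_add_le _ _) (norm_nonneg _)
    obtain ⟨i, hi, b, hu⟩ := (mem_betheRoots ζ).1 hu
    obtain ⟨j, hj, b', hv⟩ := (mem_betheRoots ζ).1 hv
    by_cases hij : i = j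
    · subst hij
      obtain ⟨n, hn⟩ := exists_int_of_mem h1 hi hu
      obtain ⟨k, hk⟩ := exists_int_of_mem h1 hi hv
      by_cases hnk : n = k
      · subst hnk
        have h5 : u ^ 2 = v ^ 2 := by linear_combination -2 * (hn.trans hk.symm)
        have h6 : u = -v := (sq_eq_sq_iff_eq_or_eq_neg.1 h5).resolve_left huv
        have h7 : ‖u - v‖ = 2 * ‖v‖ := by
          rw [h6, show -v - v = -(2 * v) by ring, norm_neg, norm_mul, Complex.norm_ofNat]
        rw [h7]
        refine ((min_le_right _ _).trans (min_le_right _ _)).trans ?_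
        nlinarith
      · refine le_trans ?_ hsq
        refine ((min_le_right _ _).trans (min_le_left _ _)).trans ?_
        have h5 : u ^ 2 - v ^ 2 = ((k - n : ℤ) : ℂ) * (4 * Real.pi * Complex.I) := by
          push_cast
          linear_combination -2 * hn + 2 * hk
        have h6 : (1 : ℝ) ≤ |((k - n : ℤ) : ℝ)| := by
          rw [← Int.cast_abs]
          exact_mod_cast Int.one_le_abs (sub_ne_zero.2 (Ne.symm hnk))
        rw [h5, norm_mul, norm_mul, norm_mul, Complex.norm_I, Complex.norm_real,
          Complex.norm_ofNat, Real.norm_of_nonneg Real.pi_pos.le, Complex.norm_intCast]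
        nlinarith [Real.pi_gt_three]
    · refine le_trans ?_ hsq
      refine (min_le_left _ _).trans ?_
      obtain ⟨i', hi', hi''⟩ := exists_perZeta_eq (ζ := ζ) hi
      obtain ⟨j', hj', hj''⟩ := exists_perZeta_eq (ζ := ζ) hj
      have hne : i' ≠ j' := fun h => hij (by rw [← hi'', ← hj'', h])
      refine (hle ⟨(i', j'), hne⟩).trans (le_trans (le_of_eq ?_) (Complex.abs_re_le_norm _))
      rw [← hi', ← hj', ← re_sq_sub_im_sq hu, ← re_sq_sub_im_sq hv, Complex.sub_re, pow_two u,
        pow_two v, Complex.mul_re, Complex.mul_re]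
      congr 1
      ring
  have hfin : κ ≤ ‖u - v‖ * ((1 + ‖u‖) * (1 + ‖v‖)) := by
    refine key.trans (mul_le_mul_of_nonneg_left ?_ hne.le)
    nlinarith [norm_nonneg u, norm_nonneg v, mul_nonneg (norm_nonneg u) (norm_nonneg v)]
  rw [inv_le_iff_one_le_mul₀ hne]
  rw [← div_le_iff₀' (by positivity)] at hfin
  calc (1 : ℝ) = κ⁻¹ * κ := (inv_mul_cancel₀ hκ0.ne').symm
    _ ≤ κ⁻¹ * (‖u - v‖ * ((1 + ‖u‖) * (1 + ‖v‖))) := by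
        refine mul_le_mul_of_nonneg_left ?_ (by positivity)
        rwa [div_le_iff₀' (by positivity)] at hfin
    _ = _ := by ring

end Roots

/-! ### Bounds for the functions `H_j`, `A_j` and `B_j` on the roots. -/

section FunctionH

variable {m : ℕ} {ζ : Fin m → ℂ} (h1 : ∀ i, 0 < ‖ζ i‖ ∧ ‖ζ i‖ < 1)
include h1

/-- On the imaginary axis the exponential is the Gaussian exp(-y²/2), and |ζ_j| < 1 keeps the
argument of the logarithm away from 0. -/
theorem exists_norm_log_le (j : ℕ) : ∃ c, 0 ≤ c ∧ ∀ y : ℝ,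
    ‖Complex.log (1 - perZeta ζ j * Complex.exp ((y * Complex.I) ^ 2 / 2))‖ ≤
      c * Real.exp (-(1 / 2) * y ^ 2) := by
  set r := ‖perZeta ζ j‖ with hr
  have hr1 : r < 1 := norm_perZeta_lt_one h1 j
  have hr0 : 0 ≤ r := norm_nonneg _
  refine ⟨(1 - r)⁻¹ + 1, by
    have : 0 < 1 - r := by linarith
    positivity, fun y => ?_⟩
  have he : ‖Complex.exp ((y * Complex.I) ^ 2 / 2)‖ = Real.exp (-(1 / 2) * y ^ 2) := by
    rw [Complex.norm_exp]
    congr 1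
    rw [show (y * Complex.I) ^ 2 / 2 = ((-(1 / 2) * y ^ 2 : ℝ) : ℂ) by
      rw [mul_pow, Complex.I_sq]
      push_cast
      ring, Complex.ofReal_re]
  have he1 : Real.exp (-(1 / 2) * y ^ 2) ≤ 1 := Real.exp_le_one_iff.2 (by nlinarith [sq_nonneg y])
  set e := Real.exp (-(1 / 2) * y ^ 2) with hed
  have he0 : 0 < e := Real.exp_pos _
  have hn : ‖-(perZeta ζ j * Complex.exp ((y * Complex.I) ^ 2 / 2))‖ = r * e := by
    rw [norm_neg, norm_mul, he]
  have hre : r * e ≤ r := mul_le_of_le_one_right hr0 he1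
  have hre0 : 0 ≤ r * e := by positivity
  rw [sub_eq_add_neg]
  refine (Complex.norm_log_one_add_le (by rw [hn]; linarith)).trans ?_
  rw [hn]
  have h3 : (1 - r * e)⁻¹ ≤ (1 - r)⁻¹ := inv_anti₀ (by linarith) (by linarith)
  have h4 : 0 ≤ (1 - r * e)⁻¹ := inv_nonneg.2 (by linarith)
  have h5 : r * e ≤ e := mul_le_of_le_one_left he0.le hr1.le
  have h6 : (r * e) ^ 2 ≤ e := by nlinarith
  have h7 : (r * e) ^ 2 * (1 - r * e)⁻¹ ≤ e * (1 - r)⁻¹ :=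
    mul_le_mul h6 h3 h4 he0.le
  have h8 : 0 ≤ (r * e) ^ 2 * (1 - r * e)⁻¹ := by positivity
  linarith

/-- Away from the imaginary axis the Cauchy denominator is bounded below, so the integral in the
exponent is bounded uniformly in z, and `H_j` is bounded from both sides. -/
theorem exists_norm_perH_le (j : ℕ) {c₀ : ℝ} (hc₀ : 0 < c₀) : ∃ M, 0 ≤ M ∧ ∀ z : ℂ, c₀ ≤ |z.re| →
    Real.exp (-M) ≤ ‖perH ζ j z‖ ∧ ‖perH ζ j z‖ ≤ Real.exp M := by
  obtain ⟨c, hc0, hc⟩ := exists_norm_log_le h1 j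
  have hint : Integrable fun y : ℝ => c * Real.exp (-(1 / 2) * y ^ 2) / c₀ :=
    ((integrable_exp_neg_mul_sq (by norm_num)).const_mul c).div_const c₀
  set M := ∫ y : ℝ, c * Real.exp (-(1 / 2) * y ^ 2) / c₀ with hM
  have hM0 : 0 ≤ M := integral_nonneg fun y => by positivity
  have hexp : ∀ I : ℂ, ‖I‖ ≤ M → Real.exp (-M) ≤ ‖Complex.exp (-I)‖ ∧
      ‖Complex.exp (-I)‖ ≤ Real.exp M := fun I hI => by
    rw [Complex.norm_exp, Real.exp_le_exp, Real.exp_le_exp, Complex.neg_re]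
    have := abs_le.1 ((Complex.abs_re_le_norm I).trans hI)
    constructor <;> linarith [this.1, this.2]
  have hbd : ∀ (y : ℝ) (w : ℂ), c₀ ≤ ‖w‖ →
      ‖Complex.log (1 - perZeta ζ j * Complex.exp ((y * Complex.I) ^ 2 / 2)) / w * Complex.I‖ ≤
        c * Real.exp (-(1 / 2) * y ^ 2) / c₀ := fun y w hw => by
    rw [norm_mul, Complex.norm_I, mul_one, norm_div]
    exact div_le_div₀ (by positivity) (hc y) hc₀ hw
  refine ⟨M, hM0, fun z hz => ?_⟩
  rw [perH]
  split_ifs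
  · refine hexp _ (norm_integral_le_of_norm_le hint (ae_of_all _ fun y => hbd y _ ?_))
    refine hz.trans ?_
    have := Complex.abs_re_le_norm (y * Complex.I - z)
    simpa using this
  · refine hexp _ (norm_integral_le_of_norm_le hint (ae_of_all _ fun y => hbd y _ ?_))
    refine hz.trans ?_
    have := Complex.abs_re_le_norm (y * Complex.I + z)
    simpa using this

theorem exists_norm_AB_le : ∃ c, 0 ≤ c ∧ ∀ j ∈ Finset.Icc 1 m, ∀ z ∈ betheRoots ζ,
    ‖(perData ζ).A j z‖ ≤ c ∧ ‖(perData ζ).B j z‖ ≤ c := by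
  obtain ⟨c₀, hc₀, hre⟩ := exists_le_abs_re h1
  choose M hM0 hM using fun j => exists_norm_perH_le h1 j hc₀
  -- The shifted index of `perHShift` runs down to 0 and up to m + 1.
  set T := ∑ j ∈ Finset.range (m + 2), M j with hT
  have hT0 : 0 ≤ T := Finset.sum_nonneg fun j _ => hM0 j
  have hH : ∀ j < m + 2, ∀ z ∈ betheRoots ζ, Real.exp (-T) ≤ ‖perH ζ j z‖ ∧
      ‖perH ζ j z‖ ≤ Real.exp T := fun j hj z hz => by
    have hle : M j ≤ T := Finset.single_le_sum (f := M) (fun j _ => hM0 j) (Finset.mem_range.2 hj)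
    have := hM j z (hre z hz)
    exact ⟨le_trans (Real.exp_le_exp.2 (by linarith)) this.1, this.2.trans (Real.exp_le_exp.2 hle)⟩
  set q := ∑ j ∈ Finset.Icc 1 m, (‖perQ1 ζ j‖ + ‖perQ2 ζ j‖) with hq
  have hq0 : 0 ≤ q := Finset.sum_nonneg fun j _ => by positivity
  refine ⟨1 / (c₀ * Real.exp (-T)) * Real.exp T + q * Real.exp T, by positivity,
    fun j hj z hz => ?_⟩
  have hj' := Finset.mem_Icc.1 hj
  have hS : ‖perHShift ζ j z‖ ≤ Real.exp T := by
    rw [perHShift]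
    split_ifs
    · exact (hH _ (by omega) z hz).2
    · exact (hH _ (by omega) z hz).2
  have hz0 : c₀ ≤ ‖z‖ := (hre z hz).trans (Complex.abs_re_le_norm z)
  constructor
  · refine le_trans ?_ (le_add_of_nonneg_right (by positivity))
    simp only [perData]
    rw [norm_mul, norm_div, norm_one, norm_mul]
    have := (hH j (by omega) z hz).1
    gcongr
  · refine le_trans ?_ (le_add_of_nonneg_left (by positivity))
    simp only [perData]
    rw [norm_mul]
    refine mul_le_mul ?_ hS (norm_nonneg _) hq0
    refine le_trans ?_ (Finset.single_le_sum (f := fun j => ‖perQ1 ζ j‖ + ‖perQ2 ζ j‖)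
      (fun j _ => by positivity) hj)
    refine (norm_add_le _ _).trans (add_le_add ?_ ?_)
    · rw [norm_mul]
      exact mul_le_of_le_one_right (norm_nonneg _) (norm_chi_le_one _ _)
    · rw [norm_mul]
      exact mul_le_of_le_one_right (norm_nonneg _) (norm_chi_le_one _ _)

end FunctionH

end KPZ

/-! ### Admissibility of the periodic determinant. -/

namespace KPZ

open ContourSystem (sideSign)

section Periodic

variable {m : ℕ} {ζ : Fin m → ℂ} {p : CubicParams m}

/-- Here ρ stands for |Re z| on a hyperbola Re z² = l. The cubic term wins if a < 0; otherwise only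
-dρ is left. -/
theorem exists_cubic_le {a d l : ℝ} (h : a < 0 ∨ (a = 0 ∧ 0 < d)) : ∃ δ > 0, ∃ c, ∀ ρ : ℝ, 0 ≤ ρ →
    2 * a * ρ ^ 3 - 3 * a * l * ρ - d * ρ ≤ c - δ * ρ := by
  rcases h with ha | ⟨rfl, hd⟩
  · set B := |1 - 3 * a * l - d| with hB
    have hB0 : 0 ≤ B := abs_nonneg _
    have hBle := le_abs_self (1 - 3 * a * l - d)
    have hA : 0 < -(2 * a) := by linarith
    refine ⟨1, one_pos, B * (1 + B / -(2 * a)), fun ρ hρ => ?_⟩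
    have h1 : (1 - 3 * a * l - d) * ρ ≤ B * ρ := mul_le_mul_of_nonneg_right hBle hρ
    have hq : 0 ≤ B / -(2 * a) := by positivity
    have hqm : B / -(2 * a) * -(2 * a) = B := div_mul_cancel₀ _ hA.ne'
    -- If ρ² ≥ B/(-2a), the cubic term absorbs the linear one; otherwise ρ ≤ 1 + ρ² bounds ρ by the
    -- constant.
    have key : B * ρ ≤ -(2 * a) * ρ ^ 3 + B * (1 + B / -(2 * a)) := by
      by_cases hρ2 : B / -(2 * a) ≤ ρ ^ 2
      · have h2 : B ≤ -(2 * a) * ρ ^ 2 := by nlinarith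
        have h3 : B * ρ ≤ -(2 * a) * ρ ^ 2 * ρ := mul_le_mul_of_nonneg_right h2 hρ
        have : 0 ≤ B * (1 + B / -(2 * a)) := by positivity
        nlinarith
      · have h2 : ρ ≤ 1 + B / -(2 * a) := by nlinarith [sq_nonneg (ρ - 1)]
        have h3 : B * ρ ≤ B * (1 + B / -(2 * a)) := mul_le_mul_of_nonneg_left h2 hB0
        have : 0 ≤ -(2 * a) * ρ ^ 3 := by positivity
        linarith
    linarith
  · exact ⟨d, hd, 0, fun ρ _ => by nlinarith⟩

/-- Six powers suffice: the kernel bound loses one of them to 1/‖u - v‖ and needs four for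
summability over the roots. -/
theorem exists_exp_neg_le {δ : ℝ} (hδ : 0 < δ) : ∃ c, 0 ≤ c ∧ ∀ x : ℝ, 0 ≤ x →
    Real.exp (-(δ * x)) ≤ c * ((1 + x)⁻¹) ^ 6 := by
  refine ⟨(1 + 6 / δ) ^ 6, by positivity, fun x hx => ?_⟩
  have h1 : 1 + x ≤ (1 + 6 / δ) * Real.exp (δ * x / 6) := by
    have h2 := Real.add_one_le_exp (δ * x / 6)
    have h3 : (1 + 6 / δ) * (δ * x / 6 + 1) ≤ (1 + 6 / δ) * Real.exp (δ * x / 6) :=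
      mul_le_mul_of_nonneg_left h2 (by positivity)
    have h4 : 6 / δ * (δ * x / 6) = x := by field_simp
    have h5 : 0 ≤ 6 / δ := by positivity
    have h6 : 0 ≤ δ * x / 6 := by positivity
    nlinarith
  have h2 := pow_le_pow_left₀ (by positivity) h1 6
  rw [mul_pow, ← Real.exp_nat_mul] at h2
  have h3 : ((6 : ℕ) : ℝ) * (δ * x / 6) = δ * x := by
    push_cast
    ring
  rw [h3] at h2
  rw [Real.exp_neg, inv_pow, ← div_eq_mul_inv, inv_eq_one_div,
    div_le_div_iff₀ (Real.exp_pos _) (by positivity), one_mul]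
  exact h2

/-- With Re z² = l one has Re z³ = Re z (3l - 2 (Re z)²), and the sign of the side turns Re z into
-|Re z|. Thus y contributes only a constant; this is why, for equal times, the periodic model needs
increasing x instead of increasing y. -/
theorem re_cubic_of_mem {b : Bool} {j : ℕ} {z : ℂ} (hz : z ∈ betheSide ζ b j) (a e d : ℝ) :
    ((sideSign b : ℂ) * (a * z ^ 3 + e * z ^ 2 + d * z)).re =
      2 * a * |z.re| ^ 3 - 3 * a * (-2 * Real.log ‖perZeta ζ j‖) * |z.re| - d * |z.re| +
        sideSign b * e * (-2 * Real.log ‖perZeta ζ j‖) := by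
  have h := re_sq_sub_im_sq hz
  set l := -2 * Real.log ‖perZeta ζ j‖
  have h2 : (z ^ 2).re = l := by
    rw [← h, pow_two, Complex.mul_re]
    ring
  have h3 : (z ^ 3).re = z.re * (3 * l - 2 * z.re ^ 2) := by
    rw [← h, pow_succ, pow_two, Complex.mul_re, Complex.mul_re, Complex.mul_im]
    ring
  have hs : |z.re| = -(sideSign b * z.re) ∧ |z.re| ^ 3 = -(sideSign b * z.re ^ 3) := by
    have hz2 := hz.2
    cases b
    · simp only [sideSign, Bool.false_eq_true, if_false] at hz2 ⊢
      rw [abs_of_pos (by linarith)]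
      constructor <;> ring
    · simp only [sideSign, if_true] at hz2 ⊢
      rw [abs_of_neg (by linarith)]
      constructor <;> ring
  rw [Complex.re_ofReal_mul, Complex.add_re, Complex.add_re, Complex.re_ofReal_mul,
    Complex.re_ofReal_mul, Complex.re_ofReal_mul, h2, h3, hs.2, hs.1]
  ring

variable (h1 : ∀ i, 0 < ‖ζ i‖ ∧ ‖ζ i‖ < 1) (h2 : ∀ i j, i < j → ‖ζ i‖ < ‖ζ j‖)
include h1 h2

theorem perData_hasCells : (perData ζ).HasCells m := by
  have hcount : ∀ {j b}, j ∈ Finset.Icc 1 m → MeasurableSet (betheSide ζ b j) := fun {j b} hj =>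
    ((countable_betheRoots h1).mono fun z hz => (mem_betheRoots ζ).2 ⟨j, hj, b, hz⟩).measurableSet
  have hdis : ∀ {i j b b'}, i ∈ Finset.Icc 1 m → j ∈ Finset.Icc 1 m → (i = j → b ≠ b') →
      Disjoint (betheSide ζ b i) (betheSide ζ b' j) := fun {i j b b'} hi hj h => by
    rw [Set.disjoint_left]
    intro z hz hz'
    by_cases hij : i = j
    · have h3 := hz.2
      have h4 := hz'.2
      have h5 := h hij
      revert h3 h4 h5
      cases b <;> cases b' <;> simp [sideSign] <;> intros <;> linarith
    · obtain ⟨i', hi', hi''⟩ := exists_perZeta_eq (ζ := ζ) hi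
      obtain ⟨j', hj', hj''⟩ := exists_perZeta_eq (ζ := ζ) hj
      have h3 : ζ i' = ζ j' := by rw [← hi', ← hj', ← hz.1, ← hz'.1]
      have hne : i' ≠ j' := fun h => hij (by rw [← hi'', ← hj'', h])
      rcases lt_or_gt_of_ne hne with h | h
      · exact (h2 _ _ h).ne (by rw [h3])
      · exact (h2 _ _ h).ne (by rw [h3])
  have e1 : ∀ j, (perData ζ).set1 j = betheSide ζ (decide (Odd j)) j := perSet1_eq ζ
  have e2 : ∀ j, (perData ζ).set2 j = betheSide ζ (!decide (Odd j)) j := perSet2_eq ζ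
  refine ⟨fun j hj => ?_, fun j hj => ?_, fun i hi j hj hij => ?_, fun i hi j hj hij => ?_,
    fun i hi j hj => ?_, subset_rfl⟩
  · rw [e1]
    exact hcount hj
  · rw [e2]
    exact hcount hj
  · rw [e1, e1]
    exact hdis hi hj fun h => absurd h hij
  · rw [e2, e2]
    exact hdis hi hj fun h => absurd h hij
  · rw [e1, e2]
    refine hdis hi hj fun h => ?_
    rw [h]
    cases decide (Odd j) <;> simp

theorem exists_halfExp_le_of_mem (hp : p ∈ perRegion m) : ∃ c, 0 ≤ c ∧ ∀ z ∈ betheRoots ζ,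
    ‖(perData ζ).halfExp p z‖ ≤ c * ((1 + ‖z‖)⁻¹) ^ 6 := by
  have hK := perData_hasCells h1 h2
  have hcell : ∀ x : Bool × {j // j ∈ Finset.Icc 1 m}, ∃ c, 0 ≤ c ∧ ∀ z ∈ betheSide ζ x.1 x.2,
      ‖(perData ζ).halfExp p z‖ ≤ c * ((1 + ‖z‖)⁻¹) ^ 6 := by
    rintro ⟨b, j, hj⟩
    have hd : p.coeffT j - p.coeffT (j - 1) < 0 ∨ (p.coeffT j - p.coeffT (j - 1) = 0 ∧
        0 < p.coeffX j - p.coeffX (j - 1)) := by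
      rcases coeffT_diff (p := p) hj with ⟨i, hi, -⟩ | ⟨i, i', hii', h, -, hx⟩
      · rw [hi]
        exact Or.inl (by linarith [hp.1 i])
      · rw [h, hx]
        obtain ⟨h1, h2⟩ := hp.2 i i' hii'
        rcases h1.lt_or_eq with h3 | h3
        · exact Or.inl (by linarith)
        · exact Or.inr ⟨by linarith, by linarith [h2 h3]⟩
    set l := -2 * Real.log ‖perZeta ζ j‖ with hl
    have hl0 : 0 ≤ l := by
      have := log_norm_perZeta_neg h1 hj
      linarith
    obtain ⟨δ, hδ, c, hc⟩ := exists_cubic_le (l := l) hd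
    -- The rate δ is halved once by the square root in `halfExp` and once by the estimate ‖z‖ ≤ 2|Re
    -- z|, which holds since l ≥ 0.
    obtain ⟨c', hc'0, hc'⟩ := exists_exp_neg_le (δ := δ / 4) (by positivity)
    set e := p.coeffY j - p.coeffY (j - 1) with he
    refine ⟨Real.exp ((c + |sideSign b * e * l|) / 2) * c', by positivity, fun z hz => ?_⟩
    rw [hK.halfExp_of_mem (cell := betheSide ζ) (perSet1_eq ζ) (perSet2_eq ζ) hj hz,
      Complex.norm_exp, mul_assoc]
    refine le_trans ?_ (mul_le_mul_of_nonneg_left (hc' ‖z‖ (norm_nonneg _)) (Real.exp_pos _).le)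
    rw [← Real.exp_add, Real.exp_le_exp, Complex.div_ofNat_re]
    have h3 : (sideSign b : ℂ) * (p.expo j z - p.expo (j - 1) z) =
        (sideSign b : ℂ) * (((p.coeffT j - p.coeffT (j - 1) : ℝ) : ℂ) * z ^ 3 +
          (e : ℂ) * z ^ 2 + ((p.coeffX j - p.coeffX (j - 1) : ℝ) : ℂ) * z) := by
      rw [p.expo_eq, p.expo_eq, he]
      push_cast
      ring
    rw [h3, re_cubic_of_mem hz, ← hl]
    have h4 := hc |z.re| (abs_nonneg _)
    have h5 := le_abs_self (sideSign b * e * l)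
    have h6 : ‖z‖ ≤ 2 * |z.re| := by
      have h7 := re_sq_sub_im_sq hz
      rw [← hl] at h7
      have h8 : ‖z‖ ^ 2 = z.re ^ 2 + z.im ^ 2 := by
        rw [Complex.sq_norm, Complex.normSq_apply]
        ring
      refine abs_le_of_sq_le_sq' ?_ (by positivity) |>.2
      rw [mul_pow, sq_abs]
      nlinarith
    nlinarith
  choose c hc0 hc using hcell
  refine ⟨∑ x, c x, Finset.sum_nonneg fun x _ => hc0 x, fun z hz => ?_⟩
  obtain ⟨j, hj, b, hz⟩ := (mem_betheRoots ζ).1 hz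
  refine (hc (b, ⟨j, hj⟩) z hz).trans (mul_le_mul_of_nonneg_right ?_ (by positivity))
  exact Finset.single_le_sum (f := c) (fun x _ => hc0 x) (Finset.mem_univ _)

theorem exists_norm_FG_le : ∃ c, 0 ≤ c ∧ ∀ z ∈ betheRoots ζ, ∀ n,
    ‖((perData ζ).family m).F z n‖ ≤ c ∧ ‖((perData ζ).family m).G z n‖ ≤ c := by
  have hK := perData_hasCells h1 h2
  obtain ⟨c, hc0, hc⟩ := exists_norm_AB_le h1
  refine ⟨c, hc0, fun z hz n => ?_⟩
  rw [KernelData.family_F, KernelData.family_G]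
  rcases (perData ζ).cases_cell m z with ⟨i, hi, hz'⟩ | ⟨i, hi, hz'⟩ | hz'
  · rw [hK.glue1 hi hz', hK.glue1 hi hz']
    constructor <;> split_ifs
    · exact (hc i hi z hz).1
    · simpa using hc0
    · exact (hc i hi z hz).2
    · simpa using hc0
  · rw [hK.glue2 hi hz', hK.glue2 hi hz']
    constructor <;> split_ifs
    · exact (hc i hi z hz).1
    · simpa using hc0
    · exact (hc i hi z hz).2
    · simpa using hc0
  · rw [KernelData.glue0 hz', KernelData.glue0 hz']
    simpa using hc0

omit h1 h2 in
theorem perData_FG_of_notMem {z : ℂ} (hz : z ∉ betheRoots ζ) (n : Fin (m + 1)) :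
    ((perData ζ).family m).F z n = 0 ∧ ((perData ζ).family m).G z n = 0 := by
  have hz' : ∀ j ∈ Finset.Icc 1 m, z ∉ (perData ζ).set1 j ∧ z ∉ (perData ζ).set2 j := fun j hj =>
    ⟨fun h => hz (Set.mem_iUnion₂.2 ⟨j, hj, Or.inl h⟩),
      fun h => hz (Set.mem_iUnion₂.2 ⟨j, hj, Or.inr h⟩)⟩
  rw [KernelData.family_F, KernelData.family_G, KernelData.glue0 hz', KernelData.glue0 hz']
  exact ⟨rfl, rfl⟩

/-- The determinant of the periodic KPZ fixed point is cubic admissible. -/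
theorem perData_fredholm (hp : p ∈ perRegion m) : (perData ζ).WellDefined m p ∧
    ((perData ζ).family m).IsCubicIntegrable p ∧ IsTraceClass (((perData ζ).family m).operator p) ∧
      HasFredholmDet (((perData ζ).family m).operator p) ((perData ζ).det m p) := by
  have hK := perData_hasCells h1 h2
  have hS := countable_betheRoots h1
  have hsum := summable_betheRoots h1
  have : SigmaFinite (perData ζ).Ω.absMeasure := sigmaFinite_discrete hS
  obtain ⟨a, ha0, ha⟩ := exists_halfExp_le_of_mem h1 h2 hp
  obtain ⟨c, hc0, hc⟩ := exists_norm_FG_le h1 h2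
  obtain ⟨s, hs0, hs⟩ := exists_inv_norm_sub_le h1 h2
  set w : ℂ → ℝ := fun z => (1 + ‖z‖)⁻¹ with hw
  have hw0 : ∀ z, 0 < w z := fun z => by positivity
  have hw1 : ∀ z, w z ≤ 1 := fun z => inv_le_one_of_one_le₀ (by linarith [norm_nonneg z])
  have hf : ∀ z ∈ betheRoots ζ, ∀ n, ‖((perData ζ).family m).f p z n‖ ≤ a * c * w z ^ 6 := by
    intro z hz n
    rw [hK.f_eq, norm_mul]
    refine (mul_le_mul (ha z hz) (hc z hz n).1 (norm_nonneg _) (by positivity)).trans (le_of_eq ?_)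
    ring
  have hg : ∀ z ∈ betheRoots ζ, ∀ n, ‖((perData ζ).family m).g p z n‖ ≤ a * c * w z ^ 6 := by
    intro z hz n
    rw [hK.g_eq, norm_mul]
    refine (mul_le_mul (ha z hz) (hc z hz n).2 (norm_nonneg _) (by positivity)).trans (le_of_eq ?_)
    ring
  -- Adding 1 makes the dominating function strictly positive and ensures D ≤ D², so that the
  -- constant can be shared by the two factors.
  set D := (m + 1) * (a * c) ^ 2 * s + 1 with hD
  have hD1 : 1 ≤ D := by
    have : 0 ≤ (m + 1) * (a * c) ^ 2 * s := by positivity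
    linarith
  have hker : ∀ u ∈ betheRoots ζ, ∀ v ∈ betheRoots ζ,
      ‖((perData ζ).family m).kernel p u v‖ ≤ (D * w u ^ 4) * (D * w v ^ 4) := by
    intro u hu v hv
    have hpu := pow_pos (hw0 u) 4
    have hpv := pow_pos (hw0 v) 4
    rw [CubicFamily.kernel]
    split_ifs with huv
    · rw [norm_zero]
      positivity
    · have e1 : ‖∑ i, ((perData ζ).family m).f p u i * ((perData ζ).family m).g p v i‖ ≤
          (m + 1) * ((a * c * w u ^ 6) * (a * c * w v ^ 6)) := by
        refine (norm_sum_le_of_le _ fun i _ => (norm_mul_le _ _).trans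
          (mul_le_mul (hf u hu i) (hg v hv i) (norm_nonneg _) (by positivity))).trans ?_
        simp
      have e2 := hs u hu v hv huv
      have e3 : (1 + ‖u‖) * w u = 1 := mul_inv_cancel₀ (by positivity)
      have e4 : (1 + ‖v‖) * w v = 1 := mul_inv_cancel₀ (by positivity)
      rw [norm_div, div_eq_mul_inv]
      calc _ ≤ (m + 1) * ((a * c * w u ^ 6) * (a * c * w v ^ 6)) *
            (s * ((1 + ‖u‖) * (1 + ‖v‖))) := mul_le_mul e1 e2 (by positivity) (by positivity)
        _ = ((m + 1) * (a * c) ^ 2 * s) * (w u ^ 5 * w v ^ 5) * (((1 + ‖u‖) * w u) *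
            ((1 + ‖v‖) * w v)) := by ring
        _ = ((m + 1) * (a * c) ^ 2 * s) * (w u ^ 5 * w v ^ 5) := by rw [e3, e4]; ring
        _ ≤ (D * D) * (w u ^ 4 * w v ^ 4) := by
            refine mul_le_mul ?_ (mul_le_mul ?_ ?_ (by positivity) hpu.le) (by positivity)
              (by positivity)
            · have : (m + 1) * (a * c) ^ 2 * s ≤ D := by linarith
              nlinarith
            · exact pow_le_pow_of_le_one (hw0 u).le (hw1 u) (by norm_num)
            · exact pow_le_pow_of_le_one (hw0 v).le (hw1 v) (by norm_num)
        _ = _ := by ring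
  obtain ⟨φ, ψ, hφ, hψ, hH⟩ := exists_sqFamily_discrete hS
    (K := ((perData ζ).family m).kernel p) (b := fun z => D * w z ^ 4)
    (fun z _ => by
      have := pow_pos (hw0 z) 4
      positivity) (hsum.mul_left D) (fun u v huv => by
      rw [CubicFamily.kernel]
      split_ifs
      · rfl
      · rw [Finset.sum_eq_zero fun n _ => ?_, zero_div]
        rw [hK.f_eq, hK.g_eq]
        rw [not_and_or] at huv
        rcases huv with hu | hv
        · rw [(perData_FG_of_notMem hu n).1]
          ring
        · rw [(perData_FG_of_notMem hv n).2]
          ring) hker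
  have : Countable (betheRoots ζ) := hS.to_subtype
  obtain ⟨r1, r2, r3, r4⟩ := hK.fredholm (p := p) (phaseRegular_discrete hS) hφ hψ hH
  have hL2 : ∀ F : ℂ → ℂ, (∀ z ∈ betheRoots ζ, ‖F z‖ ≤ a * c * w z ^ 6) →
      MemLp F 2 (perData ζ).Ω.absMeasure ∧ MemLp F ⊤ (perData ζ).Ω.absMeasure := fun F hF => by
    constructor
    · refine (memLp_discrete hS (Summable.of_nonneg_of_le (fun _ => sq_nonneg _) (fun z => ?_)
        (hsum.mul_left ((a * c) ^ 2)))).1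
      refine (pow_le_pow_left₀ (norm_nonneg _) (hF z z.2) 2).trans ?_
      rw [mul_pow, ← pow_mul]
      exact mul_le_mul_of_nonneg_left (pow_le_pow_of_le_one (hw0 z).le (hw1 z) (by norm_num))
        (sq_nonneg _)
    · refine memLp_top_discrete hS (c := a * c) fun z hz => (hF z hz).trans ?_
      exact mul_le_of_le_one_right (by positivity) (pow_le_one₀ (hw0 z).le (hw1 z))
  exact ⟨r1, ⟨not_accPt_betheRoots h1, fun u _ i => hK.orthogonal u i, fun u hu => hK.c_ne_zero hu,
    fun i => (hL2 _ fun z hz => hf z hz i).1, fun i => (hL2 _ fun z hz => hf z hz i).2,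
    fun i => (hL2 _ fun z hz => hg z hz i).1, fun i => (hL2 _ fun z hz => hg z hz i).2, r2⟩, r3, r4⟩

omit h1 h2 in
theorem perDet_eq (ζ : Fin m → ℂ) (p : CubicParams m) :
    perDet ζ p.x (fun i => 2 * p.y i) (fun i => -3 * p.t i) = (perData ζ).det m p := by
  have : perParams p.x (fun i => 2 * p.y i) (fun i => -3 * p.t i) = p := by
    obtain ⟨x, y, t⟩ := p
    simp only [perParams]
    congr 1
    · ext i
      ring
    · ext i
      ring
  rw [perDet, this]

end Periodic

end KPZ

/-! ### Transposes of integral operators. -/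

namespace KPZ

section Transpose

variable {X : Type} [MeasurableSpace X] {μ : Measure X} [SigmaFinite μ] {J : Type} [Countable J]
  {φ ψ : J → X → ℂ}

theorem hasSum_integral_kernelOperator (hφ : SqFamily μ φ) (hψ : SqFamily μ ψ)
    {T : Lp ℂ 2 μ →L[ℂ] Lp ℂ 2 μ}
    (hT : ∀ f : Lp ℂ 2 μ, HasSum (fun n => (inner ℂ ((hψ.conj.memLp n).toLp _) f : ℂ) •
        (hφ.memLp n).toLp (φ n)) (T f)) (f g : Lp ℂ 2 μ) :
    HasSum (fun n => (∫ x, ψ n x * f x ∂μ) * ∫ x, g x * φ n x ∂μ) (∫ x, g x * T f x ∂μ) := by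
  have hin : ∀ h : Lp ℂ 2 μ, inner ℂ ((Lp.memLp g).star.toLp _) h = ∫ x, g x * h x ∂μ := fun h => by
    rw [L2.inner_def]
    refine integral_congr_ae ?_
    filter_upwards [(Lp.memLp g).star.coeFn_toLp] with x hx
    rw [hx, RCLike.inner_apply, mul_comm]
    simp
  have h := (innerSL ℂ ((Lp.memLp g).star.toLp _)).hasSum (hT f)
  simp only [innerSL_apply_apply, inner_smul_right] at h
  simp only [hin] at h
  have e : ∀ n, ∫ x, g x * (hφ.memLp n).toLp (φ n) x ∂μ = ∫ x, g x * φ n x ∂μ := fun n =>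
    integral_congr_ae ((hφ.memLp n).coeFn_toLp.mono fun x hx => by simp only [hx])
  have e' : ∀ n, inner ℂ ((hψ.conj.memLp n).toLp _) f = ∫ x, ψ n x * f x ∂μ := fun n => by
    rw [L2.inner_def]
    refine integral_congr_ae ?_
    filter_upwards [(hψ.conj.memLp n).coeFn_toLp] with x hx
    rw [hx, RCLike.inner_apply, mul_comm]
    simp
  simpa only [e, e'] using h

/-- Transposition of an integral operator. -/
theorem exists_kernelOperator_transpose (hφ : SqFamily μ φ) (hψ : SqFamily μ ψ) :
    ∃ T S : Lp ℂ 2 μ →L[ℂ] Lp ℂ 2 μ,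
      (∀ f : Lp ℂ 2 μ, ∀ᵐ x ∂μ, Integrable (fun y => (∑' n, φ n x * ψ n y) * f y) μ ∧
        T f x = ∫ y, (∑' n, φ n x * ψ n y) * f y ∂μ) ∧
      (∀ g : Lp ℂ 2 μ, ∀ᵐ y ∂μ, Integrable (fun x => (∑' n, φ n x * ψ n y) * g x) μ ∧
        S g y = ∫ x, (∑' n, φ n x * ψ n y) * g x ∂μ) ∧
      ∀ f g : Lp ℂ 2 μ, ∫ x, g x * T f x ∂μ = ∫ x, f x * S g x ∂μ := by
  obtain ⟨T, hT, hTi⟩ := exists_kernelOperator hφ hψ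
  obtain ⟨S, hS, hSi⟩ := exists_kernelOperator hψ hφ
  refine ⟨T, S, hTi, fun g => ?_, fun f g => ?_⟩
  · filter_upwards [hSi g] with y hy
    simpa only [mul_comm (ψ _ y)] using hy
  · have h1 := hasSum_integral_kernelOperator hφ hψ hT f g
    have h2 := hasSum_integral_kernelOperator hψ hφ hS g f
    rw [← h1.tsum_eq, ← h2.tsum_eq]
    refine tsum_congr fun n => ?_
    rw [mul_comm]
    simp only [mul_comm]

end Transpose

/-! ### Resolvents and `Y1` under a reflection. -/

section Reflection

variable {X : Type} [MeasurableSpace X] {μ : Measure X} {σ : X → X}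

theorem memLp_reflect (hσ : MeasurePreserving σ μ μ) {k f : X → ℂ}
    (hk : AEStronglyMeasurable k μ) {c : ℝ} (hc : ∀ᵐ x ∂μ, ‖k x‖ ≤ c) (hf : MemLp f 2 μ) :
    MemLp (fun x => k x * f (σ x)) 2 μ :=
  MemLp.of_le_mul (c := c) (hf.comp_measurePreserving hσ) (hk.mul (hf.comp_measurePreserving hσ).1) (by
    filter_upwards [hc] with x hx
    rw [norm_mul]
    exact mul_le_mul_of_nonneg_right hx (norm_nonneg _))

/-- If two operators are transposes of each other with respect to a bounded, nowhere degenerate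
bilinear form `∫ k(x) f(x) g(σ x)`, then so are the inverses of `1 - T` and `1 - T'`. -/
theorem isUnit_one_sub_of_reflect (hσ : MeasurePreserving σ μ μ) (hσ2 : ∀ x, σ (σ x) = x)
    {k : X → ℂ} (hk : AEStronglyMeasurable k μ) {c : ℝ} (hc : ∀ᵐ x ∂μ, ‖k x‖ ≤ c)
    (hc' : ∀ᵐ x ∂μ, ‖(k x)⁻¹‖ ≤ c) (h0 : ∀ᵐ x ∂μ, k x ≠ 0) {T T' : Lp ℂ 2 μ →L[ℂ] Lp ℂ 2 μ}
    (hT : ∀ f g : Lp ℂ 2 μ, ∫ x, k x * g (σ x) * T f x ∂μ = ∫ x, k x * T' g (σ x) * f x ∂μ)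
    (h1 : IsUnit (1 - T)) :
    IsUnit (1 - T') ∧ ∀ f g : Lp ℂ 2 μ, ∫ x, k x * g (σ x) * Ring.inverse (1 - T) f x ∂μ =
      ∫ x, k x * Ring.inverse (1 - T') g (σ x) * f x ∂μ := by
  have hq := hσ.quasiMeasurePreserving
  have hmem : ∀ g : Lp ℂ 2 μ, MemLp (fun x => (starRingEnd ℂ) (k x * g (σ x))) 2 μ := fun g =>
    (memLp_reflect hσ hk hc (Lp.memLp g)).star
  -- `R g` is the Riesz vector of the functional f ↦ ∫ k(x) g(σ x) f(x). Since k and 1/k are bounded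
  -- and σ is an involution, `R` is a bijection, additive but antilinear.
  let R : Lp ℂ 2 μ → Lp ℂ 2 μ := fun g => (hmem g).toLp _
  have hR : ∀ g, R g =ᵐ[μ] fun x => (starRingEnd ℂ) (k x * g (σ x)) := fun g =>
    (hmem g).coeFn_toLp
  have hin : ∀ f g : Lp ℂ 2 μ, inner ℂ (R g) f = ∫ x, k x * g (σ x) * f x ∂μ := fun f g => by
    rw [L2.inner_def]
    refine integral_congr_ae ?_
    filter_upwards [hR g] with x hx
    rw [hx, RCLike.inner_apply, mul_comm]
    simp
  have hsub : ∀ g g', R (g - g') = R g - R g' := fun g g' => by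
    refine Lp.ext ?_
    filter_upwards [hR (g - g'), hR g, hR g', Lp.coeFn_sub (R g) (R g'),
      hq.ae (Lp.coeFn_sub g g')] with x e1 e2 e3 e4 e5
    rw [e4, e1, Pi.sub_apply, e2, e3, e5, Pi.sub_apply, ← map_sub, mul_sub]
  have hsurj : Function.Surjective R := fun χ => by
    have hk' : AEStronglyMeasurable (fun x => (k (σ x))⁻¹) μ := by
      have := hk.comp_quasiMeasurePreserving hq
      exact (this.aemeasurable.inv).aestronglyMeasurable
    have hm := memLp_reflect hσ hk' (c := c) (hq.ae hc') (Lp.memLp χ).star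
    refine ⟨hm.toLp _, Lp.ext ?_⟩
    filter_upwards [hR (hm.toLp _), hq.ae hm.coeFn_toLp, h0] with x e1 e2 e3
    rw [e1, e2, hσ2]
    simp [e3]
  have hinj : Function.Injective R := fun g g' h => by
    refine Lp.ext ?_
    have h2 : ∀ᵐ x ∂μ, g (σ x) = g' (σ x) := by
      filter_upwards [hR g, hR g', h0] with x e1 e2 e3
      rw [h, e2] at e1
      exact (mul_left_cancel₀ e3 ((starRingEnd ℂ).injective e1)).symm
    filter_upwards [hq.ae h2] with x hx
    simpa only [hσ2] using hx
  -- Through `R` the operator 1 - T' is conjugate to the adjoint of 1 - T, so invertibility passes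
  -- from one to the other.
  have hadj : ∀ g, ContinuousLinearMap.adjoint (1 - T) (R g) = R ((1 - T') g) := fun g => by
    refine ext_inner_right ℂ fun f => ?_
    rw [ContinuousLinearMap.adjoint_inner_left, sub_apply, sub_apply, hsub, inner_sub_left,
      inner_sub_right]
    simp only [hin, hT, one_apply_eq_self]
  have hu : IsUnit (ContinuousLinearMap.adjoint (1 - T)) := by
    rw [← ContinuousLinearMap.star_eq_adjoint]
    exact h1.star
  have hb := ContinuousLinearMap.isUnit_iff_bijective.1 hu
  have hbij : Function.Bijective ⇑(1 - T') := by
    have h3 : Function.Bijective (R ∘ ⇑(1 - T')) := by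
      have : R ∘ ⇑(1 - T') = ⇑(ContinuousLinearMap.adjoint (1 - T)) ∘ R :=
        funext fun g => (hadj g).symm
      rw [this]
      exact hb.comp ⟨hinj, hsurj⟩
    exact (Function.Bijective.of_comp_iff' ⟨hinj, hsurj⟩ _).1 h3
  have hu' := ContinuousLinearMap.isUnit_iff_bijective.2 hbij
  refine ⟨hu', fun f g => ?_⟩
  have e1 : (1 - T) (Ring.inverse (1 - T) f) = f :=
    congrArg (fun A : Lp ℂ 2 μ →L[ℂ] Lp ℂ 2 μ => A f) (Ring.mul_inverse_cancel _ h1)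
  have e2 : (1 - T') (Ring.inverse (1 - T') g) = g :=
    congrArg (fun A : Lp ℂ 2 μ →L[ℂ] Lp ℂ 2 μ => A g) (Ring.mul_inverse_cancel _ hu')
  rw [← hin, ← hin]
  conv_lhs => rw [← e2, ← hadj, ContinuousLinearMap.adjoint_inner_left, e1]

end Reflection

/-- A reflection of the set `Ω` that interchanges two kernels, up to conjugation by a function. -/
structure SpectralSet.IsReflection (Ω : SpectralSet) (ρ : ℂ → ℂ) (c : ℝ) : Prop where
  preserving : MeasurePreserving (fun z : ℂ => -z) Ω.absMeasure Ω.absMeasure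
  meas : Measurable ρ
  ae_mem : ∀ᵐ z ∂Ω.absMeasure, z ∈ Ω.carrier
  phase_neg : ∀ z ∈ Ω.carrier, Ω.phase (-z) = Ω.phase z
  norm_phase : ∀ᵐ z ∂Ω.absMeasure, ‖Ω.phase z‖ = 1
  ne_zero : ∀ z ∈ Ω.carrier, ρ z ≠ 0
  norm_le : ∀ z ∈ Ω.carrier, ‖ρ z‖ ≤ c
  norm_inv_le : ∀ z ∈ Ω.carrier, ‖(ρ z)⁻¹‖ ≤ c

section

variable {Ω : SpectralSet} [SigmaFinite Ω.absMeasure] {J : Type} [Countable J]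
  {φ ψ : J → ℂ → ℂ} {ρ : ℂ → ℂ} {c : ℝ}

/-- Transposing T under the bilinear integral and substituting x ↦ -x turns the kernel K into the
conjugate of K' given by the hypothesis. The phase is unaffected because it is even. -/
theorem SpectralSet.IsReflection.integral_eq (hR : Ω.IsReflection ρ c) (hΩ : Ω.PhaseRegular)
    (hφ : SqFamily Ω.absMeasure φ) (hψ : SqFamily Ω.absMeasure ψ) {K K' : ℂ → ℂ → ℂ}
    (hK : ∀ u v, K u v = ∑' n, φ n u * ψ n v) {T T' : Ω.L2 →L[ℂ] Ω.L2}
    (hT : Ω.IsIntegralOperator K T) (hT' : Ω.IsIntegralOperator K' T')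
    (hKK' : ∀ u ∈ Ω.carrier, ∀ v ∈ Ω.carrier, ρ v * K' (-v) (-u) = ρ u * K u v) (f g : Ω.L2) :
    ∫ x, ρ x * Ω.phase x * g (-x) * T f x ∂Ω.absMeasure =
      ∫ x, ρ x * Ω.phase x * T' g (-x) * f x ∂Ω.absMeasure := by
  have hq := hR.preserving.quasiMeasurePreserving
  obtain ⟨T₁, S, h1, h2, h3⟩ := exists_kernelOperator_transpose hφ (hψ.mul hΩ.meas hΩ.norm_le)
  have hker : ∀ u v, ∑' n, φ n u * (Ω.phase v * ψ n v) = K u v * Ω.phase v := fun u v => by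
    rw [hK, ← tsum_mul_right]
    exact tsum_congr fun n => by ring
  simp only [hker] at h1 h2
  have hTT : T = T₁ := hT.unique fun f => by
    filter_upwards [h1 f] with x hx
    refine ⟨hx.1.congr (ae_of_all _ fun v => by ring), hx.2.trans ?_⟩
    exact integral_congr_ae (ae_of_all _ fun v => by ring)
  have hkn : ∀ᵐ x ∂Ω.absMeasure, ‖ρ x * Ω.phase x‖ ≤ c := by
    filter_upwards [hR.ae_mem, hR.norm_phase] with x hx hx'
    rw [norm_mul, hx', mul_one]
    exact hR.norm_le x hx
  have hm := memLp_reflect hR.preserving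
    (hR.meas.aestronglyMeasurable.mul hΩ.meas) hkn (Lp.memLp g)
  have h4 := h3 f (hm.toLp _)
  rw [← hTT] at h4
  have e1 : ∫ x, hm.toLp _ x * T f x ∂Ω.absMeasure =
      ∫ x, ρ x * Ω.phase x * g (-x) * T f x ∂Ω.absMeasure := by
    refine integral_congr_ae ?_
    filter_upwards [hm.coeFn_toLp] with x hx
    rw [hx, Pi.mul_apply]
  rw [← e1, h4]
  refine integral_congr_ae ?_
  filter_upwards [h2 (hm.toLp _), hq.ae (hT' g), hR.ae_mem] with v hv hv' hvm
  rw [hv.2, hv'.2, mul_comm]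
  congr 1
  conv_rhs => rw [SpectralSet.integral, ← hR.preserving.integral_comp
    (MeasurableEquiv.neg ℂ).measurableEmbedding, ← integral_const_mul]
  refine integral_congr_ae ?_
  filter_upwards [hm.coeFn_toLp, hR.ae_mem] with u hu hum
  rw [hu, Pi.mul_apply, hR.phase_neg u hum]
  linear_combination (-Ω.phase v * Ω.phase u * g (-u)) * hKK' u hum v hvm

/-- If the vectors `f, g` at the parameters `p` and `p'` are exchanged by a reflection, then the
two operators are transposes of each other, and so are the matrices `Y₁`, up to conjugation. -/
theorem CubicFamily.Y1_of_isReflection {m : ℕ} (D : CubicFamily m) [SigmaFinite D.Ω.absMeasure]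
    (hR : D.Ω.IsReflection ρ c) (hΩ : D.Ω.PhaseRegular) {p p' : CubicParams m}
    (hφ : SqFamily D.Ω.absMeasure φ) (hψ : SqFamily D.Ω.absMeasure ψ)
    (hK : ∀ u v, D.kernel p u v = ∑' n, φ n u * ψ n v)
    (hp : D.IsCubicIntegrable p) (hp' : D.IsCubicIntegrable p') {l : Fin (m + 1) → ℂ}
    (hl : ∀ i, l i ≠ 0) (hg : ∀ z ∈ D.Ω.carrier, ∀ i, D.g p z i = ρ z * l i * D.f p' (-z) i)
    (hg' : ∀ z ∈ D.Ω.carrier, ∀ i, D.g p' (-z) i = ρ z * l i * D.f p z i)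
    (hu : IsUnit (1 - D.operator p)) :
    IsUnit (1 - D.operator p') ∧
      Matrix.diagonal l * D.Y1 p * (Matrix.diagonal l)⁻¹ = (D.Y1 p').transpose := by
  obtain ⟨T, hT⟩ := hp.bounded
  obtain ⟨T', hT'⟩ := hp'.bounded
  -- Inserting the two relations between f and g makes both numerators equal to ρ(u)ρ(v) ∑ l_i
  -- f_i(p, u) f_i(p', -v), and the denominators agree.
  have hker : ∀ u ∈ D.Ω.carrier, ∀ v ∈ D.Ω.carrier,
      ρ v * D.kernel p' (-v) (-u) = ρ u * D.kernel p u v := fun u hu v hv => by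
    rw [CubicFamily.kernel, CubicFamily.kernel]
    by_cases h : u = v
    · simp [h]
    · rw [if_neg (fun h' => h (neg_injective h').symm), if_neg h, ← mul_div_assoc,
        ← mul_div_assoc, Finset.mul_sum, Finset.mul_sum, neg_sub_neg]
      congr 1
      refine Finset.sum_congr rfl fun i _ => ?_
      rw [hg v hv, hg' u hu]
      ring
  have hkn : ∀ᵐ x ∂D.Ω.absMeasure, ‖ρ x * D.Ω.phase x‖ ≤ c := by
    filter_upwards [hR.ae_mem, hR.norm_phase] with x hx hx'
    rw [norm_mul, hx', mul_one]
    exact hR.norm_le x hx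
  have hkn' : ∀ᵐ x ∂D.Ω.absMeasure, ‖(ρ x * D.Ω.phase x)⁻¹‖ ≤ c := by
    filter_upwards [hR.ae_mem, hR.norm_phase] with x hx hx'
    rw [mul_inv, norm_mul, norm_inv (D.Ω.phase x), hx', inv_one, mul_one]
    exact hR.norm_inv_le x hx
  have hk0 : ∀ᵐ x ∂D.Ω.absMeasure, ρ x * D.Ω.phase x ≠ 0 := by
    filter_upwards [hR.ae_mem, hR.norm_phase] with x hx hx'
    refine mul_ne_zero (hR.ne_zero x hx) fun h => ?_
    rw [h, norm_zero] at hx'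
    exact zero_ne_one hx'
  have hq := hR.preserving.quasiMeasurePreserving
  rw [D.operator_eq hT] at hu
  obtain ⟨h1, h2⟩ := isUnit_one_sub_of_reflect hR.preserving neg_neg
    (hR.meas.aestronglyMeasurable.mul hΩ.meas) hkn hkn' hk0
    (fun f g => hR.integral_eq hΩ hφ hψ hK hT hT' hker f g) hu
  rw [D.operator_eq hT']
  refine ⟨h1, ?_⟩
  have hf : ∀ i, D.Ω.toL2 (fun u => D.f p u i) =ᵐ[D.Ω.absMeasure] fun u => D.f p u i := fun i => by
    rw [SpectralSet.toL2, dif_pos (hp.f_memL2 i)]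
    exact (hp.f_memL2 i).coeFn_toLp
  have hf' : ∀ i, D.Ω.toL2 (fun u => D.f p' u i) =ᵐ[D.Ω.absMeasure] fun u => D.f p' u i :=
    fun i => by
      rw [SpectralSet.toL2, dif_pos (hp'.f_memL2 i)]
      exact (hp'.f_memL2 i).coeFn_toLp
  -- Both sides are l_i l_j times the two sides of the resolvent identity for f_i at p and f_j at
  -- p'.
  have key : ∀ i j, D.Y1 p i j * l i = l j * D.Y1 p' j i := fun i j => by
    have e1 : D.Y1 p i j = l j * ∫ x, ρ x * D.Ω.phase x * D.Ω.toL2 (fun u => D.f p' u j) (-x) *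
        Ring.inverse (1 - T) (D.Ω.toL2 fun u => D.f p u i) x ∂D.Ω.absMeasure := by
      rw [CubicFamily.Y1, Matrix.of_apply, D.operator_eq hT, SpectralSet.integral,
        ← integral_const_mul]
      refine integral_congr_ae ?_
      filter_upwards [hR.ae_mem, hq.ae (hf' j)] with x hx hx'
      rw [hx', hg x hx]
      ring
    have e2 : D.Y1 p' j i = l i * ∫ x, ρ x * D.Ω.phase x *
        Ring.inverse (1 - T') (D.Ω.toL2 fun u => D.f p' u j) (-x) *
          D.Ω.toL2 (fun u => D.f p u i) x ∂D.Ω.absMeasure := by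
      rw [CubicFamily.Y1, Matrix.of_apply, D.operator_eq hT', SpectralSet.integral,
        ← hR.preserving.integral_comp (MeasurableEquiv.neg ℂ).measurableEmbedding,
        ← integral_const_mul]
      refine integral_congr_ae ?_
      filter_upwards [hR.ae_mem, hf i] with x hx hx'
      rw [hx', hg' x hx, hR.phase_neg x hx]
      ring
    simp only [Pi.mul_apply] at h2
    rw [e1, e2, h2]
    ring
  have hinv : (Matrix.diagonal l)⁻¹ = Matrix.diagonal fun i => (l i)⁻¹ := by
    refine Matrix.inv_eq_right_inv ?_
    rw [Matrix.diagonal_mul_diagonal, ← Matrix.diagonal_one]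
    congr 1
    ext i
    exact mul_inv_cancel₀ (hl i)
  ext i j
  rw [hinv, Matrix.mul_diagonal, Matrix.diagonal_mul, Matrix.transpose_apply]
  have := hl j
  field_simp
  linear_combination key i j

end

end KPZ

/-! ### Reflection of the contours and the weights `L_j`. -/

namespace KPZ

section GraphReflection

variable {Q : Type} [Finite Q] {ψ : Q → ℝ → ℝ} {τ : Q ≃ Q}
  (hτ : ∀ q s, graphCurve (ψ (τ q)) s = -graphCurve (ψ q) (-s))
include hτ

theorem deriv_graphCurve_reflect (q : Q) (s : ℝ) :
    deriv (graphCurve (ψ (τ q))) s = deriv (graphCurve (ψ q)) (-s) := by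
  have h : graphCurve (ψ (τ q)) = fun s => -graphCurve (ψ q) (-s) := funext (hτ q)
  rw [h, deriv.fun_neg, deriv_comp_neg, neg_neg]

theorem measurePreserving_neg_graphSet (h : ∀ q, Continuous (ψ q)) :
    MeasurePreserving (fun z : ℂ => -z) (graphSet ψ).absMeasure (graphSet ψ).absMeasure := by
  refine ⟨measurable_neg, Measure.ext_of_lintegral _ fun G hG => ?_⟩
  rw [lintegral_map hG measurable_neg, graphSet, SpectralSet.absMeasure, lintegral_sum_measure,
    lintegral_sum_measure]
  conv_rhs => rw [← τ.tsum_eq]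
  refine tsum_congr fun q => ?_
  have hG' : Measurable fun z : ℂ => G (-z) := hG.comp measurable_neg
  refine (lintegral_arcMeasure (h _) hG').trans
    (Eq.trans ?_ (lintegral_arcMeasure (h (τ q)) hG).symm)
  simp only [hτ, deriv_graphCurve_reflect hτ]
  exact ((Measure.measurePreserving_neg (volume : Measure ℝ)).lintegral_comp_emb
      (MeasurableEquiv.neg ℝ).measurableEmbedding
      fun s => ‖deriv (graphCurve (ψ q)) s‖ₑ * G (-graphCurve (ψ q) s)).symm

/-- The map z ↦ -z reverses the tangent and the reversed parametrization reverses it again. -/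
theorem phase_neg_graphSet
    (hd : ∀ q q', q ≠ q' → Disjoint (Set.range (graphCurve (ψ q))) (Set.range (graphCurve (ψ q'))))
    {z : ℂ} (hz : z ∈ (graphSet ψ).carrier) :
    (graphSet ψ).phase (-z) = (graphSet ψ).phase z := by
  rw [carrier_graphSet, Set.mem_iUnion] at hz
  obtain ⟨q, s, rfl⟩ := hz
  have e : -graphCurve (ψ q) s = graphCurve (ψ (τ q)) (-s) := by rw [hτ, neg_neg]
  rw [e]
  rw [phase_graphSet hd, phase_graphSet hd, unitTangent, unitTangent,
    deriv_graphCurve_reflect hτ, neg_neg]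

-- Parameters with zero derivative, including points of non-differentiability by the convention for
-- `deriv`, carry no arc length.
omit hτ in
theorem norm_phase_graphSet (h : ∀ q, Continuous (ψ q))
    (hd : ∀ q q', q ≠ q' → Disjoint (Set.range (graphCurve (ψ q))) (Set.range (graphCurve (ψ q')))) :
    ∀ᵐ z ∂(graphSet ψ).absMeasure, ‖(graphSet ψ).phase z‖ = 1 := by
  have := Finite.to_countable (α := Q)
  change ∀ᵐ z ∂(Measure.sum fun q => ParamCurve.arcMeasure ⟨Set.univ, graphCurve (ψ q)⟩), _
  rw [Measure.ae_sum_iff]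
  intro q
  rw [ParamCurve.arcMeasure, ((continuous_graphCurve (h q)).measurableEmbedding
    graphCurve_injective).ae_map_iff, ae_withDensity_iff (measurable_deriv _).enorm]
  refine ae_of_all _ fun s hs => ?_
  have hs' : deriv (graphCurve (ψ q)) s ≠ 0 := fun h0 => hs (by
    simp only [h0, enorm_zero])
  rw [phase_graphSet hd, unitTangent, norm_div, Complex.norm_real, norm_norm]
  exact div_self (norm_ne_zero_iff.2 hs')

end GraphReflection

section Weights

variable {m : ℕ} (ζ : Fin (m - 1) → ℂ)

/-- The diagonal entries of `L`, with the last one labelled `0`. -/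
noncomputable def weightL (k : ℕ) : ℂ :=
  (-1) ^ k * (∏ i ∈ Finset.Icc 1 k, oneSub ζ i) / ∏ i ∈ Finset.Icc 1 (k - 1), oneSubInv ζ i

/-- The diagonal of `L`. -/
noncomputable def diagL (i : Fin (m + 1)) : ℂ :=
  if (i : ℕ) < m then
    (-1) ^ ((i : ℕ) + 1) * (∏ k ∈ Finset.Icc 1 ((i : ℕ) + 1), oneSub ζ k) /
      ∏ k ∈ Finset.Icc 1 (i : ℕ), oneSubInv ζ k
  else 1

theorem diagL_idx {k : ℕ} (hk : k ≤ m) : diagL ζ (idx m k) = weightL ζ k := by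
  rw [diagL, idx, weightL]
  by_cases h : 1 ≤ k
  · rw [dif_pos ⟨h, hk⟩]
    simp only
    rw [if_pos (by omega), show k - 1 + 1 = k by omega]
  · have : k = 0 := by omega
    subst this
    simp

variable (hζ : ∀ i, 0 < ‖ζ i‖ ∧ ‖ζ i‖ < 1)
include hζ

theorem oneSub_ne_zero (j : ℕ) : oneSub ζ j ≠ 0 := by
  rw [oneSub]
  split_ifs with h
  · intro h0
    have := (hζ ⟨j - 1, by omega⟩).2
    rw [← sub_eq_zero.1 h0, norm_one] at this
    exact lt_irrefl _ this
  · exact one_ne_zero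

theorem oneSubInv_ne_zero (j : ℕ) : oneSubInv ζ j ≠ 0 := by
  rw [oneSubInv]
  split_ifs with h
  · intro h0
    have := (hζ ⟨j - 1, by omega⟩).2
    have h1 := sub_eq_zero.1 h0
    rw [one_div] at h1
    rw [inv_eq_one.1 h1.symm, norm_one] at this
    exact lt_irrefl _ this
  · exact one_ne_zero

theorem weightL_ne_zero (k : ℕ) : weightL ζ k ≠ 0 :=
  div_ne_zero (mul_ne_zero (pow_ne_zero _ (by norm_num))
    (Finset.prod_ne_zero_iff.2 fun _ _ => oneSub_ne_zero ζ hζ _))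
    (Finset.prod_ne_zero_iff.2 fun _ _ => oneSubInv_ne_zero ζ hζ _)

theorem diagL_ne_zero (i : Fin (m + 1)) : diagL ζ i ≠ 0 := by
  rw [diagL]
  split_ifs with h
  · exact weightL_ne_zero ζ hζ ((i : ℕ) + 1)
  · exact one_ne_zero

/-- This recursion, with L_0 = 1, is what determines L: its coefficients are the values of Q_j on
`Ω_{1,j}` and on `Ω_{2,j}`, up to sign. -/
theorem weightL_mul {j : ℕ} (hj : 1 ≤ j) :
    weightL ζ j * oneSubInv ζ (j - 1) = -oneSub ζ j * weightL ζ (j - 1) := by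
  obtain ⟨n, rfl⟩ := Nat.exists_eq_add_of_le' hj
  rw [weightL, weightL, Nat.add_sub_cancel, Finset.prod_Icc_succ_top (by omega), pow_succ]
  have h0 := Finset.prod_ne_zero_iff.2 fun i (_ : i ∈ Finset.Icc 1 (n - 1)) =>
    oneSubInv_ne_zero ζ hζ i
  have h1 := oneSubInv_ne_zero ζ hζ n
  rcases Nat.eq_zero_or_pos n with rfl | hn
  · simp [oneSubInv]
  · obtain ⟨k, rfl⟩ : ∃ k, n = k + 1 := ⟨n - 1, by omega⟩
    simp only [Nat.add_sub_cancel] at h0 ⊢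
    rw [Finset.prod_Icc_succ_top (by omega : 1 ≤ k + 1) (oneSubInv ζ)]
    field_simp

end Weights

end KPZ

/-! ### The symmetry of `Y1` for the KPZ fixed point. -/

namespace KPZ

namespace ContourSystem

variable {C : ContourSystem} {m : ℕ}

/-- The exchange of the left and the right contours. -/
def flip (m : ℕ) : Label m ≃ Label m := Equiv.boolNot.prodCongr (Equiv.refl _)

theorem IsSymmetric.curve_flip (hS : C.IsSymmetric m) (q : Label m) (s : ℝ) :
    C.curve (flip m q) s = -C.curve q (-s) := by
  obtain ⟨b, k⟩ := q
  cases b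
  · have := hS k k.2 (-s)
    rw [neg_neg] at this
    change C.leftCurve k s = -C.rightCurve k (-s)
    rw [this, neg_neg]
  · exact hS k k.2 s

theorem IsSymmetric.neg_mem_gamma (hS : C.IsSymmetric m) {b : Bool} {j : ℕ}
    (hj : j ∈ Finset.Icc 1 m) {z : ℂ} (hz : z ∈ C.gamma b j) : -z ∈ C.gamma (!b) j := by
  rw [mem_gamma_iff hj] at hz ⊢
  obtain ⟨q, rfl, hq, s, rfl⟩ := hz
  exact ⟨flip m q, rfl, hq, -s, by rw [hS.curve_flip, neg_neg]⟩

theorem IsSymmetric.neg_mem_set1 (hS : C.IsSymmetric m) (ζ : Fin (m - 1) → ℂ) {j : ℕ}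
    (hj : j ∈ Finset.Icc 1 m) {z : ℂ} (hz : z ∈ (kpzData ζ C).set1 j) :
    -z ∈ (kpzData ζ C).set2 j := by
  have hz : z ∈ C.set1 j := hz
  change -z ∈ C.set2 j
  rw [set1_eq] at hz
  rw [set2_eq]
  exact hS.neg_mem_gamma hj hz

theorem IsSymmetric.neg_mem_set2 (hS : C.IsSymmetric m) (ζ : Fin (m - 1) → ℂ) {j : ℕ}
    (hj : j ∈ Finset.Icc 1 m) {z : ℂ} (hz : z ∈ (kpzData ζ C).set2 j) :
    -z ∈ (kpzData ζ C).set1 j := by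
  have hz : z ∈ C.set2 j := hz
  change -z ∈ C.set1 j
  rw [set2_eq] at hz
  rw [set1_eq, ← Bool.not_not (decide (Odd j))]
  exact hS.neg_mem_gamma hj hz

theorem IsSymmetric.kpzP_neg (hS : C.IsSymmetric m) (ζ : Fin (m - 1) → ℂ) {j : ℕ}
    (hj : j ∈ Finset.Icc 1 m) (z : ℂ) : kpzP ζ C j (-z) = kpzP ζ C j z := by
  have hk : ((j : ℤ) - 1).natAbs < m := by
    rw [Finset.mem_Icc] at hj
    omega
  have h : ∀ z, z ∈ Set.range (C.rightCurve ((j : ℤ) - 1)) ↔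
      -z ∈ Set.range (C.leftCurve ((j : ℤ) - 1)) := fun z => by
    constructor
    · rintro ⟨s, rfl⟩
      exact ⟨-s, by rw [hS _ hk, neg_neg]⟩
    · rintro ⟨s, hs⟩
      exact ⟨-s, by rw [hS _ hk, neg_neg, hs, neg_neg]⟩
  have h' : -z ∈ Set.range (C.leftCurve ((j : ℤ) - 1)) ∪ Set.range (C.rightCurve ((j : ℤ) - 1)) ↔
      z ∈ Set.range (C.leftCurve ((j : ℤ) - 1)) ∪ Set.range (C.rightCurve ((j : ℤ) - 1)) := by
    rw [Set.mem_union, Set.mem_union, h, h, neg_neg, or_comm]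
  rw [kpzP, kpzP]
  by_cases hz : z ∈ Set.range (C.leftCurve ((j : ℤ) - 1)) ∪ Set.range (C.rightCurve ((j : ℤ) - 1))
  · rw [if_pos hz, if_pos (h'.2 hz)]
  · rw [if_neg hz, if_neg (mt h'.1 hz)]

theorem kpzP_ne_zero {ζ : Fin (m - 1) → ℂ} (hζ : ∀ i, 0 < ‖ζ i‖ ∧ ‖ζ i‖ < 1) {j : ℕ}
    (hj : j ∈ Finset.Icc 1 m) (z : ℂ) : kpzP ζ C j z ≠ 0 := by
  have h2 := Complex.two_pi_I_ne_zero
  have h3 := oneSub_ne_zero ζ hζ (j - 1)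
  rw [Finset.mem_Icc] at hj
  rw [kpzP]
  split_ifs with h
  · exact div_ne_zero one_ne_zero h2
  · exact div_ne_zero one_ne_zero (mul_ne_zero h2 h3)
  · refine div_ne_zero ?_ (mul_ne_zero h2 h3)
    rw [oneSub, dif_pos (by omega), sub_sub_cancel_left, neg_ne_zero, ← norm_pos_iff]
    exact (hζ _).1

namespace IsAdmissible

variable (hC : C.IsAdmissible m) (ζ : Fin (m - 1) → ℂ) {p : CubicParams m}
include hC

theorem kpzQ_set1 {j : ℕ} (hj : j ∈ Finset.Icc 1 m) {z : ℂ} (hz : z ∈ (kpzData ζ C).set1 j) :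
    kpzQ ζ C j z = if Odd j then -oneSubInv ζ (j - 1) else -oneSub ζ j := by
  have h1 : chi (C.set1 j) z = 1 := KernelData.chi_of_mem hz
  have h2 : chi (C.set2 j) z = 0 := KernelData.chi_of_notMem
    (Set.disjoint_left.1 ((hC.hasCells ζ).disj12 j hj j hj) hz)
  rw [kpzQ, h1, h2]
  split_ifs <;> ring

theorem kpzQ_set2 {j : ℕ} (hj : j ∈ Finset.Icc 1 m) {z : ℂ} (hz : z ∈ (kpzData ζ C).set2 j) :
    kpzQ ζ C j z = if Odd j then oneSub ζ j else oneSubInv ζ (j - 1) := by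
  have h1 : chi (C.set2 j) z = 1 := KernelData.chi_of_mem hz
  have h2 : chi (C.set1 j) z = 0 := KernelData.chi_of_notMem
    (Set.disjoint_right.1 ((hC.hasCells ζ).disj12 j hj j hj) hz)
  rw [kpzQ, h1, h2]
  split_ifs <;> ring

/-- The reflection preserves P_j and exchanges the two values of Q_j; the change is compensated by
the ratio of two consecutive weights. -/
theorem kpzB_neg (hS : C.IsSymmetric m) (hζ : ∀ i, 0 < ‖ζ i‖ ∧ ‖ζ i‖ < 1) {j : ℕ}
    (hj : j ∈ Finset.Icc 1 m) {z : ℂ} (hz : z ∈ (kpzData ζ C).set1 j) :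
    (kpzData ζ C).B j (-z) * weightL ζ (evenOf j) = (kpzData ζ C).B j z * weightL ζ (oddOf j) := by
  have h := weightL_mul ζ hζ (Finset.mem_Icc.1 hj).1
  simp only [kpzData]
  rw [hS.kpzP_neg ζ hj, hC.kpzQ_set1 ζ hj hz, hC.kpzQ_set2 ζ hj (hS.neg_mem_set1 ζ hj hz),
    evenOf, oddOf]
  split_ifs
  · linear_combination kpzP ζ C j z * h
  · linear_combination kpzP ζ C j z * h

/-- The function by which the kernels of the two operators are conjugated. -/
noncomputable def _root_.KPZ.reflectWeight (ζ : Fin (m - 1) → ℂ) (C : ContourSystem) (z : ℂ) : ℂ :=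
  (kpzData ζ C).glue m (fun j => (kpzData ζ C).B j z / weightL ζ (evenOf j))
    (fun j => (kpzData ζ C).B j z / weightL ζ (oddOf j)) z

theorem mem_carrier_iff {z : ℂ} :
    z ∈ (kpzData ζ C).Ω.carrier ↔ ∃ q : Label m, ∃ s, C.curve q s = z := by
  have : (kpzData ζ C).Ω = graphSet (C.profile (m := m)) := omega_eq
  rw [this, carrier_graphSet, Set.mem_iUnion]
  rfl

theorem reflectWeight_curve (q : Label m) (s : ℝ) :
    reflectWeight ζ C (C.curve q s) = reflectWeight ζ C (C.curve q 0) := by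
  rw [reflectWeight, reflectWeight]
  rcases hC.exists_side ζ q with ⟨-, hs⟩ | ⟨-, hs⟩
  · rw [(hC.hasCells ζ).glue1 (level_mem q) (hs s), (hC.hasCells ζ).glue1 (level_mem q) (hs 0),
      hC.kpzB_curve ζ q (level_mem q)]
  · rw [(hC.hasCells ζ).glue2 (level_mem q) (hs s), (hC.hasCells ζ).glue2 (level_mem q) (hs 0),
      hC.kpzB_curve ζ q (level_mem q)]

theorem reflectWeight_ne_zero (hζ : ∀ i, 0 < ‖ζ i‖ ∧ ‖ζ i‖ < 1) (q : Label m) (s : ℝ) :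
    reflectWeight ζ C (C.curve q s) ≠ 0 := by
  have hj := level_mem q
  have h1 := oneSub_ne_zero ζ hζ (level q)
  have h2 := oneSubInv_ne_zero ζ hζ (level q - 1)
  rw [reflectWeight]
  rcases hC.exists_side ζ q with ⟨-, hs⟩ | ⟨-, hs⟩
  · rw [(hC.hasCells ζ).glue1 hj (hs s)]
    refine div_ne_zero (mul_ne_zero ?_ (kpzP_ne_zero hζ hj _)) (weightL_ne_zero ζ hζ _)
    rw [hC.kpzQ_set1 ζ hj (hs s)]
    split_ifs
    · exact neg_ne_zero.2 h2
    · exact neg_ne_zero.2 h1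
  · rw [(hC.hasCells ζ).glue2 hj (hs s)]
    refine div_ne_zero (mul_ne_zero ?_ (kpzP_ne_zero hζ hj _)) (weightL_ne_zero ζ hζ _)
    rw [hC.kpzQ_set2 ζ hj (hs s)]
    split_ifs
    · exact h1
    · exact h2

theorem exists_isReflection (hS : C.IsSymmetric m) (hζ : ∀ i, 0 < ‖ζ i‖ ∧ ‖ζ i‖ < 1) :
    ∃ c, (kpzData ζ C).Ω.IsReflection (reflectWeight ζ C) c := by
  have hΩ : (kpzData ζ C).Ω = graphSet (C.profile (m := m)) := omega_eq
  have hd : ∀ q q', q ≠ q' → Disjoint (Set.range (graphCurve (C.profile (m := m) q)))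
      (Set.range (graphCurve (C.profile q'))) := fun _ _ => hC.disjoint_range
  -- `reflectWeight` is constant on each of the finitely many contours, so bounds for it and its
  -- inverse are maxima of finite sets.
  obtain ⟨c₁, h1⟩ := (Set.finite_range fun q : Label m =>
    ‖reflectWeight ζ C (C.curve q 0)‖).bddAbove
  obtain ⟨c₂, h2⟩ := (Set.finite_range fun q : Label m =>
    ‖(reflectWeight ζ C (C.curve q 0))⁻¹‖).bddAbove
  refine ⟨max c₁ c₂, ?_, ?_, ?_, ?_, ?_, ?_, ?_, ?_⟩
  · rw [hΩ]
    exact measurePreserving_neg_graphSet hS.curve_flip hC.continuous_profile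
  · exact (hC.hasCells ζ).measurable_glue
      (a := fun j z => (kpzData ζ C).B j z / weightL ζ (evenOf j))
      (b := fun j z => (kpzData ζ C).B j z / weightL ζ (oddOf j))
      (fun j hj => (hC.measurable_kpzB ζ hj).div_const _)
      fun j hj => (hC.measurable_kpzB ζ hj).div_const _
  · rw [hΩ]
    exact ae_mem_carrier_graphSet hC.lip
  · rw [hΩ]
    exact fun z hz => phase_neg_graphSet hS.curve_flip hd hz
  · rw [hΩ]
    exact norm_phase_graphSet hC.continuous_profile hd
  · intro z hz
    obtain ⟨q, s, rfl⟩ := (hC.mem_carrier_iff ζ).1 hz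
    exact hC.reflectWeight_ne_zero ζ hζ q s
  · intro z hz
    obtain ⟨q, s, rfl⟩ := (hC.mem_carrier_iff ζ).1 hz
    rw [hC.reflectWeight_curve]
    exact (h1 ⟨q, rfl⟩).trans (le_max_left _ _)
  · intro z hz
    obtain ⟨q, s, rfl⟩ := (hC.mem_carrier_iff ζ).1 hz
    rw [hC.reflectWeight_curve]
    exact (h2 ⟨q, rfl⟩).trans (le_max_right _ _)

/-- Once y changes sign with z, every term of the cubic exponent is odd; the sign of the side
changes as well. -/
theorem halfExp_neg (hS : C.IsSymmetric m) (q : Label m) (s : ℝ) :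
    (kpzData ζ C).halfExp p.negY (-C.curve q s) = (kpzData ζ C).halfExp p (C.curve q s) := by
  have e : -C.curve q s = C.curve (flip m q) (-s) := by rw [hS.curve_flip, neg_neg]
  have hexpo : ∀ j z, p.negY.expo j (-z) = -p.expo j z := fun j z => by
    rw [CubicParams.expo, CubicParams.expo, CubicParams.negY]
    split_ifs
    · simp only [Pi.neg_apply]
      push_cast
      ring
    · simp
  have hl : level (flip m q) = level q := rfl
  have hs : sideSign (flip m q).1 = -sideSign q.1 := by
    obtain ⟨b, k⟩ := q
    cases b <;> simp [flip, sideSign]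
  rw [e, hC.halfExp_curve, hC.halfExp_curve, ← e, hl, hs, hexpo, hexpo]
  congr 1
  push_cast
  ring

theorem g_eq_reflect (hS : C.IsSymmetric m) (hζ : ∀ i, 0 < ‖ζ i‖ ∧ ‖ζ i‖ < 1) {z : ℂ}
    (hz : z ∈ (kpzData ζ C).Ω.carrier) (n : Fin (m + 1)) :
    ((kpzData ζ C).family m).g p z n =
        reflectWeight ζ C z * diagL ζ n * ((kpzData ζ C).family m).f p.negY (-z) n ∧
      ((kpzData ζ C).family m).g p.negY (-z) n =
        reflectWeight ζ C z * diagL ζ n * ((kpzData ζ C).family m).f p z n := by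
  have hK := hC.hasCells ζ
  obtain ⟨q, s, rfl⟩ := (hC.mem_carrier_iff ζ).1 hz
  have hj := level_mem q
  have w1 := weightL_ne_zero ζ hζ (evenOf (level q))
  have w2 := weightL_ne_zero ζ hζ (oddOf (level q))
  have d1 := diagL_idx ζ (evenOf_le hj)
  have d2 := diagL_idx ζ (oddOf_le hj)
  have hA : ∀ j z, (kpzData ζ C).A j z = 1 := fun _ _ => rfl
  rw [hK.g_eq, hK.g_eq, hK.f_eq, hK.f_eq, hC.halfExp_neg ζ hS, reflectWeight]
  simp only [KernelData.family_F, KernelData.family_G, hA]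
  rcases hC.exists_side ζ q with ⟨-, hs⟩ | ⟨-, hs⟩
  · have hs' := hS.neg_mem_set1 ζ hj (hs s)
    have hB := hC.kpzB_neg ζ hS hζ hj (hs s)
    rw [hK.glue1 hj (hs s), hK.glue1 hj (hs s), hK.glue1 hj (hs s), hK.glue2 hj hs',
      hK.glue2 hj hs']
    constructor
    · split_ifs with h
      · rw [h, d1]
        field_simp
      · ring
    · split_ifs with h
      · rw [h, d2]
        field_simp
        linear_combination (kpzData ζ C).halfExp p (C.curve q s) * hB
      · ring
  · have hs' := hS.neg_mem_set2 ζ hj (hs s)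
    have hB := hC.kpzB_neg ζ hS hζ hj hs'
    rw [neg_neg] at hB
    rw [hK.glue2 hj (hs s), hK.glue2 hj (hs s), hK.glue2 hj (hs s), hK.glue1 hj hs',
      hK.glue1 hj hs']
    constructor
    · split_ifs with h
      · rw [h, d2]
        field_simp
      · ring
    · split_ifs with h
      · rw [h, d1]
        field_simp
        linear_combination -(kpzData ζ C).halfExp p (C.curve q s) * hB
      · ring

/-- The symmetry of `Y₁` under the change of the sign of `y`. -/
theorem Y1_negY (hS : C.IsSymmetric m) (hζ : ∀ i, 0 < ‖ζ i‖ ∧ ‖ζ i‖ < 1) (hp : C.Decays p)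
    (hp' : C.Decays p.negY) (hu : IsUnit (1 - ((kpzData ζ C).family m).operator p)) :
    IsUnit (1 - ((kpzData ζ C).family m).operator p.negY) ∧
      kpzL ζ * ((kpzData ζ C).family m).Y1 p * (kpzL ζ)⁻¹ =
        (((kpzData ζ C).family m).Y1 p.negY).transpose := by
  obtain ⟨c, hR⟩ := hC.exists_isReflection ζ hS hζ
  obtain ⟨φ, ψ, hφ, hψ, hK⟩ := hC.exists_sqFamily ζ hp
  have : SigmaFinite ((kpzData ζ C).family m).Ω.absMeasure := hC.sigmaFinite ζ
  exact CubicFamily.Y1_of_isReflection _ hR (hC.phaseRegular ζ) hφ hψ hK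
    (hC.fredholm ζ hp).2.1 (hC.fredholm ζ hp').2.1 (diagL_ne_zero ζ hζ)
    (fun z hz i => (hC.g_eq_reflect ζ hS hζ hz i).1)
    (fun z hz i => (hC.g_eq_reflect ζ hS hζ hz i).2) hu

end IsAdmissible

end ContourSystem

end KPZ

/-! ### Assembly of the main theorem. -/

theorem mainTheorem3 (m : ℕ) (hm : 1 ≤ m) :
    -- the KPZ fixed point
    (∀ ζ : Fin (m - 1) → ℂ, (∀ i, 0 < ‖ζ i‖ ∧ ‖ζ i‖ < 1) →
      ∀ C : KPZ.ContourSystem, C.IsAdmissible m →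
        -- strictly increasing times, all admissible contours
        ((∀ p ∈ KPZ.kpzStrictRegion m, (KPZ.kpzData ζ C).WellDefined m p) ∧
          ((KPZ.kpzData ζ C).family m).IsStronglyAdmissibleDet (KPZ.kpzStrictRegion m)
            (fun p => KPZ.kpzDet ζ C p.x p.y (fun i => -3 * p.t i))) ∧
        -- nondecreasing times, contours ending in the smaller sectors
        (C.EndsIn (3 * Real.pi / 4) (Real.pi / 4) →
          (∀ p ∈ KPZ.kpzRegion m, (KPZ.kpzData ζ C).WellDefined m p) ∧
            ((KPZ.kpzData ζ C).family m).IsStronglyAdmissibleDet (KPZ.kpzRegion m)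
              (fun p => KPZ.kpzDet ζ C p.x p.y (fun i => -3 * p.t i))) ∧
        -- the symmetry
        (C.IsSymmetric m → ∀ p ∈ KPZ.kpzStrictRegion m,
          IsUnit (1 - ((KPZ.kpzData ζ C).family m).operator p) →
            IsUnit (1 - ((KPZ.kpzData ζ C).family m).operator p.negY) ∧
              KPZ.kpzL ζ * ((KPZ.kpzData ζ C).family m).Y1 p * (KPZ.kpzL ζ)⁻¹ =
                (((KPZ.kpzData ζ C).family m).Y1 p.negY).transpose)) ∧
    -- the periodic KPZ fixed point
    (∀ ζ : Fin m → ℂ, (∀ i, 0 < ‖ζ i‖ ∧ ‖ζ i‖ < 1) → (∀ i j, i < j → ‖ζ i‖ < ‖ζ j‖) →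
      (∀ p ∈ KPZ.perRegion m, (KPZ.perData ζ).WellDefined m p) ∧
        ((KPZ.perData ζ).family m).IsAdmissibleDet (KPZ.perRegion m)
          (fun p => KPZ.perDet ζ p.x (fun i => 2 * p.y i) (fun i => -3 * p.t i))) := by
  refine ⟨fun ζ hζ C hC => ⟨⟨fun p hp => (hC.fredholm ζ (hC.decays_strict hp)).1,
    hC.isPiecewiseConstant ζ, fun p hp => ?_⟩, fun hE => ⟨fun p hp =>
      (hC.fredholm ζ (hC.decays hE hp)).1, hC.isPiecewiseConstant ζ, fun p hp => ?_⟩, ?_⟩, ?_⟩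
  · simp only [KPZ.kpzDet_eq]
    exact (hC.fredholm ζ (hC.decays_strict hp)).2
  · simp only [KPZ.kpzDet_eq]
    exact (hC.fredholm ζ (hC.decays hE hp)).2
  · intro hS p hp hu
    -- The strict region constrains only t, so it contains `p.negY` along with p; in `kpzRegion` the
    -- condition on y would be reversed.
    exact hC.Y1_negY ζ hS hζ (hC.decays_strict hp) (hC.decays_strict (p := p.negY) hp) hu
  · intro ζ h1 h2
    refine ⟨fun p hp => (KPZ.perData_fredholm h1 h2 hp).1, fun p hp => ?_⟩
    simp only [KPZ.perDet_eq]
    exact (KPZ.perData_fredholm h1 h2 hp).2
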